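/- Let $S$ be a family of $m$ non-degenerate closed line segments in the plane, each horizontal or vertical, and let $P$ be the family of its $n=2m$ endpoints. The segment intersection problem asks whether two different segments of $S$ have a common point. Let $A_x$ and $A_y$ be arrays that list $P$ sorted by $x$-coordinate and by $y$-coordinate respectively (ties in any order), and let $\pi$ be the permutation with $A_x[i]=A_y[\pi(i)]$ for all $i$. For every entry of $A_x$ it is known to which segment it belongs. (a) (Lower bound, given only $A_x$.) A comparison-based algorithm is modelled by a ternary decision tree whose internal nodes compare an affine combination of the coordinates of the points $A_x[1],\dots,A_x[n]$ with a constant (in particular, any two coordinates may be compared) and branch on $<,=,>$; the tree may depend on $n$ and on the assignment of the entries of $A_x$ to the endpoints of the segments. Solving the problem has an $\Omega(n\log n)$ lower bound in this model: there is a constant $c>0$ such that for all sufficiently large $m$ there is an assignment of the $n=2m$ entries of $A_x$ to the endpoints of the $m$ segments such that every decision tree that answers correctly on all inputs with this assignment whose array $A_x$ is sorted by $x$-coordinate performs at least $c\,n\log n$ comparisons on some such input. (b) (Upper bound, given a 2-presorting.) There is a deterministic Real RAM program that, given $n$, the coordinates of the points in $A_x$ and $A_y$, the permutation $\pi$, and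 for every entry of $A_x$ the index of its segment, decides whether two different segments of $S$ intersect, in $O(n\log\log n)$ worst-case time. Here the Real RAM has integer cells and real cells; its unit-cost instructions are $+,-,\times$ on integers, $+,-,\times,/$ on reals, loading an integer constant, conversion of an integer to a real, comparisons $=,<$ (with an integer $0/1$ outcome), indirect addressing through integer cells, conditional jumps, and halting; there is no rounding and no integer division. -/

import Mathlib

open Filter Asymptotics

/-! ## Horizontal and vertical segments, and sortings of their endpoints -/

/-- A family of `m` axis-parallel (horizontal or vertical) line segments in the plane. The `i`-th
segment has the two distinct endpoints `endpt (i, false)` and `endpt (i, true)`. -/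
structure AxisSegments (m : ℕ) where
  endpt : Fin m × Bool → ℝ × ℝ
  axis_parallel : ∀ i, (endpt (i, false)).1 = (endpt (i, true)).1 ∨
    (endpt (i, false)).2 = (endpt (i, true)).2
  nondegenerate : ∀ i, endpt (i, false) ≠ endpt (i, true)

namespace AxisSegments

variable {m : ℕ}

/-- The `i`-th segment as a closed set of points of the plane. -/
def seg (S : AxisSegments m) (i : Fin m) : Set (ℝ × ℝ) :=
  segment ℝ (S.endpt (i, false)) (S.endpt (i, true))

/-- Some two segments of the family have a common point. -/
def Intersecting (S : AxisSegments m) : Prop :=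
  ∃ i j : Fin m, i ≠ j ∧ (S.seg i ∩ S.seg j).Nonempty

/-- The array `k ↦ S.endpt (e k)` lists all `2 * m` endpoints, sorted by `x`-coordinate (ties in
any order). The bijection `e` says which endpoint of which segment is stored in each entry. -/
def SortedByX (S : AxisSegments m) (e : Fin (2 * m) ≃ Fin m × Bool) : Prop :=
  Monotone fun k => (S.endpt (e k)).1

/-- The array `k ↦ S.endpt (e k)` lists all `2 * m` endpoints, sorted by `y`-coordinate (ties in
any order). -/
def SortedByY (S : AxisSegments m) (e : Fin (2 * m) ≃ Fin m × Bool) : Prop :=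
  Monotone fun k => (S.endpt (e k)).2

/-- The real numbers stored in the endpoint array `k ↦ S.endpt (e k)`: the entry `(k, false)` is
the `x`-coordinate, and the entry `(k, true)` the `y`-coordinate, of the `k`-th point. -/
def coords (S : AxisSegments m) (e : Fin (2 * m) ≃ Fin m × Bool) : Fin (2 * m) × Bool → ℝ :=
  fun q => if q.2 then (S.endpt (e q.1)).2 else (S.endpt (e q.1)).1

end AxisSegments

/-! ## Comparison-based decision trees -/

/-- Decision trees that access a real input vector `x : ι → ℝ` only through three-way comparisons
of affine combinations of its entries: an internal node compares `∑ i, w i * x i` with `c`. In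
particular every comparison `x i : x j` of two entries, and every comparison of an entry with a
constant, is available. The leaves carry the answer. -/
inductive ComparisonTree (ι : Type) : Type
  | leaf (answer : Bool) : ComparisonTree ι
  | node (w : ι → ℝ) (c : ℝ) (lt eq gt : ComparisonTree ι) : ComparisonTree ι

namespace ComparisonTree

variable {ι : Type} [Fintype ι]

/-- The answer of the tree on the input `x`. -/
noncomputable def eval (x : ι → ℝ) : ComparisonTree ι → Bool
  | leaf b => b
  | node w c lt eq gt =>
      if ∑ i, w i * x i < c then eval x lt
      else if ∑ i, w i * x i = c then eval x eq
      else eval x gt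

/-- The number of comparisons that the tree performs on the input `x`. -/
noncomputable def cost (x : ι → ℝ) : ComparisonTree ι → ℕ
  | leaf _ => 0
  | node w c lt eq gt =>
      1 + (if ∑ i, w i * x i < c then cost x lt
        else if ∑ i, w i * x i = c then cost x eq
        else cost x gt)

end ComparisonTree

/-! ## The Real RAM -/

namespace RealRAM

/-- Instructions of a (deterministic) Real RAM. Every cell is designated either for integers or for
reals. Cells with a fixed address in the program are called registers; the main memory, which is an
unbounded sequence of integer cells and an unbounded sequence of real cells, is accessed indirectly
through an address in an integer register. Real values never flow into integer cells, except through
the Boolean outcome of a comparison; there is neither rounding nor integer division. -/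
inductive Instr : Type
  /- integer register `d` := the constant `k` -/
  | iconst (d : ℕ) (k : ℤ)
  /- arithmetic on integer registers: register `d` := `a ∘ b` -/
  | iadd (d a b : ℕ)
  | isub (d a b : ℕ)
  | imul (d a b : ℕ)
  /- comparison of integer registers `a` and `b`; integer register `d` := 1 (true) or 0 (false) -/
  | ieq (d a b : ℕ)
  | ilt (d a b : ℕ)
  /- integer register `d` := integer memory cell whose address is in integer register `a` -/
  | iload (d a : ℕ)
  /- integer memory cell whose address is in integer register `a` := integer register `s` -/
  | istore (a s : ℕ)
  /- real register `d` := integer register `s`, regarded as a real number -/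
  | rofInt (d s : ℕ)
  /- arithmetic on real registers: register `d` := `a ∘ b` -/
  | radd (d a b : ℕ)
  | rsub (d a b : ℕ)
  | rmul (d a b : ℕ)
  | rdiv (d a b : ℕ)
  /- comparison of real registers `a` and `b`; integer register `d` := 1 (true) or 0 (false) -/
  | req (d a b : ℕ)
  | rlt (d a b : ℕ)
  /- real register `d` := real memory cell whose address is in integer register `a` -/
  | rload (d a : ℕ)
  /- real memory cell whose address is in integer register `a` := real register `s` -/
  | rstore (a s : ℕ)
  /- if integer register `b` is nonzero (true), continue with instruction number `target` -/
  | jumpIf (b target : ℕ)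
  | halt

/-- A program is a finite sequence of instructions, numbered from `0`. -/
abbrev Program : Type := List Instr

/-- A state of the machine: the number of the current instruction and the contents of the integer
registers, the real registers, the integer memory cells and the real memory cells. -/
structure State where
  pc : ℕ
  ireg : ℕ → ℤ
  rreg : ℕ → ℝ
  imem : ℕ → ℤ
  rmem : ℕ → ℝ

namespace State

/-- Write an integer register and proceed to the next instruction. -/
def setI (s : State) (d : ℕ) (v : ℤ) : State :=
  { s with pc := s.pc + 1, ireg := Function.update s.ireg d v }

/-- Write a real register and proceed to the next instruction. -/
def setR (s : State) (d : ℕ) (v : ℝ) : State :=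
  { s with pc := s.pc + 1, rreg := Function.update s.rreg d v }

end State

/-- The effect of one instruction. There is no successor state after `halt`, nor after an illegal
operation (a negative address or a division by zero). -/
noncomputable def exec (s : State) : Instr → Option State
  | .iconst d k => some (s.setI d k)
  | .iadd d a b => some (s.setI d (s.ireg a + s.ireg b))
  | .isub d a b => some (s.setI d (s.ireg a - s.ireg b))
  | .imul d a b => some (s.setI d (s.ireg a * s.ireg b))
  | .ieq d a b => some (s.setI d (if s.ireg a = s.ireg b then 1 else 0))
  | .ilt d a b => some (s.setI d (if s.ireg a < s.ireg b then 1 else 0))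
  | .iload d a => if 0 ≤ s.ireg a then some (s.setI d (s.imem (s.ireg a).toNat)) else none
  | .istore a t =>
      if 0 ≤ s.ireg a then
        some { s with
          pc := s.pc + 1, imem := Function.update s.imem (s.ireg a).toNat (s.ireg t) }
      else none
  | .rofInt d t => some (s.setR d (s.ireg t : ℝ))
  | .radd d a b => some (s.setR d (s.rreg a + s.rreg b))
  | .rsub d a b => some (s.setR d (s.rreg a - s.rreg b))
  | .rmul d a b => some (s.setR d (s.rreg a * s.rreg b))
  | .rdiv d a b => if s.rreg b = 0 then none else some (s.setR d (s.rreg a / s.rreg b))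
  | .req d a b => some (s.setI d (if s.rreg a = s.rreg b then 1 else 0))
  | .rlt d a b => some (s.setI d (if s.rreg a < s.rreg b then 1 else 0))
  | .rload d a => if 0 ≤ s.ireg a then some (s.setR d (s.rmem (s.ireg a).toNat)) else none
  | .rstore a t =>
      if 0 ≤ s.ireg a then
        some { s with
          pc := s.pc + 1, rmem := Function.update s.rmem (s.ireg a).toNat (s.rreg t) }
      else none
  | .jumpIf b target => some { s with pc := if s.ireg b ≠ 0 then target else s.pc + 1 }
  | .halt => none

/-- One step of the program `P`. -/
noncomputable def step (P : Program) (s : State) : Option State :=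
  P[s.pc]?.bind (exec s)

/-- `Runs P t s s'`: from the state `s`, the program `P` reaches the state `s'` by executing exactly
`t` instructions. -/
inductive Runs (P : Program) : ℕ → State → State → Prop
  | refl (s : State) : Runs P 0 s s
  | head {t : ℕ} {s s' s'' : State} : step P s = some s' → Runs P t s' s'' → Runs P (t + 1) s s''

/-- The initial state for an input that consists of the size parameter `n`, the integers `B` and the
reals `A`. The input occupies the first cells of the memory, and integer register `0` contains `n`;
all other cells contain `0`. -/
def init (n : ℕ) (B : List ℕ) (A : List ℝ) : State where
  pc := 0
  ireg := fun k => if k = 0 then (n : ℤ) else 0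
  rreg := fun _ => 0
  imem := fun k => (B.getD k 0 : ℤ)
  rmem := fun k => A.getD k 0

/-- Started in the state `s`, the program `P` executes at most `T` instructions, then arrives at a
`halt` instruction, and at that time integer register `0` contains the truth value of `Q`
(`1` for true, `0` for false). -/
def DecidesWithin (P : Program) (s : State) (T : ℕ) (Q : Prop) : Prop :=
  ∃ (t : ℕ) (s' : State), t ≤ T ∧ Runs P t s s' ∧ P[s'.pc]? = some Instr.halt ∧
    ((Q ∧ s'.ireg 0 = 1) ∨ (¬ Q ∧ s'.ireg 0 = 0))

end RealRAM

/-! ## Input of the segment intersection problem with a 2-presorting -/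

namespace AxisSegments

variable {m : ℕ}

/-- The array of points `k ↦ S.endpt (e k)` as a list of reals: `x₀, y₀, x₁, y₁, …`. -/
def pointArray (S : AxisSegments m) (e : Fin (2 * m) ≃ Fin m × Bool) : List ℝ :=
  (List.finRange (2 * m)).flatMap fun k => [(S.endpt (e k)).1, (S.endpt (e k)).2]

/-- The Real RAM input for the two endpoint arrays `A_x = S.endpt ∘ ex` and `A_y = S.endpt ∘ ey`.
The reals are the entries of `A_x`, followed by those of `A_y`. The integers are the entries of the
permutation `π` with `A_x[k] = A_y[π k]`, followed by the number of the segment to which `A_x[k]`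
belongs, for each `k`. The size parameter is the number `2 * m` of endpoints. -/
def ramInput (S : AxisSegments m) (ex ey : Fin (2 * m) ≃ Fin m × Bool) : RealRAM.State :=
  RealRAM.init (2 * m)
    ((List.finRange (2 * m)).map (fun k => ((ex.trans ey.symm) k : ℕ)) ++
      (List.finRange (2 * m)).map (fun k => ((ex k).1 : ℕ)))
    (S.pointArray ex ++ S.pointArray ey)

end AxisSegments

/-! Lower bound. Horizontal segments from `(0, y i)` to `(1, y i)`, listed with all left endpoints
first, are sorted by `x` whatever the heights are, so the problem contains element distinctness for
the `y i`. The inputs that follow one path of a decision tree form a convex set on which the answer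
is constant (`path_convex`). Two different permutations, taken as heights, order some pair of
segments oppositely. If they shared a path, a convex combination in which this pair has equal
heights would get the answer "disjoint" that is correct for the permutations (`path_injective`). So
a correct tree has at least `m!` paths, and some path has length of order `log m!`.

Upper bound. The presorting allows every coordinate to be replaced by an integer rank below `n`, by
comparing neighbours only; the permutation carries ranks from one order to the other. Collinear
overlaps are found first: on each line the segments appear by increasing start, and a new start has
only to be compared with the last end (`conflict_succ`, `LastEnd.succ`). If there is no such
conflict, a left-to-right sweep has at most one active horizontal segment per line, so the active
segments form a set of integers that changes by insertions and deletions. A vertical segment meets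
an active one if this set has an element between the ranks of its ends (`active_insert`,
`active_delete`, `crossing_succ`).

The set is kept in a van Emde Boas tree in which both extreme elements of a node are stored outside
of its clusters. Then filling an empty cluster or clearing a singleton takes constant time, so
insertion, deletion and range search make only one recursive call, into a universe of square root
size (`ins_spec`, `del_spec`, `qry_spec`). There are `O(log log n)` levels. The machine has no
integer division, so quotients and remainders are tabulated for each level by counting, in `O(n)`
per level. The memory is initially zero and zero encodes the empty tree, so the large address space
costs nothing.

To verify a concrete program, a small structured language is compiled to the machine with a constant
factor in time (`Cmd.correct`). The tail-recursive tree operations become loops that run once per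
level, and the sweep makes at most `3 * n` steps. -/

/-! ## Lower bound: linear decision trees on horizontal segments -/

namespace ComparisonTree

variable {ι : Type} [Fintype ι]

/-- The outcomes of the comparisons that the tree performs on the input `x`. -/
noncomputable def path (x : ι → ℝ) : ComparisonTree ι → List (Fin 3)
  | leaf _ => []
  | node w c lt eq gt =>
      if ∑ i, w i * x i < c then 0 :: path x lt
      else if ∑ i, w i * x i = c then 1 :: path x eq
      else 2 :: path x gt

theorem length_path (x : ι → ℝ) (T : ComparisonTree ι) : (T.path x).length = T.cost x := by
  induction T with
  | leaf b => rfl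
  | node w c lt eq gt h1 h2 h3 =>
    simp only [path, cost]
    split_ifs <;> simp [*, add_comm]

/-- Each outcome of a comparison of an affine form with a constant cuts out a convex set, so the
inputs with a prescribed list of outcomes form a convex set, and all of them end in the same leaf.
-/
theorem path_convex (x y : ι → ℝ) (s : ℝ) (h0 : 0 ≤ s) (h1 : s ≤ 1) (T : ComparisonTree ι)
    (h : T.path x = T.path y) :
    T.path (fun i => (1 - s) * x i + s * y i) = T.path x ∧ T.eval x = T.eval y ∧
      T.eval (fun i => (1 - s) * x i + s * y i) = T.eval x := by
  induction T with
  | leaf b => simp [path, eval]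
  | node w c lt eq gt i1 i2 i3 =>
    have key : ∑ i, w i * ((1 - s) * x i + s * y i)
        = (1 - s) * ∑ i, w i * x i + s * ∑ i, w i * y i := by
      rw [Finset.mul_sum, Finset.mul_sum, ← Finset.sum_add_distrib]
      exact Finset.sum_congr rfl fun i _ => by ring
    simp only [path, eval, key] at h ⊢
    generalize ∑ i, w i * x i = a at *
    generalize ∑ i, w i * y i = b at *
    rcases lt_trichotomy a c with ha | ha | ha <;> rcases lt_trichotomy b c with hb | hb | hb
    · have : (1 - s) * a + s * b < c := by
        rcases h0.eq_or_lt with rfl | hs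
        · simpa using ha
        · nlinarith
      simp only [ha, hb, this, if_true, List.cons.injEq, true_and] at h ⊢
      exact i1 h
    · simp [ha, hb] at h
    · simp [ha, not_lt.2 hb.le, hb.ne'] at h
    · simp [ha, hb] at h
    · have : (1 - s) * a + s * b = c := by rw [ha, hb]; ring
      simp only [ha, hb, lt_irrefl, if_false, if_true, List.cons.injEq, true_and] at h ⊢
      have h2 : (1 - s) * c + s * c = c := by ring
      simp only [h2, lt_irrefl, if_false, if_true, List.cons.injEq, true_and]
      exact i2 h
    · simp [ha, not_lt.2 hb.le, hb.ne'] at h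
    · simp [hb, not_lt.2 ha.le, ha.ne'] at h
    · simp [hb, not_lt.2 ha.le, ha.ne'] at h
    · have : c < (1 - s) * a + s * b := by
        rcases h0.eq_or_lt with rfl | hs
        · simpa using ha
        · nlinarith
      simp only [not_lt.2 ha.le, ha.ne', not_lt.2 hb.le, hb.ne', not_lt.2 this.le, this.ne',
        if_false, List.cons.injEq, true_and] at h ⊢
      exact i3 h

end ComparisonTree

namespace AxisSegments

/-- The horizontal segments from `(0, y i)` to `(1, y i)`. -/
def unitHorizontal {m : ℕ} (y : Fin m → ℝ) : AxisSegments m where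
  endpt q := (if q.2 then 1 else 0, y q.1)
  axis_parallel i := Or.inr rfl
  nondegenerate i := by simp

/-- This is element distinctness: all these segments span the same `x`-interval. -/
theorem unitHorizontal_intersecting {m : ℕ} (y : Fin m → ℝ) :
    (unitHorizontal y).Intersecting ↔ ∃ i j, i ≠ j ∧ y i = y j := by
  have hs : ∀ i, (unitHorizontal y).seg i = (fun x => (x, y i)) '' segment ℝ (0 : ℝ) 1 := by
    intro i
    rw [Prod.image_mk_segment_left]
    simp [seg, unitHorizontal]
  constructor
  · rintro ⟨i, j, hij, p, hi, hj⟩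
    rw [hs] at hi hj
    obtain ⟨_, -, rfl⟩ := hi
    obtain ⟨_, -, h⟩ := hj
    exact ⟨i, j, hij, (Prod.ext_iff.1 h).2.symm⟩
  · rintro ⟨i, j, hij, h⟩
    refine ⟨i, j, hij, (0, y i), ?_, ?_⟩
    · rw [hs]
      exact ⟨0, left_mem_segment ℝ _ _, rfl⟩
    · rw [hs, h]
      exact ⟨0, left_mem_segment ℝ _ _, rfl⟩

/-- The assignment that lists all left endpoints before all right endpoints. -/
def leftThenRight (m : ℕ) : Fin (2 * m) ≃ Fin m × Bool :=
  (finProdFinEquiv.symm.trans (finTwoEquiv.prodCongr (Equiv.refl _))).trans (Equiv.prodComm _ _)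

/-- The abscissa of an entry depends only on its index divided by `m`, not on the heights. The given
order therefore reveals nothing about `y`. -/
theorem unitHorizontal_sortedByX {m : ℕ} (y : Fin m → ℝ) :
    (unitHorizontal y).SortedByX (leftThenRight m) := by
  intro a b hab
  have h2 : (finProdFinEquiv.symm a).1 ≤ (finProdFinEquiv.symm b).1 := by
    simp only [finProdFinEquiv_symm_apply]
    exact Nat.div_le_div_right (c := m) hab
  simp only [unitHorizontal, leftThenRight, Equiv.trans_apply, Equiv.prodCongr_apply,
    Equiv.prodComm_apply, Prod.map, Prod.swap]
  generalize (finProdFinEquiv.symm a).1 = u at *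
  generalize (finProdFinEquiv.symm b).1 = v at *
  revert h2
  fin_cases u <;> fin_cases v <;> simp [finTwoEquiv]

theorem coords_unitHorizontal_convex {m : ℕ} (y z : Fin m → ℝ) (s : ℝ)
    (e : Fin (2 * m) ≃ Fin m × Bool) :
    (unitHorizontal fun i => (1 - s) * y i + s * z i).coords e =
      fun q => (1 - s) * (unitHorizontal y).coords e q + s * (unitHorizontal z).coords e q := by
  funext q
  simp only [coords, unitHorizontal]
  split_ifs <;> simp

/-- Without an inversion, `τ ∘ σ⁻¹` would be an increasing bijection of a finite chain, hence the
identity. -/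
theorem exists_inversion {m : ℕ} {σ τ : Equiv.Perm (Fin m)} (h : σ ≠ τ) :
    ∃ i j, σ i < σ j ∧ τ j < τ i := by
  by_contra! hc
  apply h
  have hm : StrictMono (σ.symm.trans τ) := by
    intro a b hab
    have := hc (σ.symm a) (σ.symm b) (by simpa using hab)
    refine lt_of_le_of_ne this fun h => hab.ne ?_
    simpa using h
  have h2 : σ.symm.trans τ = Equiv.refl _ := by
    ext a
    have := (Subsingleton.elim (hm.orderIsoOfSurjective _ (Equiv.surjective _)) (OrderIso.refl _))
    have h3 := DFunLike.congr_fun this a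
    simpa using congrArg Fin.val h3
  ext a
  have := DFunLike.congr_fun h2 (σ a)
  simpa using (congrArg Fin.val this).symm

/-- The inputs whose heights are permutations take pairwise different paths in a correct tree. -/
theorem path_injective {m : ℕ} (e : Fin (2 * m) ≃ Fin m × Bool)
    (hs : ∀ y : Fin m → ℝ, (unitHorizontal y).SortedByX e)
    (T : ComparisonTree (Fin (2 * m) × Bool))
    (hT : ∀ S : AxisSegments m, S.SortedByX e → (T.eval (S.coords e) = true ↔ S.Intersecting)) :
    Function.Injective fun σ : Equiv.Perm (Fin m) =>
      T.path ((unitHorizontal fun i => ((σ i : ℕ) : ℝ)).coords e) := by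
  intro σ τ h
  by_contra hne
  obtain ⟨i, j, h1, h2⟩ := exists_inversion hne
  have h1' : ((σ i : ℕ) : ℝ) < (σ j : ℕ) := by exact_mod_cast h1
  have h2' : ((τ j : ℕ) : ℝ) < (τ i : ℕ) := by exact_mod_cast h2
  set p : ℝ := (σ j : ℕ) - (σ i : ℕ) with hp
  set q : ℝ := (τ i : ℕ) - (τ j : ℕ) with hq
  have hp0 : 0 < p := by rw [hp]; linarith
  have hq0 : 0 < q := by rw [hq]; linarith
  -- Along the line from `σ` to `τ` the gap between the heights of `j` and `i` goes linearly from
  -- `p` to `-q`; it vanishes at the parameter `p / (p + q)`.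
  have hc := ComparisonTree.path_convex _ _ (p / (p + q)) (by positivity)
    (by rw [div_le_one (by positivity)]; linarith) T h
  rw [← coords_unitHorizontal_convex] at hc
  have hI := (hT _ (hs _)).2 ((unitHorizontal_intersecting
    (fun i => (1 - p / (p + q)) * ((σ i : ℕ) : ℝ) + p / (p + q) * ((τ i : ℕ) : ℝ))).2
    ⟨i, j, fun h => by simp [h] at h1, by
      have : p + q ≠ 0 := by positivity
      field_simp
      rw [hp, hq]; ring⟩)
  rw [hc.2.2] at hI
  obtain ⟨a, b, hab, h3⟩ := (unitHorizontal_intersecting _).1 ((hT _ (hs _)).1 hI)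
  apply hab
  apply σ.injective
  apply Fin.ext
  exact_mod_cast h3

/-- A path of length at most `h` is determined by its first `h` entries. Each of them is one of
three outcomes or missing, which gives the base `4`. -/
theorem factorial_le_of_cost_le {m : ℕ} (e : Fin (2 * m) ≃ Fin m × Bool)
    (hs : ∀ y : Fin m → ℝ, (unitHorizontal y).SortedByX e)
    (T : ComparisonTree (Fin (2 * m) × Bool))
    (hT : ∀ S : AxisSegments m, S.SortedByX e → (T.eval (S.coords e) = true ↔ S.Intersecting))
    (h : ℕ) (hh : ∀ S : AxisSegments m, S.SortedByX e → T.cost (S.coords e) ≤ h) :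
    m.factorial ≤ 4 ^ h := by
  have hinj : Function.Injective fun (σ : Equiv.Perm (Fin m)) (k : Fin h) =>
      (T.path ((unitHorizontal fun i => ((σ i : ℕ) : ℝ)).coords e))[(k : ℕ)]? := by
    intro σ τ hst
    apply path_injective e hs T hT
    apply List.ext_getElem?
    intro k
    by_cases hk : k < h
    · exact congrFun hst ⟨k, hk⟩
    · rw [List.getElem?_eq_none, List.getElem?_eq_none]
      all_goals
        rw [ComparisonTree.length_path]
        exact (hh _ (hs _)).trans (not_lt.1 hk)
  have := Fintype.card_le_of_injective _ hinj
  simpa [Fintype.card_perm] using this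

/-- With costs below `H = m log (2m) / 10`, the inequalities `m! ≤ 4 ^ H` and `m ^ m ≤ m! * exp m`
give `m log m ≤ 2 H + m ≤ m (1 + log m) / 5 + m`, which is false for `log m ≥ 4`. -/
theorem exists_cost_lower_bound {m : ℕ} (hm : 4 ≤ Real.log m)
    (e : Fin (2 * m) ≃ Fin m × Bool)
    (hs : ∀ y : Fin m → ℝ, (unitHorizontal y).SortedByX e)
    (T : ComparisonTree (Fin (2 * m) × Bool))
    (hT : ∀ S : AxisSegments m, S.SortedByX e → (T.eval (S.coords e) = true ↔ S.Intersecting)) :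
    ∃ S : AxisSegments m, S.SortedByX e ∧
      1 / 20 * ((2 * m : ℕ) : ℝ) * Real.log ((2 * m : ℕ) : ℝ) ≤ (T.cost (S.coords e) : ℝ) := by
  by_contra! hc
  have hm0 : 0 < m := by
    rcases Nat.eq_zero_or_pos m with rfl | h
    · norm_num at hm
    · exact h
  have hmR : (1 : ℝ) ≤ m := by exact_mod_cast hm0
  set H : ℝ := 1 / 20 * ((2 * m : ℕ) : ℝ) * Real.log ((2 * m : ℕ) : ℝ) with hH
  have hfac := factorial_le_of_cost_le e hs T hT ⌊H⌋₊ (fun S hS => Nat.le_floor (hc S hS).le)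
  have hlog2 : Real.log ((2 * m : ℕ) : ℝ) ≤ 1 + Real.log m := by
    push_cast
    rw [Real.log_mul (by norm_num) (by positivity)]
    linarith [Real.log_two_lt_d9]
  have hH0 : 0 ≤ H := mul_nonneg (by positivity) (Real.log_natCast_nonneg _)
  have h1 : (m : ℝ) ^ m ≤ 4 ^ ⌊H⌋₊ * Real.exp m := by
    have h2 := Real.pow_div_factorial_le_exp (m : ℝ) (by positivity) m
    rw [div_le_iff₀ (by positivity)] at h2
    have h3 : (m.factorial : ℝ) ≤ 4 ^ ⌊H⌋₊ := by exact_mod_cast hfac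
    nlinarith [Real.exp_pos (m : ℝ)]
  have h4 := Real.log_le_log (by positivity) h1
  rw [Real.log_mul (by positivity) (by positivity), Real.log_pow, Real.log_pow, Real.log_exp] at h4
  have h5 : Real.log 4 < 2 := by
    rw [show (4 : ℝ) = 2 ^ 2 by norm_num, Real.log_pow]
    push_cast
    linarith [Real.log_two_lt_d9]
  have h6 : (⌊H⌋₊ : ℝ) * Real.log 4 ≤ H * 2 :=
    mul_le_mul (Nat.floor_le hH0) h5.le (Real.log_nonneg (by norm_num)) hH0
  have h7 : H ≤ 1 / 10 * m * (1 + Real.log m) := by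
    rw [hH]
    push_cast at hlog2 ⊢
    nlinarith
  nlinarith

end AxisSegments

/-! ## A small structured language and its compilation to the Real RAM -/

namespace RealRAM

/-- Integer variables of the structured language. -/
inductive Var : Type
  | i | k | u | q | r | a | b | c | id | x | y | h | l | h' | l' | lo | hi | ans | top
  deriving DecidableEq

/-- Integer arrays of the structured language. -/
inductive Arr : Type
  | rankX | rankY | inv | first | partner | endX | endY | div | mod | size | mn | mx
  deriving DecidableEq

def Var.idx : Var → ℕ
  | i => 0 | k => 1 | u => 2 | q => 3 | r => 4 | a => 5 | b => 6 | c => 7 | id => 8 | x => 9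
  | y => 10 | h => 11 | l => 12 | h' => 13 | l' => 14 | lo => 15 | hi => 16 | ans => 17 | top => 18

def Arr.idx : Arr → ℕ
  | rankX => 0 | rankY => 1 | inv => 2 | first => 3 | partner => 4 | endX => 5 | endY => 6
  | div => 7 | mod => 8 | size => 9 | mn => 10 | mx => 11

theorem Var.idx_inj {v w : Var} : v.idx = w.idx ↔ v = w := by
  cases v <;> cases w <;> simp [Var.idx]

theorem Arr.idx_lt (A : Arr) : A.idx < 12 := by
  cases A <;> simp [Arr.idx]

theorem Arr.idx_inj {v w : Arr} : v.idx = w.idx ↔ v = w := by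
  cases v <;> cases w <;> simp [Arr.idx]

/-- Expressions with natural number values. `inp` reads the integer input, `rlt` compares two
reals of the input, and `load` reads an array. -/
inductive Expr : Type
  | const (n : ℕ)
  | size
  | var (v : Var)
  | add (e f : Expr)
  | sub (e f : Expr)
  | mul (e f : Expr)
  | lt (e f : Expr)
  | eq (e f : Expr)
  | inp (e : Expr)
  | load (A : Arr) (e : Expr)
  | rlt (e f : Expr)

/-- The input: the size parameter, the integers and the reals. -/
structure Env where
  n : ℕ
  inp : ℕ → ℕ
  real : ℕ → ℝ

/-- A store: the values of the variables and of the arrays. -/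
structure Store where
  reg : Var → ℕ
  mem : Arr → ℕ → ℕ

namespace Store

def setV (s : Store) (v : Var) (a : ℕ) : Store :=
  { s with reg := Function.update s.reg v a }

def setA (s : Store) (A : Arr) (i a : ℕ) : Store :=
  { s with mem := Function.update s.mem A (Function.update (s.mem A) i a) }

@[simp] theorem setV_reg (s : Store) (v w : Var) (a : ℕ) :
    (s.setV v a).reg w = if w = v then a else s.reg w := by
  simp [setV, Function.update_apply]

@[simp] theorem setV_mem (s : Store) (v : Var) (a : ℕ) : (s.setV v a).mem = s.mem := rfl

@[simp] theorem setA_reg (s : Store) (A : Arr) (i a : ℕ) : (s.setA A i a).reg = s.reg := rfl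

@[simp] theorem setA_mem (s : Store) (A A' : Arr) (i a : ℕ) :
    (s.setA A i a).mem A' = if A' = A then Function.update (s.mem A) i a else s.mem A' := by
  simp only [setA, Function.update_apply]

end Store

/-- The input cell that is read for the address `a`: addresses outside of the input are
redirected to cell `0`. -/
def Env.clip (E : Env) (a : ℕ) : ℕ := if a < 2 * E.n then a else 0

/-- The value of an expression. -/
noncomputable def Expr.eval (E : Env) (s : Store) : Expr → ℕ
  | const m => m
  | size => E.n
  | var v => s.reg v
  | add e f => e.eval E s + f.eval E s
  | sub e f => e.eval E s - f.eval E s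
  | mul e f => e.eval E s * f.eval E s
  | lt e f => if e.eval E s < f.eval E s then 1 else 0
  | eq e f => if e.eval E s = f.eval E s then 1 else 0
  | inp e => E.inp (E.clip (e.eval E s))
  | load A e => s.mem A (e.eval E s)
  | rlt e f => if E.real (e.eval E s) < E.real (f.eval E s) then 1 else 0

/-- Code that evaluates an expression into the temporary register `2 * d + 1`. -/
def Expr.code : Expr → ℕ → List Instr
  | const m, d => [.iconst (2 * d + 1) m]
  | size, d => [.iconst (2 * d + 1) 0, .iadd (2 * d + 1) (2 * d + 1) 0]
  | var v, d => [.iconst (2 * d + 1) 0, .iadd (2 * d + 1) (2 * d + 1) (2 * v.idx + 2)]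
  | add e f, d => e.code d ++ (f.code (d + 1) ++ [.iadd (2 * d + 1) (2 * d + 1) (2 * d + 3)])
  | sub e f, d => e.code d ++ (f.code (d + 1) ++
      [.ilt (2 * d + 5) (2 * d + 3) (2 * d + 1), .isub (2 * d + 1) (2 * d + 1) (2 * d + 3),
        .imul (2 * d + 1) (2 * d + 1) (2 * d + 5)])
  | mul e f, d => e.code d ++ (f.code (d + 1) ++ [.imul (2 * d + 1) (2 * d + 1) (2 * d + 3)])
  | lt e f, d => e.code d ++ (f.code (d + 1) ++ [.ilt (2 * d + 1) (2 * d + 1) (2 * d + 3)])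
  | eq e f, d => e.code d ++ (f.code (d + 1) ++ [.ieq (2 * d + 1) (2 * d + 1) (2 * d + 3)])
  | inp e, d => e.code d ++ [.iadd (2 * d + 3) 0 0, .ilt (2 * d + 3) (2 * d + 1) (2 * d + 3),
      .imul (2 * d + 1) (2 * d + 1) (2 * d + 3), .iload (2 * d + 1) (2 * d + 1)]
  | load A e, d => e.code d ++ [.iconst (2 * d + 3) 12, .imul (2 * d + 1) (2 * d + 1) (2 * d + 3),
      .iconst (2 * d + 3) (A.idx + 1), .iadd (2 * d + 1) (2 * d + 1) (2 * d + 3),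
      .iadd (2 * d + 1) (2 * d + 1) 0, .iadd (2 * d + 1) (2 * d + 1) 0,
      .iload (2 * d + 1) (2 * d + 1)]
  | rlt e f, d => e.code d ++ (f.code (d + 1) ++
      [.rload 0 (2 * d + 1), .rload 1 (2 * d + 3), .rlt (2 * d + 1) 0 1])

/-- The machine state represents the store. -/
structure Sim (E : Env) (s : Store) (σ : State) : Prop where
  size : σ.ireg 0 = E.n
  reg : ∀ v : Var, σ.ireg (2 * v.idx + 2) = s.reg v
  inp : ∀ a, σ.imem (E.clip a) = E.inp (E.clip a)
  mem : ∀ A i, σ.imem (12 * i + (Arr.idx A + 1) + E.n + E.n) = s.mem A i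
  real : σ.rmem = E.real

/-- Register `0` holds `n`, the other even registers hold the variables, and the odd ones are
temporaries that `Sim` ignores. The arrays are interleaved with stride `12` behind the integer
input. Evaluation of expressions writes only temporaries. -/
theorem Sim.congr {E : Env} {s : Store} {σ σ' : State} (h : Sim E s σ) (h0 : σ'.ireg 0 = σ.ireg 0)
    (h1 : ∀ v : Var, σ'.ireg (2 * v.idx + 2) = σ.ireg (2 * v.idx + 2)) (h2 : σ'.imem = σ.imem)
    (h3 : σ'.rmem = σ.rmem) : Sim E s σ' :=
  ⟨h0.trans h.size, fun v => (h1 v).trans (h.reg v), by rw [h2]; exact h.inp, by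
    rw [h2]; exact h.mem, h3.trans h.real⟩

/-- Straight-line execution of a list of instructions. -/
noncomputable def execs : List Instr → State → Option State
  | [], σ => some σ
  | c :: l, σ => (exec σ c).bind (execs l)

theorem execs_append (l l' : List Instr) (σ : State) :
    execs (l ++ l') σ = (execs l σ).bind (execs l') := by
  induction l generalizing σ with
  | nil => rfl
  | cons c l ih =>
    simp only [List.cons_append, execs]
    cases exec σ c with
    | none => rfl
    | some τ => exact ih τ

/-- The list `l` occurs in the program `P` at position `p`. -/
def At (P : Program) (p : ℕ) (l : List Instr) : Prop := ∀ i, i < l.length → P[p + i]? = l[i]?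

theorem At.left {P : Program} {p : ℕ} {l l' : List Instr} (h : At P p (l ++ l')) : At P p l := by
  intro i hi
  rw [h i (by rw [List.length_append]; omega), List.getElem?_append_left hi]

theorem At.right {P : Program} {p : ℕ} {l l' : List Instr} (h : At P p (l ++ l')) :
    At P (p + l.length) l' := by
  intro i hi
  rw [add_assoc, h (l.length + i) (by rw [List.length_append]; omega),
    List.getElem?_append_right (by omega)]
  simp

theorem At.head {P : Program} {p : ℕ} {c : Instr} {l : List Instr} (h : At P p (c :: l)) :
    P[p]? = some c := by simpa using h 0 (by simp)

theorem At.tail {P : Program} {p : ℕ} {c : Instr} {l : List Instr} (h : At P p (c :: l)) :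
    At P (p + 1) l := At.right (l := [c]) h

theorem Runs.trans {P : Program} {t t' : ℕ} {σ σ' σ'' : State} (h : Runs P t σ σ')
    (h' : Runs P t' σ' σ'') : Runs P (t + t') σ σ'' := by
  induction h with
  | refl => simpa using h'
  | head hs _ ih =>
    rw [Nat.add_right_comm]
    exact Runs.head hs (ih h')

theorem Runs.single {P : Program} {σ σ' : State} {c : Instr} (h : P[σ.pc]? = some c)
    (h' : exec σ c = some σ') : Runs P 1 σ σ' :=
  Runs.head (by simp [step, h, h']) (Runs.refl _)

/-- Instructions that proceed to the next instruction. -/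
def Instr.Straight (c : Instr) : Prop := ∀ b p, c ≠ jumpIf b p

theorem exec_pc {σ σ' : State} {c : Instr} (hc : c.Straight) (h : exec σ c = some σ') :
    σ'.pc = σ.pc + 1 := by
  cases c with
  | jumpIf b p => exact absurd rfl (hc b p)
  | halt => simp [exec] at h
  | _ =>
    simp only [exec] at h
    (try split_ifs at h) <;> simp only [Option.some.injEq] at h <;> subst h <;> rfl

theorem runs_execs {P : Program} {l : List Instr} {σ σ' : State} (hl : ∀ c ∈ l, c.Straight)
    (hP : At P σ.pc l) (h : execs l σ = some σ') :
    Runs P l.length σ σ' ∧ σ'.pc = σ.pc + l.length := by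
  induction l generalizing σ with
  | nil =>
    injection h with h
    subst h
    exact ⟨Runs.refl _, rfl⟩
  | cons c l ih =>
    simp only [execs] at h
    cases hc : exec σ c with
    | none => simp [hc] at h
    | some τ =>
      simp only [hc, Option.bind_some] at h
      have hpc := exec_pc (hl c (by simp)) hc
      have := ih (fun c hc => hl c (by simp [hc])) (by rw [hpc]; exact hP.tail) h
      refine ⟨?_, by rw [this.2, hpc, List.length_cons]; omega⟩
      exact Runs.head (by simp [step, hP.head, hc]) this.1

theorem Expr.straight_code (e : Expr) (d : ℕ) : ∀ c ∈ e.code d, c.Straight := by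
  induction e generalizing d <;> simp_all [code, or_imp, forall_and, Instr.Straight] <;>
    (try refine ⟨?_, ?_⟩) <;> solve_by_elim

/-- What the code of an expression does. -/
def Expr.Correct (E : Env) (s : Store) (e : Expr) : Prop :=
  ∀ (d : ℕ) (σ : State), Sim E s σ → ∃ σ', execs (e.code d) σ = some σ' ∧ Sim E s σ' ∧
    σ'.ireg (2 * d + 1) = e.eval E s ∧ ∀ t < d, σ'.ireg (2 * t + 1) = σ.ireg (2 * t + 1)

/-- The second operand is evaluated at depth `d + 1`, which leaves the first value in register `2 *
d + 1` untouched. -/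
theorem Expr.correct_binary {E : Env} {s : Store} {e f g : Expr} {l : ℕ → List Instr}
    (he : e.Correct E s) (hf : f.Correct E s)
    (hg : ∀ d, g.code d = e.code d ++ (f.code (d + 1) ++ l d))
    (h : ∀ d σ, Sim E s σ → σ.ireg (2 * d + 1) = e.eval E s → σ.ireg (2 * d + 3) = f.eval E s →
      ∃ σ', execs (l d) σ = some σ' ∧ Sim E s σ' ∧ σ'.ireg (2 * d + 1) = g.eval E s ∧
        ∀ t < d, σ'.ireg (2 * t + 1) = σ.ireg (2 * t + 1)) : g.Correct E s := by
  intro d σ hσ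
  obtain ⟨σ₁, h1, s1, v1, p1⟩ := he d σ hσ
  obtain ⟨σ₂, h2, s2, v2, p2⟩ := hf (d + 1) σ₁ s1
  obtain ⟨σ₃, h3, s3, v3, p3⟩ := h d σ₂ s2 ((p2 d (by omega)).trans v1) v2
  refine ⟨σ₃, ?_, s3, v3, fun t ht => ?_⟩
  · rw [hg, execs_append, h1, Option.bind_some, execs_append, h2, Option.bind_some, h3]
  · rw [p3 t ht, p2 t (by omega), p1 t ht]

theorem Expr.correct_unary {E : Env} {s : Store} {e g : Expr} {l : ℕ → List Instr}
    (he : e.Correct E s) (hg : ∀ d, g.code d = e.code d ++ l d)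
    (h : ∀ d σ, Sim E s σ → σ.ireg (2 * d + 1) = e.eval E s →
      ∃ σ', execs (l d) σ = some σ' ∧ Sim E s σ' ∧ σ'.ireg (2 * d + 1) = g.eval E s ∧
        ∀ t < d, σ'.ireg (2 * t + 1) = σ.ireg (2 * t + 1)) : g.Correct E s := by
  intro d σ hσ
  obtain ⟨σ₁, h1, s1, v1, p1⟩ := he d σ hσ
  obtain ⟨σ₃, h3, s3, v3, p3⟩ := h d σ₁ s1 v1
  refine ⟨σ₃, ?_, s3, v3, fun t ht => ?_⟩
  · rw [hg, execs_append, h1, Option.bind_some, h3]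
  · rw [p3 t ht, p1 t ht]

theorem Expr.correct (E : Env) (s : Store) (e : Expr) : e.Correct E s := by
  induction e with
  | const m =>
    intro d σ hσ
    refine ⟨_, rfl, hσ.congr ?_ ?_ rfl rfl, ?_, fun t ht => ?_⟩
    · simp [State.setI]
    · intro v
      simp [State.setI, Function.update_apply]
      omega
    · simp [State.setI, eval]
    · simp [State.setI, Function.update_apply]
      omega
  | size =>
    intro d σ hσ
    refine ⟨_, rfl, hσ.congr ?_ ?_ rfl rfl, ?_, fun t ht => ?_⟩
    · simp [State.setI]
    · intro v
      simp [State.setI, Function.update_apply]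
      omega
    · simp [State.setI, eval, hσ.size]
    · simp [State.setI, Function.update_apply]
      omega
  | var w =>
    intro d σ hσ
    have h1 : ¬ (2 * w.idx + 2 = 2 * d + 1) := by omega
    refine ⟨_, rfl, hσ.congr ?_ ?_ rfl rfl, ?_, fun t ht => ?_⟩
    · simp [State.setI]
    · intro v
      simp [State.setI, Function.update_apply]
      omega
    · simp [State.setI, eval, hσ.reg, h1]
    · simp [State.setI, Function.update_apply]
      omega
  | add e f he hf =>
    refine correct_binary he hf (fun d => rfl) fun d σ hσ h1 h2 => ?_
    refine ⟨_, rfl, hσ.congr ?_ ?_ rfl rfl, ?_, fun t ht => ?_⟩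
    · simp [State.setI]
    · intro v
      simp [State.setI, Function.update_apply]
      omega
    · simp [State.setI, eval, h1, h2]
    · simp [State.setI, Function.update_apply]
      omega
  | mul e f he hf =>
    refine correct_binary he hf (fun d => rfl) fun d σ hσ h1 h2 => ?_
    refine ⟨_, rfl, hσ.congr ?_ ?_ rfl rfl, ?_, fun t ht => ?_⟩
    · simp [State.setI]
    · intro v
      simp [State.setI, Function.update_apply]
      omega
    · simp [State.setI, eval, h1, h2]
    · simp [State.setI, Function.update_apply]
      omega
  -- Subtraction is truncated at `0`: the integer difference is multiplied by the outcome of the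
  -- test `f < e`.
  | sub e f he hf =>
    refine correct_binary he hf (fun d => rfl) fun d σ hσ h1 h2 => ?_
    refine ⟨_, rfl, hσ.congr ?_ ?_ rfl rfl, ?_, fun t ht => ?_⟩
    · simp [State.setI]
    · intro v
      simp [State.setI, Function.update_apply]
      split_ifs <;> omega
    · simp [State.setI, eval, h1, h2]
      split_ifs <;> omega
    · simp [State.setI, Function.update_apply]
      split_ifs <;> omega
  | lt e f he hf =>
    refine correct_binary he hf (fun d => rfl) fun d σ hσ h1 h2 => ?_
    refine ⟨_, rfl, hσ.congr ?_ ?_ rfl rfl, ?_, fun t ht => ?_⟩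
    · simp [State.setI]
    · intro v
      simp [State.setI, Function.update_apply]
      omega
    · simp [State.setI, eval, h1, h2]
    · simp [State.setI, Function.update_apply]
      omega
  | eq e f he hf =>
    refine correct_binary he hf (fun d => rfl) fun d σ hσ h1 h2 => ?_
    refine ⟨_, rfl, hσ.congr ?_ ?_ rfl rfl, ?_, fun t ht => ?_⟩
    · simp [State.setI]
    · intro v
      simp [State.setI, Function.update_apply]
      omega
    · simp [State.setI, eval, h1, h2]
    · simp [State.setI, Function.update_apply]
      omega
  | inp e he =>
    refine correct_unary he (fun d => rfl) fun d σ hσ h1 => ?_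
    -- Multiplication by the outcome of the test against `2 * n` sends every address outside of the
    -- input to `0`.
    have h2 : ((E.clip (e.eval E s) : ℕ) : ℤ) =
        (e.eval E s : ℤ) * (if (e.eval E s : ℤ) < E.n + E.n then 1 else 0) := by
      rw [Env.clip]
      split_ifs <;> simp <;> omega
    simp only [execs, exec, Option.bind_some, State.setI, Function.update_self,
      Function.update_of_ne (show (2 * d + 1) ≠ 2 * d + 3 by omega), h1, hσ.size, ← h2,
      Int.toNat_natCast, hσ.inp, Nat.cast_nonneg, if_true]
    refine ⟨_, rfl, hσ.congr ?_ ?_ rfl rfl, ?_, fun t ht => ?_⟩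
    · simp
    · intro v
      simp [Function.update_apply]
      split_ifs <;> omega
    · simp [eval]
    · simp [Function.update_apply]
      split_ifs <;> omega
  | load A e he =>
    refine correct_unary he (fun d => rfl) fun d σ hσ h1 => ?_
    have h2 : ((12 * e.eval E s + (A.idx + 1) + E.n + E.n : ℕ) : ℤ) =
        (e.eval E s : ℤ) * 12 + ((A.idx : ℤ) + 1) + E.n + E.n := by
      push_cast; ring
    simp only [execs, exec, Option.bind_some, State.setI, Function.update_self,
      Function.update_of_ne (show (2 * d + 1) ≠ 2 * d + 3 by omega),
      Function.update_of_ne (show 0 ≠ 2 * d + 3 by omega),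
      Function.update_of_ne (show 0 ≠ 2 * d + 1 by omega), h1, hσ.size, ← h2,
      Int.toNat_natCast, hσ.mem, Nat.cast_nonneg, if_true]
    refine ⟨_, rfl, hσ.congr ?_ ?_ rfl rfl, ?_, fun t ht => ?_⟩
    · simp
    · intro v
      simp [Function.update_apply]
      split_ifs <;> omega
    · simp [eval]
    · simp [Function.update_apply]
      split_ifs <;> omega
  | rlt e f he hf =>
    refine correct_binary he hf (fun d => rfl) fun d σ hσ h1 h2 => ?_
    simp only [execs, exec, Option.bind_some, State.setR, h1, h2, Nat.cast_nonneg, if_true,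
      Int.toNat_natCast]
    refine ⟨_, rfl, hσ.congr ?_ ?_ rfl rfl, ?_, fun t ht => ?_⟩
    · simp [State.setI]
    · intro v
      simp [State.setI, Function.update_apply]
      omega
    · simp [State.setI, eval, hσ.real]
    · simp [State.setI, Function.update_apply]
      omega

/-- Commands of the structured language. -/
inductive Cmd : Type
  | skip
  | assign (v : Var) (e : Expr)
  | store (A : Arr) (e f : Expr)
  | seq (c d : Cmd)
  | ite (e : Expr) (c d : Cmd)
  | loop (e : Expr) (c : Cmd)

/-- Big-step semantics: `Ev E c s t s'` says that `c` leads from `s` to `s'` in `t` elementary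
commands. -/
inductive Ev (E : Env) : Cmd → Store → ℕ → Store → Prop
  | skip (s : Store) : Ev E .skip s 0 s
  | assign (v : Var) (e : Expr) (s : Store) : Ev E (.assign v e) s 1 (s.setV v (e.eval E s))
  | store (A : Arr) (e f : Expr) (s : Store) :
      Ev E (.store A e f) s 1 (s.setA A (e.eval E s) (f.eval E s))
  | seq {c d : Cmd} {s s' s'' : Store} {t t' : ℕ} : Ev E c s t s' → Ev E d s' t' s'' →
      Ev E (.seq c d) s (t + t') s''
  | ite_true {e : Expr} {c d : Cmd} {s s' : Store} {t : ℕ} : e.eval E s ≠ 0 → Ev E c s t s' →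
      Ev E (.ite e c d) s (t + 1) s'
  | ite_false {e : Expr} {c d : Cmd} {s s' : Store} {t : ℕ} : e.eval E s = 0 → Ev E d s t s' →
      Ev E (.ite e c d) s (t + 1) s'
  | loop_true {e : Expr} {c : Cmd} {s s' s'' : Store} {t t' : ℕ} : e.eval E s ≠ 0 →
      Ev E c s t s' → Ev E (.loop e c) s' t' s'' → Ev E (.loop e c) s (t + 1 + t') s''
  | loop_false {e : Expr} {c : Cmd} {s : Store} : e.eval E s = 0 → Ev E (.loop e c) s 1 s

/-- The length of the code of a command. -/
def Cmd.len : Cmd → ℕ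
  | skip => 0
  | assign _ e => (e.code 0).length + 2
  | store _ e f => (e.code 0).length + (f.code 1).length + 7
  | seq c d => c.len + d.len
  | ite e c d => (e.code 0).length + 1 + (d.len + 2) + c.len
  | loop e c => (e.code 0).length + 1 + 2 + (c.len + 2)

/-- The code of a command that is placed at position `p` of the program. -/
def Cmd.comp : Cmd → ℕ → List Instr
  | skip, _ => []
  | assign v e, _ => e.code 0 ++ [.iconst 3 0, .iadd (2 * v.idx + 2) 1 3]
  | store A e f, _ => e.code 0 ++ (f.code 1 ++ [.iconst 5 12, .imul 1 1 5, .iconst 5 (A.idx + 1),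
      .iadd 1 1 5, .iadd 1 1 0, .iadd 1 1 0, .istore 1 3])
  | seq c d, p => c.comp p ++ d.comp (p + c.len)
  | ite e c d, p => e.code 0 ++ (.jumpIf 1 (p + (e.code 0).length + 1 + (d.len + 2)) ::
      (d.comp (p + (e.code 0).length + 1) ++
        (.iconst 1 1 :: .jumpIf 1 (p + (ite e c d).len) ::
          c.comp (p + (e.code 0).length + 1 + (d.len + 2)))))
  | loop e c, p => e.code 0 ++ (.jumpIf 1 (p + (e.code 0).length + 3) ::
      .iconst 1 1 :: .jumpIf 1 (p + (loop e c).len) ::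
        (c.comp (p + (e.code 0).length + 3) ++ [.iconst 1 1, .jumpIf 1 p]))

theorem Cmd.length_comp (c : Cmd) (p : ℕ) : (c.comp p).length = c.len := by
  induction c generalizing p <;> simp [comp, len, *] <;> omega

/-- The largest number of instructions that are executed for an elementary command. -/
def Cmd.weight : Cmd → ℕ
  | skip => 0
  | assign _ e => (e.code 0).length + 2
  | store _ e f => (e.code 0).length + (f.code 1).length + 7
  | seq c d => max c.weight d.weight
  | ite e c d => max ((e.code 0).length + 3) (max c.weight d.weight)
  | loop e c => max ((e.code 0).length + 3) c.weight

/-- The bound cannot be `2 * E.n`: for `n = 0` the cell `0` is still read. For this reason the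
arrays begin at cell `2 * n + 1`. -/
theorem Env.clip_lt (E : Env) (a : ℕ) : E.clip a < 2 * E.n + 1 := by
  rw [Env.clip]; split_ifs <;> omega

theorem Sim.setV {E : Env} {s : Store} {σ σ' : State} (h : Sim E s σ) (v : Var) (a : ℕ)
    (h0 : σ'.ireg 0 = σ.ireg 0)
    (h1 : ∀ w : Var, σ'.ireg (2 * w.idx + 2) = if w = v then (a : ℤ) else σ.ireg (2 * w.idx + 2))
    (h2 : σ'.imem = σ.imem) (h3 : σ'.rmem = σ.rmem) : Sim E (s.setV v a) σ' :=
  ⟨h0.trans h.size, fun w => by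
    rw [h1, Store.setV_reg]
    split_ifs
    · rfl
    · exact h.reg w, by rw [h2]; exact h.inp, by rw [h2]; exact h.mem, h3.trans h.real⟩

/-- Array numbers are below the stride `12`, so different entries have different addresses, and none
of them is an input cell. -/
theorem Sim.setA {E : Env} {s : Store} {σ σ' : State} (h : Sim E s σ) (A : Arr) (i a : ℕ)
    (h0 : σ'.ireg 0 = σ.ireg 0)
    (h1 : ∀ w : Var, σ'.ireg (2 * w.idx + 2) = σ.ireg (2 * w.idx + 2))
    (h2 : σ'.imem = Function.update σ.imem (12 * i + (Arr.idx A + 1) + E.n + E.n) (a : ℤ))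
    (h3 : σ'.rmem = σ.rmem) : Sim E (s.setA A i a) σ' := by
  refine ⟨h0.trans h.size, fun v => (h1 v).trans (h.reg v), fun b => ?_, fun B j => ?_,
    h3.trans h.real⟩
  · have := E.clip_lt b
    rw [h2, Function.update_of_ne (by omega), h.inp]
  · have hA := A.idx_lt
    have hB := B.idx_lt
    rw [h2, Store.setA_mem, Function.update_apply]
    by_cases hAB : B = A
    · subst hAB
      rw [if_pos rfl, Function.update_apply]
      by_cases hij : j = i
      · rw [if_pos (by rw [hij]), if_pos hij]
      · rw [if_neg (by omega), if_neg hij, h.mem]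
    · rw [if_neg hAB, if_neg, h.mem]
      intro hc
      exact hAB (Arr.idx_inj.1 (by omega))

theorem Expr.runs {E : Env} {s : Store} {σ : State} {P : Program} (e : Expr) (hσ : Sim E s σ)
    (hP : At P σ.pc (e.code 0)) : ∃ σ', Runs P (e.code 0).length σ σ' ∧
      σ'.pc = σ.pc + (e.code 0).length ∧ Sim E s σ' ∧ σ'.ireg 1 = e.eval E s := by
  obtain ⟨σ', h1, h2, h3, -⟩ := e.correct E s 0 σ hσ
  have := runs_execs (e.straight_code 0) hP h1
  exact ⟨σ', this.1, this.2, h2, h3⟩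

theorem Sim.jump {E : Env} {s : Store} {σ : State} (h : Sim E s σ) (p : ℕ) :
    Sim E s { σ with pc := p } := h.congr rfl (fun _ => rfl) rfl rfl

/-- The unconditional jump that is used between the parts of a command. -/
theorem Sim.goto {E : Env} {s : Store} {σ : State} {P : Program} {p : ℕ} {l : List Instr}
    (h : Sim E s σ) (hP : At P σ.pc (.iconst 1 1 :: .jumpIf 1 p :: l)) :
    ∃ σ', Runs P 2 σ σ' ∧ σ'.pc = p ∧ Sim E s σ' := by
  refine ⟨{ σ.setI 1 1 with pc := p }, ?_, rfl, h.congr ?_ ?_ rfl rfl⟩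
  · refine (Runs.single (c := .iconst 1 1) hP.head rfl).trans
      (Runs.single (c := .jumpIf 1 p) hP.tail.head ?_)
    simp [exec, State.setI]
  · simp [State.setI]
  · intro v
    simp [State.setI]

/-- Every elementary command, and every test together with the jumps around it, takes at most `W`
instructions. The induction is on the evaluation rather than on the command, because a loop executes
the same code at the same position again. -/
theorem Cmd.correct {E : Env} {c : Cmd} {s s' : Store} {t : ℕ} (hc : Ev E c s t s') (W : ℕ)
    (hW : c.weight ≤ W) (P : Program) (σ : State) (hσ : Sim E s σ) (hP : At P σ.pc (c.comp σ.pc)) :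
    ∃ T σ', T ≤ W * t ∧ Runs P T σ σ' ∧ σ'.pc = σ.pc + c.len ∧ Sim E s' σ' := by
  induction hc generalizing σ with
  | skip s => exact ⟨0, σ, by simp, Runs.refl _, rfl, hσ⟩
  | assign v e s =>
    simp only [weight] at hW
    obtain ⟨σ₁, r1, p1, s1, v1⟩ := e.runs hσ hP.left
    have h2 := hP.right
    rw [← p1] at h2
    obtain ⟨r2, p2⟩ := runs_execs (σ := σ₁) (by simp [Instr.Straight]) h2 rfl
    refine ⟨_, _, ?_, r1.trans r2, ?_, s1.setV v _ ?_ ?_ rfl rfl⟩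
    · simpa using hW
    · rw [p2, p1, len]
      simp [add_assoc]
    · simp [State.setI]
    · intro w
      simp only [State.setI, Function.update_apply]
      by_cases hw : w = v
      · simp [hw, v1]
      · have := mt Var.idx_inj.1 hw
        rw [if_neg (by omega), if_neg (by omega), if_neg hw]
  | store A e f s =>
    simp only [weight] at hW
    obtain ⟨σ₁, h1, s1, v1, -⟩ := e.correct E s 0 σ hσ
    obtain ⟨r1, p1⟩ := runs_execs (e.straight_code 0) hP.left h1
    have hP2 := hP.right
    rw [← p1] at hP2
    obtain ⟨σ₂, h2, s2, v2, k2⟩ := f.correct E s 1 σ₁ s1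
    obtain ⟨r2, p2⟩ := runs_execs (f.straight_code 1) hP2.left h2
    have hP3 := hP2.right
    rw [← p2] at hP3
    have v1' : σ₂.ireg 1 = e.eval E s := (k2 0 (by omega)).trans v1
    have h2 : ((12 * e.eval E s + (A.idx + 1) + E.n + E.n : ℕ) : ℤ) =
        (e.eval E s : ℤ) * 12 + ((A.idx : ℤ) + 1) + E.n + E.n := by
      push_cast; ring
    have hex : ∃ σ₃, execs [.iconst 5 12, .imul 1 1 5, .iconst 5 (A.idx + 1),
        .iadd 1 1 5, .iadd 1 1 0, .iadd 1 1 0, .istore 1 3] σ₂ = some σ₃ ∧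
        Sim E (s.setA A (e.eval E s) (f.eval E s)) σ₃ := by
      simp only [execs, exec, Option.bind_some, State.setI, Function.update_self,
        Function.update_of_ne (show 1 ≠ 5 by omega), Function.update_of_ne (show 0 ≠ 5 by omega),
        Function.update_of_ne (show 0 ≠ 1 by omega), Function.update_of_ne (show 3 ≠ 5 by omega),
        Function.update_of_ne (show 3 ≠ 1 by omega), v1', s2.size, ← h2, Nat.cast_nonneg, if_true,
        Int.toNat_natCast]
      refine ⟨_, rfl, s2.setA A _ _ ?_ ?_ ?_ rfl⟩
      · simp
      · intro w
        simp only [Function.update_apply]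
        split_ifs <;> omega
      · simp only [v2]
    obtain ⟨σ₃, h3, s3⟩ := hex
    obtain ⟨r3, p3⟩ := runs_execs (by simp [Instr.Straight]) hP3 h3
    refine ⟨_, _, ?_, r1.trans (r2.trans r3), ?_, s3⟩
    · simpa [add_assoc] using hW
    · rw [p3, p2, p1, len]
      simp [add_assoc]
  | @seq c d s s' s'' t t' _ _ ih1 ih2 =>
    simp only [weight] at hW
    obtain ⟨T1, σ₁, b1, r1, p1, s1⟩ := ih1 ((le_max_left _ _).trans hW) σ hσ hP.left
    have h2 := hP.right
    rw [c.length_comp, ← p1] at h2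
    obtain ⟨T2, σ₂, b2, r2, p2, s2⟩ := ih2 ((le_max_right _ _).trans hW) σ₁ s1 h2
    exact ⟨T1 + T2, σ₂, by rw [mul_add]; omega, r1.trans r2, by rw [p2, p1, len, add_assoc], s2⟩
  | @ite_true e c d s s' t he _ ih =>
    simp only [weight, max_le_iff] at hW
    obtain ⟨σ₁, r1, p1, s1, v1⟩ := e.runs hσ hP.left
    have h2 := hP.right
    rw [← p1] at h2
    have r2 := Runs.single (c := .jumpIf 1 _) h2.head rfl
    have hv : σ₁.ireg 1 ≠ 0 := by rw [v1]; exact_mod_cast he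
    simp only [hv, ne_eq, not_false_eq_true, if_true] at r2
    rw [p1] at r2
    have h3 := h2.tail.right.tail.tail
    rw [length_comp, p1] at h3
    obtain ⟨T, σ₂, b, r3, p3, s3⟩ := ih hW.2.1 _
      (s1.jump (σ.pc + (e.code 0).length + 1 + (d.len + 2))) (by
        refine Eq.mp ?_ h3
        congr 1)
    refine ⟨_, σ₂, ?_, r1.trans (r2.trans r3), ?_, s3⟩
    · rw [mul_add]; omega
    · rw [p3, len]
      simp only
      omega
  | @ite_false e c d s s' t he _ ih =>
    simp only [weight, max_le_iff] at hW
    obtain ⟨σ₁, r1, p1, s1, v1⟩ := e.runs hσ hP.left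
    have h2 := hP.right
    rw [← p1] at h2
    have r2 := Runs.single (c := .jumpIf 1 _) h2.head rfl
    have hv : σ₁.ireg 1 = 0 := by rw [v1]; exact_mod_cast he
    simp only [hv, ne_eq, not_true_eq_false, if_false] at r2
    have h3 := h2.tail
    obtain ⟨T, σ₂, b, r3, p3, s3⟩ := ih hW.2.2 _ (s1.jump (σ₁.pc + 1)) (by
      refine Eq.mp ?_ h3.left
      rw [p1])
    have h4 := h3.right
    rw [length_comp] at h4
    simp only at p3
    rw [← p3] at h4
    obtain ⟨σ₃, r4, p4, s4⟩ := s3.goto h4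
    refine ⟨_, σ₃, ?_, r1.trans (r2.trans (r3.trans r4)), p4, s4⟩
    rw [mul_add]; omega
  | @loop_true e c s s' s'' t t' he _ _ ih1 ih2 =>
    have hW' := hW
    simp only [weight, max_le_iff] at hW
    obtain ⟨σ₁, r1, p1, s1, v1⟩ := e.runs hσ hP.left
    have h2 := hP.right
    rw [← p1] at h2
    have r2 := Runs.single (c := .jumpIf 1 _) h2.head rfl
    have hv : σ₁.ireg 1 ≠ 0 := by rw [v1]; exact_mod_cast he
    simp only [hv, ne_eq, not_false_eq_true, if_true] at r2
    rw [p1] at r2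
    have h3 := h2.tail.tail.tail
    rw [p1] at h3
    obtain ⟨T, σ₂, b, r3, p3, s3⟩ := ih1 hW.2 _ (s1.jump (σ.pc + (e.code 0).length + 3)) h3.left
    have h4 := h3.right
    rw [length_comp] at h4
    simp only at p3
    rw [← p3] at h4
    obtain ⟨σ₃, r4, p4, s4⟩ := s3.goto h4
    obtain ⟨T', σ₄, b', r5, p5, s5⟩ := ih2 hW' σ₃ s4 (by rw [p4]; exact hP)
    refine ⟨_, σ₄, ?_, r1.trans (r2.trans (r3.trans (r4.trans r5))), by rw [p5, p4], s5⟩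
    rw [mul_add, mul_add]; omega
  | @loop_false e c s he =>
    simp only [weight, max_le_iff] at hW
    obtain ⟨σ₁, r1, p1, s1, v1⟩ := e.runs hσ hP.left
    have h2 := hP.right
    rw [← p1] at h2
    have r2 := Runs.single (c := .jumpIf 1 _) h2.head rfl
    have hv : σ₁.ireg 1 = 0 := by rw [v1]; exact_mod_cast he
    simp only [hv, ne_eq, not_true_eq_false, if_false] at r2
    obtain ⟨σ₃, r4, p4, s4⟩ := (s1.jump (σ₁.pc + 1)).goto h2.tail
    refine ⟨_, σ₃, ?_, r1.trans (r2.trans r4), p4, s4⟩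
    omega

/-- The program that runs a command and answers with the value of the variable `ans`. -/
def Cmd.program (c : Cmd) : Program :=
  c.comp 0 ++ [.iconst 1 0, .iadd 0 1 (2 * Var.ans.idx + 2), .halt]

/-- All memory behind the `2 * n` input integers is zero, so the machine starts in a representation
of the zero store and no array needs initialisation. The summand `2` pays for copying `ans` to
register `0`. -/
theorem Cmd.decidesWithin {n : ℕ} {B : List ℕ} {A : List ℝ} (hB : B.length = 2 * n) {c : Cmd}
    {s : Store} {t : ℕ} {Q : Prop}
    (hc : Ev ⟨n, fun k => B.getD k 0, fun k => A.getD k 0⟩ c ⟨fun _ => 0, fun _ _ => 0⟩ t s)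
    (hQ : (Q ∧ s.reg .ans = 1) ∨ (¬ Q ∧ s.reg .ans = 0)) {T : ℕ} (hT : c.weight * t + 2 ≤ T) :
    DecidesWithin c.program (init n B A) T Q := by
  have hP : At c.program 0 (c.comp 0 ++ [.iconst 1 0, .iadd 0 1 (2 * Var.ans.idx + 2), .halt]) :=
    fun i _ => by rw [zero_add]; rfl
  obtain ⟨T1, σ, b1, r1, p1, s1⟩ := c.correct hc _ le_rfl c.program (init n B A)
    ⟨rfl, fun v => rfl, fun a => rfl, fun A i => by
      simp only [init]
      rw [List.getD_eq_default _ _ (by omega)], rfl⟩ hP.left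
  have h2 := hP.right
  rw [length_comp] at h2
  simp only [init, zero_add] at p1 h2
  rw [← p1] at h2
  have h3 : At c.program σ.pc ([.iconst 1 0, .iadd 0 1 (2 * Var.ans.idx + 2)] ++ [.halt]) := h2
  obtain ⟨r2, p2⟩ := runs_execs (σ := σ) (by simp [Instr.Straight]) h3.left rfl
  refine ⟨_, _, ?_, r1.trans r2, ?_, ?_⟩
  · simp only [List.length_cons, List.length_nil]; omega
  · rw [p2]
    exact h3.right.head
  · have := s1.reg .ans
    simp only [State.setI, Function.update_apply, if_true, Var.idx] at this ⊢
    norm_num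
    rw [this]
    exact_mod_cast hQ

end RealRAM

/-! ## Van Emde Boas trees that store both the minimum and the maximum lazily

The nodes of the tree are numbered: the node `id` has the summary `id * (N + 1)` and the clusters
`id * (N + 1) + h + 1` for `h < N`. A node at level `k + 1` keeps its minimum and its maximum (plus
one, the value `0` means that the set is empty) outside of the clusters, which have universe size
`w k`. A node at level `0` represents the empty set. -/

namespace LazyTree

/-- The minima and the maxima of all nodes. -/
structure Heap where
  mn : ℕ → ℕ
  mx : ℕ → ℕ

def Heap.set (V : Heap) (j p q : ℕ) : Heap :=
  ⟨Function.update V.mn j p, Function.update V.mx j q⟩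

/-- Two heaps agree on the node `j`. -/
def SameAt (V V' : Heap) (j : ℕ) : Prop := V'.mn j = V.mn j ∧ V'.mx j = V.mx j

theorem SameAt.trans {V V' V'' : Heap} {j : ℕ} (h : SameAt V V' j) (h' : SameAt V' V'' j) :
    SameAt V V'' j := ⟨h'.1.trans h.1, h'.2.trans h.2⟩

theorem sameAt_set {V : Heap} {j i p q : ℕ} (h : j ≠ i) : SameAt V (V.set i p q) j :=
  ⟨Function.update_of_ne h _ _, Function.update_of_ne h _ _⟩

@[simp] theorem Heap.set_mn (V : Heap) (j p q : ℕ) : (V.set j p q).mn j = p :=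
  Function.update_self _ _ _

@[simp] theorem Heap.set_mx (V : Heap) (j p q : ℕ) : (V.set j p q).mx j = q :=
  Function.update_self _ _ _

/-- The node `j` lies in the subtree of the node `id`. -/
def Desc (N id j : ℕ) : Prop := ∃ t, j / (N + 1) ^ t = id

theorem Desc.refl (N id : ℕ) : Desc N id id := ⟨0, by simp⟩

theorem Desc.of_child {N id d j : ℕ} (hd : d ≤ N) (h : Desc N (id * (N + 1) + d) j) :
    Desc N id j := by
  obtain ⟨t, ht⟩ := h
  refine ⟨t + 1, ?_⟩
  rw [pow_succ, ← Nat.div_div_eq_div_mul, ht, mul_comm,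
    Nat.mul_add_div (by omega), Nat.div_eq_of_lt (by omega), add_zero]

/-- A descendant never has a smaller number. The node `0` would be its own summary, so numbers must
be positive, and the root will be `1`. -/
theorem Desc.not_child_self {N id d : ℕ} (hid : 0 < id) (hN : 0 < N) :
    ¬ Desc N (id * (N + 1) + d) id := by
  rintro ⟨t, ht⟩
  have := Nat.div_le_self id ((N + 1) ^ t)
  nlinarith

/-- The number of an ancestor is a prefix of the number of its descendant in base `N + 1`. Hence
different children have disjoint subtrees, which makes updates of one child invisible to the others.
-/
theorem Desc.child_unique {N id d d' j : ℕ} (hid : 0 < id) (hd : d ≤ N) (hd' : d' ≤ N)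
    (h : Desc N (id * (N + 1) + d) j) (h' : Desc N (id * (N + 1) + d') j) : d = d' := by
  by_contra hne
  wlog hts : ∃ t s, t ≤ s ∧ j / (N + 1) ^ t = id * (N + 1) + d ∧
      j / (N + 1) ^ s = id * (N + 1) + d' generalizing d d'
  · obtain ⟨t, ht⟩ := h
    obtain ⟨s, hs⟩ := h'
    refine this hd' hd ⟨s, hs⟩ ⟨t, ht⟩ (Ne.symm hne) ⟨s, t, ?_, hs, ht⟩
    by_contra hlt
    exact hts ⟨t, s, by omega, ht, hs⟩
  obtain ⟨t, s, hle, ht, hs⟩ := hts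
  rcases hle.eq_or_lt with rfl | hlt
  · omega
  -- If the two prefixes end at different digits, the shorter one is a prefix of `id` and at most
  -- `id`, but the number of a child exceeds `id`.
  · obtain ⟨e, rfl⟩ := Nat.exists_eq_add_of_lt hlt
    rw [add_assoc, pow_add, ← Nat.div_div_eq_div_mul, ht, pow_succ', ← Nat.div_div_eq_div_mul,
      mul_comm, Nat.mul_add_div (by omega), Nat.div_eq_of_lt (b := N + 1) (by omega),
      add_zero] at hs
    have := Nat.div_le_self id ((N + 1) ^ e)
    have : 0 < N := by omega
    nlinarith

theorem sameAt_set_of_not_desc {N : ℕ} {V : Heap} {i j p q : ℕ} (h : ¬ Desc N i j) :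
    SameAt V (V.set i p q) j :=
  sameAt_set fun he => h (he ▸ Desc.refl _ _)

theorem sameAt_set_child {N id d d' j : ℕ} {V : Heap} {p q : ℕ} (hid : 0 < id) (hd : d ≤ N)
    (hd' : d' ≤ N) (hne : d ≠ d') (h : Desc N (id * (N + 1) + d) j) :
    SameAt V (V.set (id * (N + 1) + d') p q) j :=
  sameAt_set_of_not_desc fun h' => hne (Desc.child_unique hid hd hd' h h')

theorem Desc.summary {N id j : ℕ} : Desc N (id * (N + 1) + 0) j ↔ Desc N (id * (N + 1)) j := Iff.rfl

/-- `p` and `q` encode the minimum and the maximum of `A`, and `B` consists of the other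
elements. -/
def Shape (p q : ℕ) (A B : Set ℕ) : Prop :=
  (A = ∅ ∧ B = ∅ ∧ p = 0 ∧ q = 0) ∨ (∃ a, A = {a} ∧ B = ∅ ∧ p = a + 1 ∧ q = a + 1) ∨
    ∃ a b, a < b ∧ A = insert a (insert b B) ∧ (∀ y ∈ B, a < y ∧ y < b) ∧ p = a + 1 ∧ q = b + 1

/-- The quotients of the elements of `B`. -/
def quots (W : ℕ) (B : Set ℕ) : Set ℕ := {h | ∃ y ∈ B, y / W = h}

/-- The remainders of the elements of `B` with quotient `h`. -/
def rems (W : ℕ) (B : Set ℕ) (h : ℕ) : Set ℕ := {l | ∃ y ∈ B, y / W = h ∧ y % W = l}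

/-- The subtree of the node `id` at level `k` represents the set `A`. -/
def Rep (N : ℕ) (w : ℕ → ℕ) : ℕ → Heap → ℕ → Set ℕ → Prop
  | 0, V, id, A => A = ∅ ∧ V.mn id = 0 ∧ V.mx id = 0
  | k + 1, V, id, A => (∀ y ∈ A, y < w (k + 1) ∧ y < N) ∧ ∃ B, Shape (V.mn id) (V.mx id) A B ∧
      Rep N w k V (id * (N + 1)) (quots (w k) B) ∧
      ∀ h < N, Rep N w k V (id * (N + 1) + (h + 1)) (rems (w k) B h)

/-- The summary and the clusters of the node `id` at level `k + 1` represent the set `B`. -/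
def Inner (N : ℕ) (w : ℕ → ℕ) (k : ℕ) (V : Heap) (id : ℕ) (B : Set ℕ) : Prop :=
  Rep N w k V (id * (N + 1)) (quots (w k) B) ∧
    ∀ h < N, Rep N w k V (id * (N + 1) + (h + 1)) (rems (w k) B h)

variable {N : ℕ} {w : ℕ → ℕ}

/-- The frame rule of the tree: a representation depends only on the nodes in the subtree of `id`.
-/
theorem Rep.congr {k : ℕ} {V V' : Heap} {id : ℕ} {A : Set ℕ} (h : Rep N w k V id A)
    (hV : ∀ j, Desc N id j → SameAt V V' j) : Rep N w k V' id A := by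
  induction k generalizing id A with
  | zero =>
    have := hV id (Desc.refl _ _)
    exact ⟨h.1, this.1.trans h.2.1, this.2.trans h.2.2⟩
  | succ k ih =>
    have h0 := hV id (Desc.refl _ _)
    obtain ⟨hA, B, hs, h1, h2⟩ := h
    refine ⟨hA, B, by rwa [h0.1, h0.2], ih h1 fun j hj => hV j ?_, fun i hi =>
      ih (h2 i hi) fun j hj => hV j ?_⟩
    · exact Desc.of_child (d := 0) (Nat.zero_le _) (by simpa using hj)
    · exact Desc.of_child hi hj

theorem Inner.congr {k : ℕ} {V V' : Heap} {id : ℕ} {B : Set ℕ} (h : Inner N w k V id B)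
    (hV : ∀ d ≤ N, ∀ j, Desc N (id * (N + 1) + d) j → SameAt V V' j) : Inner N w k V' id B :=
  ⟨h.1.congr fun j hj => hV 0 (Nat.zero_le _) j (by simpa using hj),
    fun i hi => (h.2 i hi).congr fun j hj => hV (i + 1) hi j hj⟩

theorem Inner.set {k : ℕ} {V : Heap} {id : ℕ} {B : Set ℕ} (hid : 0 < id) (hN : 0 < N)
    (h : Inner N w k V id B) (p q : ℕ) : Inner N w k (V.set id p q) id B :=
  h.congr fun _ _ _ hj => sameAt_set fun he => Desc.not_child_self hid hN (he ▸ hj)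

theorem Rep.shape {k : ℕ} {V : Heap} {id : ℕ} {A : Set ℕ} (h : Rep N w k V id A) :
    ∃ B, Shape (V.mn id) (V.mx id) A B := by
  cases k with
  | zero => exact ⟨∅, Or.inl ⟨h.1, rfl, h.2⟩⟩
  | succ k => exact ⟨_, h.2.choose_spec.1⟩

theorem Rep.bound {k : ℕ} {V : Heap} {id : ℕ} {A : Set ℕ} (h : Rep N w k V id A) :
    ∀ y ∈ A, y < w k ∧ y < N := by
  cases k with
  | zero => rw [h.1]; simp
  | succ k => exact h.1

theorem Rep.mn_eq_zero {k : ℕ} {V : Heap} {id : ℕ} {A : Set ℕ} (h : Rep N w k V id A) :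
    V.mn id = 0 ↔ A = ∅ := by
  obtain ⟨B, h | ⟨a, h⟩ | ⟨a, b, h⟩⟩ := h.shape
  · simp [h]
  · simp [h]
  · have h1 : a ∈ A := by rw [h.2.1]; simp
    have h2 : A ≠ ∅ := fun h => by simp [h] at h1
    simp only [h2, iff_false]
    omega

theorem Rep.min {k : ℕ} {V : Heap} {id : ℕ} {A : Set ℕ} (h : Rep N w k V id A)
    (h0 : V.mn id ≠ 0) : V.mn id - 1 ∈ A ∧ ∀ y ∈ A, V.mn id ≤ y + 1 := by
  obtain ⟨B, h | ⟨a, h⟩ | ⟨a, b, hab, hA, hB, hp, hq⟩⟩ := h.shape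
  · exact absurd h.2.2.1 h0
  · simp [h]
  · simp only [hp, hA, Nat.add_sub_cancel, Set.mem_insert_iff, true_or, true_and]
    rintro y (rfl | rfl | hy)
    · omega
    · omega
    · have := hB y hy
      omega

theorem Rep.max {k : ℕ} {V : Heap} {id : ℕ} {A : Set ℕ} (h : Rep N w k V id A)
    (h0 : V.mx id ≠ 0) : V.mx id - 1 ∈ A ∧ ∀ y ∈ A, y + 1 ≤ V.mx id := by
  obtain ⟨B, h | ⟨a, h⟩ | ⟨a, b, hab, hA, hB, hp, hq⟩⟩ := h.shape
  · exact absurd h.2.2.2 h0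
  · simp [h]
  · simp only [hq, hA, Nat.add_sub_cancel, Set.mem_insert_iff, true_or, or_true, true_and]
    rintro y (rfl | rfl | hy)
    · omega
    · omega
    · have := hB y hy
      omega

theorem Rep.mx_eq_zero {k : ℕ} {V : Heap} {id : ℕ} {A : Set ℕ} (h : Rep N w k V id A) :
    V.mx id = 0 ↔ V.mn id = 0 := by
  obtain ⟨B, h | ⟨a, h⟩ | ⟨a, b, h⟩⟩ := h.shape
  · simp [h]
  · simp [h]
  · simp [h]

theorem Rep.eq_singleton {k : ℕ} {V : Heap} {id : ℕ} {A : Set ℕ} (h : Rep N w k V id A)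
    (h0 : V.mn id = V.mx id) {x : ℕ} (hx : x ∈ A) : A = {x} := by
  obtain ⟨B, h | ⟨a, h⟩ | ⟨a, b, h⟩⟩ := h.shape
  · simp [h.1] at hx
  · rw [h.1] at hx ⊢
    rw [Set.mem_singleton_iff.1 hx]
  · omega

theorem Rep.mn_eq_mx {k : ℕ} {V : Heap} {id x : ℕ} (h : Rep N w k V id {x}) :
    V.mn id = V.mx id := by
  obtain ⟨B, h | ⟨a, h⟩ | ⟨a, b, hab, hA, -⟩⟩ := h.shape
  · simp at h
  · rw [h.2.2.1, h.2.2.2]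
  · have h1 : a = x := by
      rw [← Set.mem_singleton_iff, hA]; simp
    have h2 : b = x := by
      rw [← Set.mem_singleton_iff, hA]; simp
    omega

/-! ### Quotient and remainder sets under insertion and deletion -/

theorem quots_empty (W : ℕ) : quots W ∅ = ∅ := by simp [quots]

theorem rems_empty (W h : ℕ) : rems W ∅ h = ∅ := by simp [rems]

theorem quots_eq_empty {W : ℕ} {B : Set ℕ} : quots W B = ∅ ↔ B = ∅ := by
  refine ⟨fun h => ?_, fun h => by rw [h, quots_empty]⟩
  ext y
  simp only [Set.mem_empty_iff_false, iff_false]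
  intro hy
  have : y / W ∈ quots W B := ⟨y, hy, rfl⟩
  simp [h] at this

theorem quots_insert (W y : ℕ) (B : Set ℕ) :
    quots W (insert y B) = insert (y / W) (quots W B) := by
  ext h
  simp [quots, eq_comm]

theorem rems_insert (W y : ℕ) (B : Set ℕ) :
    rems W (insert y B) (y / W) = insert (y % W) (rems W B (y / W)) := by
  ext h
  simp [rems, eq_comm]

theorem rems_insert_of_ne {W y h : ℕ} (B : Set ℕ) (hh : h ≠ y / W) :
    rems W (insert y B) h = rems W B h := by
  ext l
  simp [rems, hh.symm]

theorem mem_rems_iff {W y : ℕ} {B : Set ℕ} : y % W ∈ rems W B (y / W) ↔ y ∈ B := by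
  refine ⟨?_, fun h => ⟨y, h, rfl, rfl⟩⟩
  rintro ⟨z, hz, h1, h2⟩
  rwa [← Nat.div_add_mod y W, ← h1, ← h2, Nat.div_add_mod]

/-- The summary lists exactly the nonempty clusters. -/
theorem mem_quots_iff {W h : ℕ} {B : Set ℕ} : h ∈ quots W B ↔ rems W B h ≠ ∅ := by
  rw [← Set.nonempty_iff_ne_empty]
  constructor
  · rintro ⟨y, hy, rfl⟩
    exact ⟨_, y, hy, rfl, rfl⟩
  · rintro ⟨l, y, hy, h1, -⟩
    exact ⟨y, hy, h1⟩

theorem rems_diff (W y : ℕ) (B : Set ℕ) :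
    rems W (B \ {y}) (y / W) = rems W B (y / W) \ {y % W} := by
  ext l
  constructor
  · rintro ⟨z, hz, h1, rfl⟩
    refine ⟨⟨z, hz.1, h1, rfl⟩, fun h => hz.2 ?_⟩
    rw [Set.mem_singleton_iff] at h ⊢
    rw [← Nat.div_add_mod z W, h1, h, Nat.div_add_mod]
  · rintro ⟨⟨z, hz, h1, rfl⟩, h⟩
    refine ⟨z, ⟨hz, fun hy => h ?_⟩, h1, rfl⟩
    rw [Set.mem_singleton_iff] at hy ⊢
    rw [hy]

theorem rems_diff_of_ne {W y h : ℕ} (B : Set ℕ) (hh : h ≠ y / W) :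
    rems W (B \ {y}) h = rems W B h := by
  ext l
  constructor
  · rintro ⟨z, hz, h1, h2⟩
    exact ⟨z, hz.1, h1, h2⟩
  · rintro ⟨z, hz, h1, h2⟩
    exact ⟨z, ⟨hz, fun hy => hh (by rw [← h1, Set.mem_singleton_iff.1 hy])⟩, h1, h2⟩

/-- A quotient leaves the summary only when the last element of its cluster is deleted;
`quots_diff_of_ne` is the other case. -/
theorem quots_diff {W y : ℕ} {B : Set ℕ} (h : rems W B (y / W) = {y % W}) :
    quots W (B \ {y}) = quots W B \ {y / W} := by
  ext q
  by_cases hq : q = y / W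
  · subst hq
    rw [mem_quots_iff, rems_diff, h]
    simp
  · rw [mem_quots_iff, rems_diff_of_ne _ hq, ← mem_quots_iff]
    simp [hq]

theorem quots_diff_of_ne {W y : ℕ} {B : Set ℕ} (hy : y ∈ B) (h : rems W B (y / W) ≠ {y % W}) :
    quots W (B \ {y}) = quots W B := by
  ext q
  by_cases hq : q = y / W
  · subst hq
    rw [mem_quots_iff, rems_diff, mem_quots_iff]
    refine ⟨fun h1 h2 => h1 (by simp [h2]), fun _ h2 => h ?_⟩
    refine Set.Subset.antisymm (Set.sdiff_eq_empty.1 h2) ?_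
    rw [Set.singleton_subset_iff]
    exact mem_rems_iff.2 hy
  · rw [mem_quots_iff, rems_diff_of_ne _ hq, ← mem_quots_iff]

/-- Only the subtrees of the children of `id` have been changed. -/
def InnerFrame (N : ℕ) (V V' : Heap) (id : ℕ) : Prop :=
  ∀ j, (∀ d ≤ N, ¬ Desc N (id * (N + 1) + d) j) → SameAt V V' j

theorem InnerFrame.of_child {V V' : Heap} {id d : ℕ} (hd : d ≤ N)
    (h : ∀ j, ¬ Desc N (id * (N + 1) + d) j → SameAt V V' j) : InnerFrame N V V' id :=
  fun j hj => h j (hj d hd)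

theorem InnerFrame.not_desc {V V' : Heap} {id j : ℕ} (h : InnerFrame N V V' id)
    (hj : ¬ Desc N id j) : SameAt V V' j :=
  h j fun _ hd hc => hj (hc.of_child hd)

theorem InnerFrame.self {V V' : Heap} {id : ℕ} (h : InnerFrame N V V' id) (hid : 0 < id)
    (hN : 0 < N) : SameAt V V' id :=
  h id fun _ _ => Desc.not_child_self hid hN

/-- Both extremes lie outside of the clusters, so a singleton leaves all clusters empty and can be
written in constant time. This saves the second recursive call of an insertion. -/
theorem Inner.empty_single {k : ℕ} {V : Heap} {id l : ℕ} (hid : 0 < id)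
    (h : Rep N w (k + 1) V id ∅) (hl : l < w (k + 1)) (hN : l < N) :
    Rep N w (k + 1) (V.set id (l + 1) (l + 1)) id {l} := by
  obtain ⟨-, B, hs, h12⟩ := h
  have hB : B = ∅ := by
    rcases hs with h | ⟨a, h, -⟩ | ⟨a, b, -, h, -⟩
    · exact h.2.1
    · exact absurd h.symm (Set.singleton_ne_empty a)
    · exact absurd h.symm (Set.insert_nonempty _ _).ne_empty
  subst hB
  refine ⟨by simpa using ⟨hl, hN⟩, ∅, Or.inr (Or.inl ⟨l, rfl, rfl, ?_, ?_⟩), ?_⟩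
  · simp
  · simp
  · exact Inner.set hid (by omega) h12 _ _

/-- The counterpart for deletions: a singleton is cleared in constant time. -/
theorem Rep.single_empty {k : ℕ} {V : Heap} {id l : ℕ} (hid : 0 < id)
    (h : Rep N w k V id {l}) : Rep N w k (V.set id 0 0) id ∅ := by
  cases k with
  | zero => simp [Rep] at h
  | succ k =>
    have hN := (h.1 l rfl).2
    obtain ⟨-, B, hs, h12⟩ := h
    have hB : B = ∅ := by
      rcases hs with h | ⟨a, -, h, -⟩ | ⟨a, b, hab, h, -⟩
      · exact h.2.1
      · exact h
      · have h1 : a ∈ ({l} : Set ℕ) := by rw [h]; simp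
        have h2 : b ∈ ({l} : Set ℕ) := by rw [h]; simp
        simp only [Set.mem_singleton_iff] at h1 h2
        omega
    subst hB
    exact ⟨by simp, ∅, Or.inl ⟨rfl, rfl, by simp, by simp⟩, Inner.set hid (by omega) h12 _ _⟩

/-- Tabulated quotients and remainders of divisions by the universe size of the clusters, and
these universe sizes, for the nodes of every level. -/
structure Tables where
  div : ℕ → ℕ → ℕ
  mod : ℕ → ℕ → ℕ
  size : ℕ → ℕ

/-- The tables are correct for the levels up to `K`. -/
def Tables.Good (T : Tables) (N : ℕ) (w : ℕ → ℕ) (K : ℕ) : Prop :=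
  ∀ k < K, T.size (k + 1) = w k ∧
    ∀ y < N, T.div (k + 1) y = y / w k ∧ T.mod (k + 1) y = y % w k

theorem Tables.Good.mono {T : Tables} {K K' : ℕ} (h : T.Good N w K) (hK : K' ≤ K) :
    T.Good N w K' := fun k hk => h k (hk.trans_le hK)

/-- Insertion of an element with quotient `h` and remainder `l` below the node `id`, where `f`
inserts into a child. -/
def insInner (N : ℕ) (f : ℕ → ℕ → Heap → Heap) (id h l : ℕ) (V : Heap) : Heap :=
  if V.mn (id * (N + 1) + (h + 1)) = 0 then
    f (id * (N + 1)) h (V.set (id * (N + 1) + (h + 1)) (l + 1) (l + 1))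
  else f (id * (N + 1) + (h + 1)) l V

/-- Insertion of an element `x` into the set that is represented by the node `id`. -/
def ins (N : ℕ) (T : Tables) : ℕ → ℕ → ℕ → Heap → Heap
  | 0, _, _, V => V
  | k + 1, id, x, V =>
    if V.mn id = 0 then V.set id (x + 1) (x + 1)
    else if V.mn id = V.mx id then
      if x + 1 < V.mn id then V.set id (x + 1) (V.mx id) else V.set id (V.mn id) (x + 1)
    else if x + 1 < V.mn id then
      insInner N (ins N T k) id (T.div (k + 1) (V.mn id - 1)) (T.mod (k + 1) (V.mn id - 1))
        (V.set id (x + 1) (V.mx id))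
    else if V.mx id < x + 1 then
      insInner N (ins N T k) id (T.div (k + 1) (V.mx id - 1)) (T.mod (k + 1) (V.mx id - 1))
        (V.set id (V.mn id) (x + 1))
    else insInner N (ins N T k) id (T.div (k + 1) x) (T.mod (k + 1) x) V

/-- If the cluster of `y` is empty, it is filled directly and the recursion goes to the summary.
Otherwise the summary already contains the quotient and the recursion goes to the cluster. The
assumption `hf` is the specification of this single call. -/
theorem insInner_spec {k : ℕ} {f : ℕ → ℕ → Heap → Heap}
    (hf : ∀ V id A x, 0 < id → Rep N w (k + 1) V id A → x ∉ A → x < w (k + 1) → x < N →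
      Rep N w (k + 1) (f id x V) id (insert x A) ∧ ∀ j, ¬ Desc N id j → SameAt V (f id x V) j)
    {V : Heap} {id y : ℕ} {B : Set ℕ} (hid : 0 < id) (h : Inner N w (k + 1) V id B) (hy : y ∉ B)
    (hyw : y < w (k + 1) * w (k + 1)) (hyN : y < N) :
    Inner N w (k + 1) (insInner N f id (y / w (k + 1)) (y % w (k + 1)) V) id (insert y B) ∧
      InnerFrame N V (insInner N f id (y / w (k + 1)) (y % w (k + 1)) V) id := by
  have hW : 0 < w (k + 1) := Nat.pos_of_ne_zero fun h0 => by simp [h0] at hyw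
  have hq : y / w (k + 1) < w (k + 1) := Nat.div_lt_of_lt_mul hyw
  have hr : y % w (k + 1) < w (k + 1) := Nat.mod_lt _ hW
  have hqN : y / w (k + 1) < N := (Nat.div_le_self _ _).trans_lt hyN
  have hrN : y % w (k + 1) < N := (Nat.mod_le _ _).trans_lt hyN
  have hc := h.2 _ hqN
  have hid2 : 0 < id * (N + 1) := by positivity
  have hno : y % w (k + 1) ∉ rems (w (k + 1)) B (y / w (k + 1)) := fun h => hy (mem_rems_iff.1 h)
  rw [insInner]
  split_ifs with h0
  · have he := hc.mn_eq_zero.1 h0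
    rw [he] at hc
    have h1 := Inner.empty_single (Nat.succ_pos _) hc hr hrN
    set V1 := V.set (id * (N + 1) + (y / w (k + 1) + 1)) (y % w (k + 1) + 1) (y % w (k + 1) + 1)
      with hV1
    have hsum : Rep N w (k + 1) V1 (id * (N + 1)) (quots (w (k + 1)) B) :=
      h.1.congr fun j hj => sameAt_set_child hid (Nat.zero_le _) hqN (Nat.succ_ne_zero _).symm
        (Desc.summary.2 hj)
    obtain ⟨r, fr⟩ := hf _ _ _ _ hid2 hsum (by simp [mem_quots_iff, he]) hq hqN
    have fr' : ∀ d ≤ N, d ≠ 0 → ∀ j, Desc N (id * (N + 1) + d) j →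
        SameAt V1 (f (id * (N + 1)) (y / w (k + 1)) V1) j := fun d hd hd0 j hj =>
      fr j fun hj' => hd0 (Desc.child_unique hid hd (Nat.zero_le _) hj (Desc.summary.2 hj'))
    refine ⟨⟨?_, fun i hi => ?_⟩, fun j hj => ?_⟩
    · rw [quots_insert]
      exact r
    · by_cases hiq : i = y / w (k + 1)
      · subst hiq
        rw [rems_insert, he, insert_empty_eq]
        exact h1.congr (fr' _ hqN (Nat.succ_ne_zero _))
      · rw [rems_insert_of_ne _ hiq]
        exact (h.2 i hi).congr fun j hj => (sameAt_set_child hid hi hqN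
          (fun he => hiq (Nat.succ_injective he)) hj).trans (fr' _ hi (Nat.succ_ne_zero _) j hj)
    · exact (sameAt_set_of_not_desc (hj _ hqN)).trans (fr j (hj 0 (Nat.zero_le _)))
  · have hne : rems (w (k + 1)) B (y / w (k + 1)) ≠ ∅ := fun he => h0 (hc.mn_eq_zero.2 he)
    obtain ⟨r, fr⟩ := hf _ _ _ _ (Nat.succ_pos _) hc hno hr hrN
    refine ⟨⟨?_, fun i hi => ?_⟩, InnerFrame.of_child hqN fr⟩
    · rw [quots_insert, Set.insert_eq_of_mem (mem_quots_iff.2 hne)]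
      exact h.1.congr fun j hj => fr j fun hj' => Nat.succ_ne_zero _
        (Desc.child_unique hid (Nat.zero_le _) hqN (Desc.summary.2 hj) hj').symm
    · by_cases hiq : i = y / w (k + 1)
      · subst hiq
        rw [rems_insert]
        exact r
      · rw [rems_insert_of_ne _ hiq]
        exact (h.2 i hi).congr fun j hj => fr j fun hj' =>
          hiq (Nat.succ_injective (Desc.child_unique hid hi hqN hj hj'))

/-- Something is pushed below the node only if it already holds two elements, so `hI` is needed in
that case alone. This lets the same step serve the lowest level. -/
theorem ins_step {k : ℕ} {V : Heap} {id : ℕ} {A : Set ℕ} {x : ℕ} {T : Tables}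
    (hT : T.Good N w (k + 1)) (hid : 0 < id) (h : Rep N w (k + 1) V id A) (hx : x ∉ A)
    (hxw : x < w (k + 1)) (hxN : x < N)
    (hI : (∃ a ∈ A, ∃ b ∈ A, a ≠ b) → ∀ B V y, Inner N w k V id B → y ∉ B → y < w (k + 1) → y < N →
      Inner N w k (insInner N (ins N T k) id (y / w k) (y % w k) V) id (insert y B) ∧
      InnerFrame N V (insInner N (ins N T k) id (y / w k) (y % w k) V) id) :
    Rep N w (k + 1) (ins N T (k + 1) id x V) id (insert x A) ∧
      ∀ j, ¬ Desc N id j → SameAt V (ins N T (k + 1) id x V) j := by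
  have hN : 0 < N := by omega
  obtain ⟨hA, B, hs, hB⟩ := h
  change Inner N w k V id B at hB
  have hbd : ∀ y ∈ insert x A, y < w (k + 1) ∧ y < N := by
    rintro y (rfl | hy)
    · exact ⟨hxw, hxN⟩
    · exact hA y hy
  have hset : ∀ p q j, ¬ Desc N id j → SameAt V (V.set id p q) j := fun p q j hj =>
    sameAt_set_of_not_desc hj
  rw [ins]
  rcases hs with ⟨rfl, rfl, hp, hq⟩ | ⟨a, rfl, rfl, hp, hq⟩ | ⟨a, b, hab, hAB, hlt, hp, hq⟩
  · rw [if_pos hp]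
    exact ⟨⟨hbd, ∅, Or.inr (Or.inl ⟨x, by simp, rfl, by simp, by simp⟩), hB.set hid hN _ _⟩,
      hset _ _⟩
  · have hxa : x ≠ a := hx
    rw [if_neg (by omega), if_pos (by omega)]
    split_ifs with h1
    · exact ⟨⟨hbd, ∅, Or.inr (Or.inr ⟨x, a, by omega, by simp, by simp, by simp, by simp [hq]⟩),
        hB.set hid hN _ _⟩, hset _ _⟩
    · exact ⟨⟨hbd, ∅, Or.inr (Or.inr ⟨a, x, by omega, by simp [Set.pair_comm], by simp,
        by simp [hp], by simp⟩), hB.set hid hN _ _⟩, hset _ _⟩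
  · have haA : a ∈ A := by rw [hAB]; simp
    have hbA : b ∈ A := by rw [hAB]; simp
    have hxa : x ≠ a := fun h => hx (h ▸ haA)
    have hxb : x ≠ b := fun h => hx (h ▸ hbA)
    have hxB : x ∉ B := fun h => hx (by rw [hAB]; simp [h])
    have hI' := hI ⟨a, haA, b, hbA, hab.ne⟩ B
    rw [if_neg (by omega), if_neg (by omega)]
    have hT' := fun y hy => (hT k (Nat.lt_succ_self k)).2 y hy
    have haN := (hA a haA).2
    have hbN := (hA b hbA).2
    rw [(hT' (V.mn id - 1) (by omega)).1, (hT' (V.mn id - 1) (by omega)).2,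
      (hT' (V.mx id - 1) (by omega)).1, (hT' (V.mx id - 1) (by omega)).2, (hT' x hxN).1,
      (hT' x hxN).2]
    split_ifs with h1 h2
    -- The new element takes the place of the minimum, and the old minimum is pushed down. The next
    -- case does the same with the maximum.
    · obtain ⟨r, f⟩ := hI' _ (V.mn id - 1) (hB.set hid hN (x + 1) (V.mx id))
        (fun h => by have := hlt _ h; omega) (by have := hA a haA; omega)
        (by have := hA a haA; omega)
      have fs := f.self hid hN
      refine ⟨⟨hbd, _, Or.inr (Or.inr ⟨x, b, by omega, ?_, ?_, ?_, ?_⟩), r⟩,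
        fun j hj => (hset _ _ j hj).trans (f.not_desc hj)⟩
      · rw [hAB, hp, Nat.add_sub_cancel, Set.insert_comm a b]
      · rintro y (rfl | hy)
        · omega
        · have := hlt y hy
          omega
      · rw [fs.1, Heap.set_mn]
      · rw [fs.2, Heap.set_mx, hq]
    · obtain ⟨r, f⟩ := hI' _ (V.mx id - 1) (hB.set hid hN (V.mn id) (x + 1))
        (fun h => by have := hlt _ h; omega) (by have := hA b hbA; omega)
        (by have := hA b hbA; omega)
      have fs := f.self hid hN
      refine ⟨⟨hbd, _, Or.inr (Or.inr ⟨a, x, by omega, ?_, ?_, ?_, ?_⟩), r⟩,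
        fun j hj => (hset _ _ j hj).trans (f.not_desc hj)⟩
      · rw [hAB, hq, Nat.add_sub_cancel, Set.insert_comm a x]
      · rintro y (rfl | hy)
        · omega
        · have := hlt y hy
          omega
      · rw [fs.1, Heap.set_mn, hp]
      · rw [fs.2, Heap.set_mx]
    · obtain ⟨r, f⟩ := hI' _ x hB hxB hxw hxN
      have fs := f.self hid hN
      refine ⟨⟨hbd, _, Or.inr (Or.inr ⟨a, b, by omega, ?_, ?_, ?_, ?_⟩), r⟩,
        fun j hj => f.not_desc hj⟩
      · rw [hAB, Set.insert_comm x a, Set.insert_comm x b]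
      · rintro y (rfl | hy)
        · omega
        · have := hlt y hy
          omega
      · rw [fs.1, hp]
      · rw [fs.2, hq]

theorem ins_spec (hw1 : w 1 = 2) (hw : ∀ k, w (k + 2) = w (k + 1) * w (k + 1)) (k : ℕ)
    (T : Tables) (hT : T.Good N w (k + 1)) (V : Heap) (id : ℕ) (A : Set ℕ) (x : ℕ) (hid : 0 < id)
    (h : Rep N w (k + 1) V id A)
    (hx : x ∉ A) (hxw : x < w (k + 1)) (hxN : x < N) :
    Rep N w (k + 1) (ins N T (k + 1) id x V) id (insert x A) ∧
      ∀ j, ¬ Desc N id j → SameAt V (ins N T (k + 1) id x V) j := by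
  induction k generalizing V id A x with
  | zero =>
    refine ins_step hT hid h hx hxw hxN ?_
    -- At level `1` the universe has size `2`: two present elements leave no room for a new `x`, so
    -- nothing is ever pushed down to level `0`.
    rintro ⟨a, ha, b, hb, hab⟩
    have h1 := (h.bound a ha).1
    have h2 := (h.bound b hb).1
    have h3 : x ≠ a := fun h => hx (h ▸ ha)
    have h4 : x ≠ b := fun h => hx (h ▸ hb)
    simp only [zero_add, hw1] at h1 h2 hxw
    omega
  | succ k ih =>
    exact ins_step hT hid h hx hxw hxN fun _ B V y hB hy hyw hyN =>
      insInner_spec (ih (hT.mono (Nat.le_succ _))) hid hB hy (by rwa [← hw]) hyN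

/-- Deletion of the element with quotient `h` and remainder `l` below the node `id`, where `f`
deletes from a child. -/
def delInner (N : ℕ) (f : ℕ → ℕ → Heap → Heap) (id h l : ℕ) (V : Heap) : Heap :=
  if V.mn (id * (N + 1) + (h + 1)) = V.mx (id * (N + 1) + (h + 1)) then
    f (id * (N + 1)) h (V.set (id * (N + 1) + (h + 1)) 0 0)
  else f (id * (N + 1) + (h + 1)) l V

/-- The smallest element below the node `id`, when the clusters have universe size `W`. -/
def innerMin (N W id : ℕ) (V : Heap) : ℕ :=
  (V.mn (id * (N + 1)) - 1) * W + (V.mn (id * (N + 1) + V.mn (id * (N + 1))) - 1)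

/-- The largest element below the node `id`, when the clusters have universe size `W`. -/
def innerMax (N W id : ℕ) (V : Heap) : ℕ :=
  (V.mx (id * (N + 1)) - 1) * W + (V.mx (id * (N + 1) + V.mx (id * (N + 1))) - 1)

/-- Deletion of an element `x` of the set that is represented by the node `id`. -/
def del (N : ℕ) (T : Tables) : ℕ → ℕ → ℕ → Heap → Heap
  | 0, _, _, V => V
  | k + 1, id, x, V =>
    if V.mn id = V.mx id then V.set id 0 0
    else if V.mn (id * (N + 1)) = 0 then
      if x + 1 = V.mn id then V.set id (V.mx id) (V.mx id) else V.set id (V.mn id) (V.mn id)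
    else if x + 1 = V.mn id then
      delInner N (del N T k) id (T.div (k + 1) (innerMin N (T.size (k + 1)) id V))
        (T.mod (k + 1) (innerMin N (T.size (k + 1)) id V))
        (V.set id (innerMin N (T.size (k + 1)) id V + 1) (V.mx id))
    else if x + 1 = V.mx id then
      delInner N (del N T k) id (T.div (k + 1) (innerMax N (T.size (k + 1)) id V))
        (T.mod (k + 1) (innerMax N (T.size (k + 1)) id V))
        (V.set id (V.mn id) (innerMax N (T.size (k + 1)) id V + 1))
    else delInner N (del N T k) id (T.div (k + 1) x) (T.mod (k + 1) x) V

/-- A cluster that consists of `y` alone is cleared directly and its quotient is deleted from the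
summary. Otherwise the cluster stays nonempty and the summary does not change. Again there is one
recursive call. -/
theorem delInner_spec {k : ℕ} {f : ℕ → ℕ → Heap → Heap}
    (hf : ∀ V id A x, 0 < id → Rep N w k V id A → x ∈ A →
      Rep N w k (f id x V) id (A \ {x}) ∧ ∀ j, ¬ Desc N id j → SameAt V (f id x V) j)
    {V : Heap} {id y : ℕ} {B : Set ℕ} (hid : 0 < id) (h : Inner N w k V id B) (hy : y ∈ B)
    (hyN : y < N) :
    Inner N w k (delInner N f id (y / w k) (y % w k) V) id (B \ {y}) ∧
      InnerFrame N V (delInner N f id (y / w k) (y % w k) V) id := by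
  have hqN : y / w k < N := (Nat.div_le_self _ _).trans_lt hyN
  have hc := h.2 _ hqN
  have hid2 : 0 < id * (N + 1) := by positivity
  have hyr : y % w k ∈ rems (w k) B (y / w k) := mem_rems_iff.2 hy
  rw [delInner]
  split_ifs with h0
  · have he := hc.eq_singleton h0 hyr
    rw [he] at hc
    have h1 := hc.single_empty (Nat.succ_pos _)
    set V1 := V.set (id * (N + 1) + (y / w k + 1)) 0 0 with hV1
    have hsum : Rep N w k V1 (id * (N + 1)) (quots (w k) B) :=
      h.1.congr fun j hj => sameAt_set_child hid (Nat.zero_le _) hqN (Nat.succ_ne_zero _).symm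
        (Desc.summary.2 hj)
    obtain ⟨r, fr⟩ := hf _ _ _ (y / w k) hid2 hsum ⟨y, hy, rfl⟩
    have fr' : ∀ d ≤ N, d ≠ 0 → ∀ j, Desc N (id * (N + 1) + d) j →
        SameAt V1 (f (id * (N + 1)) (y / w k) V1) j := fun d hd hd0 j hj =>
      fr j fun hj' => hd0 (Desc.child_unique hid hd (Nat.zero_le _) hj (Desc.summary.2 hj'))
    refine ⟨⟨?_, fun i hi => ?_⟩, fun j hj => ?_⟩
    · rw [quots_diff he]
      exact r
    · by_cases hiq : i = y / w k
      · subst hiq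
        rw [rems_diff, he, Set.sdiff_self]
        exact h1.congr (fr' _ hqN (Nat.succ_ne_zero _))
      · rw [rems_diff_of_ne _ hiq]
        exact (h.2 i hi).congr fun j hj => (sameAt_set_child hid hi hqN
          (fun he => hiq (Nat.succ_injective he)) hj).trans (fr' _ hi (Nat.succ_ne_zero _) j hj)
    · exact (sameAt_set_of_not_desc (hj _ hqN)).trans (fr j (hj 0 (Nat.zero_le _)))
  · obtain ⟨r, fr⟩ := hf _ _ _ _ (Nat.succ_pos _) hc hyr
    refine ⟨⟨?_, fun i hi => ?_⟩, InnerFrame.of_child hqN fr⟩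
    · rw [quots_diff_of_ne hy fun he => h0 (by rw [he] at hc; exact hc.mn_eq_mx)]
      exact h.1.congr fun j hj => fr j fun hj' => Nat.succ_ne_zero _
        (Desc.child_unique hid (Nat.zero_le _) hqN (Desc.summary.2 hj) hj').symm
    · by_cases hiq : i = y / w k
      · subst hiq
        rw [rems_diff]
        exact r
      · rw [rems_diff_of_ne _ hiq]
        exact (h.2 i hi).congr fun j hj => fr j fun hj' =>
          hiq (Nat.succ_injective (Desc.child_unique hid hi hqN hj hj'))

/-- The smallest element below the node `id`. -/
theorem Inner.min {k : ℕ} {V : Heap} {id : ℕ} {B : Set ℕ} (h : Inner N w k V id B)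
    (hB : ∀ y ∈ B, y < N) (h0 : V.mn (id * (N + 1)) ≠ 0) :
    innerMin N (w k) id V ∈ B ∧ ∀ y ∈ B, innerMin N (w k) id V ≤ y := by
  rw [innerMin]
  obtain ⟨⟨z, hz, hzq⟩, hmin⟩ := h.1.min h0
  have hqN : V.mn (id * (N + 1)) - 1 < N := hzq ▸ (Nat.div_le_self _ _).trans_lt (hB z hz)
  have hc := h.2 _ hqN
  rw [Nat.sub_add_cancel (by omega)] at hc
  -- The smallest quotient comes from an element `z`, so its cluster is nonempty and has a minimum.
  obtain ⟨⟨y, hy, hyq, hyr⟩, hmin2⟩ := hc.min fun h => by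
    have h1 : z % w k ∈ rems (w k) B (V.mn (id * (N + 1)) - 1) := ⟨z, hz, hzq, rfl⟩
    rw [hc.mn_eq_zero.1 h] at h1
    exact h1
  rw [← hyq, ← hyr, mul_comm, Nat.div_add_mod]
  refine ⟨hy, fun v hv => ?_⟩
  have h1 := hmin (v / w k) ⟨v, hv, rfl⟩
  rcases (show V.mn (id * (N + 1)) - 1 ≤ v / w k by omega).eq_or_lt with h2 | h2
  · have h3 := hmin2 (v % w k) ⟨v, hv, h2.symm, rfl⟩
    rw [← Nat.div_add_mod y (w k), ← Nat.div_add_mod v (w k), ← h2, hyq]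
    omega
  · rw [← hyq] at h2
    exact (Nat.lt_of_div_lt_div h2).le

/-- The largest element below the node `id`. -/
theorem Inner.max {k : ℕ} {V : Heap} {id : ℕ} {B : Set ℕ} (h : Inner N w k V id B)
    (hB : ∀ y ∈ B, y < N) (h0 : V.mx (id * (N + 1)) ≠ 0) :
    innerMax N (w k) id V ∈ B ∧ ∀ y ∈ B, y ≤ innerMax N (w k) id V := by
  rw [innerMax]
  obtain ⟨⟨z, hz, hzq⟩, hmax⟩ := h.1.max h0
  have hqN : V.mx (id * (N + 1)) - 1 < N := hzq ▸ (Nat.div_le_self _ _).trans_lt (hB z hz)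
  have hc := h.2 _ hqN
  rw [Nat.sub_add_cancel (by omega)] at hc
  obtain ⟨⟨y, hy, hyq, hyr⟩, hmax2⟩ := hc.max fun h => by
    have h1 : z % w k ∈ rems (w k) B (V.mx (id * (N + 1)) - 1) := ⟨z, hz, hzq, rfl⟩
    rw [hc.mn_eq_zero.1 (hc.mx_eq_zero.1 h)] at h1
    exact h1
  rw [← hyq, ← hyr, mul_comm, Nat.div_add_mod]
  refine ⟨hy, fun v hv => ?_⟩
  have h1 := hmax (v / w k) ⟨v, hv, rfl⟩
  rcases (show v / w k ≤ V.mx (id * (N + 1)) - 1 by omega).eq_or_lt with h2 | h2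
  · have h3 := hmax2 (v % w k) ⟨v, hv, h2, rfl⟩
    rw [← Nat.div_add_mod y (w k), ← Nat.div_add_mod v (w k), h2, hyq]
    omega
  · rw [← hyq] at h2
    exact (Nat.lt_of_div_lt_div h2).le

theorem Inner.mn_eq_zero {k : ℕ} {V : Heap} {id : ℕ} {B : Set ℕ} (h : Inner N w k V id B) :
    V.mn (id * (N + 1)) = 0 ↔ B = ∅ := h.1.mn_eq_zero.trans quots_eq_empty

/-- Extreme elements are not stored below the node. A deleted extreme is replaced by the nearest
element from below, and this element is deleted there instead. -/
theorem del_spec (k : ℕ) (T : Tables) (hT : T.Good N w k) (V : Heap) (id : ℕ) (A : Set ℕ) (x : ℕ)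
    (hid : 0 < id)
    (h : Rep N w k V id A) (hx : x ∈ A) :
    Rep N w k (del N T k id x V) id (A \ {x}) ∧
      ∀ j, ¬ Desc N id j → SameAt V (del N T k id x V) j := by
  induction k generalizing V id A x with
  | zero => simp [h.1] at hx
  | succ k ih =>
    have hI := fun (V : Heap) (B : Set ℕ) (y : ℕ) =>
      delInner_spec (V := V) (B := B) (y := y) (ih (hT.mono (Nat.le_succ _))) hid
    have hN : 0 < N := Nat.zero_lt_of_lt (h.bound x hx).2
    have hT' := fun y hy => (hT k (Nat.lt_succ_self k)).2 y hy
    have hrep := h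
    obtain ⟨hA, B, hs, hB⟩ := h
    change Inner N w k V id B at hB
    have hbd : ∀ y ∈ A \ {x}, y < w (k + 1) ∧ y < N := fun y hy => hA y hy.1
    have hset : ∀ p q j, ¬ Desc N id j → SameAt V (V.set id p q) j := fun p q j hj =>
      sameAt_set_of_not_desc hj
    rw [del]
    by_cases h0 : V.mn id = V.mx id
    · rw [if_pos h0]
      obtain rfl : A = {x} := hrep.eq_singleton h0 hx
      rw [Set.sdiff_self]
      exact ⟨hrep.single_empty hid, hset _ _⟩
    rcases hs with ⟨rfl, rfl, hp, hq⟩ | ⟨a, rfl, rfl, hp, hq⟩ | ⟨a, b, hab, hAB, hlt, hp, hq⟩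
    · omega
    · omega
    rw [if_neg h0]
    have haA : a ∈ A := by rw [hAB]; simp
    have hbA : b ∈ A := by rw [hAB]; simp
    have haB : a ∉ B := fun h => (hlt a h).1.false
    have hbB : b ∉ B := fun h => (hlt b h).2.false
    have hBA : ∀ y ∈ B, y ∈ A := fun y hy => by rw [hAB]; simp [hy]
    have hBN : ∀ y ∈ B, y < N := fun y hy => (hA y (hBA y hy)).2
    by_cases hs0 : V.mn (id * (N + 1)) = 0
    · rw [if_pos hs0]
      obtain rfl := hB.mn_eq_zero.1 hs0
      have hx' : x = a ∨ x = b := by simpa [hAB] using hx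
      split_ifs with h1
      · have hxa : x = a := by omega
        subst hxa
        refine ⟨⟨hbd, ∅, Or.inr (Or.inl ⟨b, ?_, rfl, by simp [hq], by simp [hq]⟩),
          hB.set hid hN _ _⟩, hset _ _⟩
        rw [hAB]
        ext y
        simp
        omega
      · have hxb : x = b := by omega
        subst hxb
        refine ⟨⟨hbd, ∅, Or.inr (Or.inl ⟨a, ?_, rfl, by simp [hp], by simp [hp]⟩),
          hB.set hid hN _ _⟩, hset _ _⟩
        rw [hAB]
        ext y
        simp
        omega
    · rw [if_neg hs0]
      split_ifs with h1 h2
      · have hxa : x = a := by omega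
        subst hxa
        rw [(hT k (Nat.lt_succ_self k)).1]
        obtain ⟨hm, hmin⟩ := hB.min hBN hs0
        rw [(hT' _ (hBN _ hm)).1, (hT' _ (hBN _ hm)).2]
        generalize innerMin N (w k) id V = m at *
        obtain ⟨r, f⟩ := hI _ B m (hB.set hid hN (m + 1) (V.mx id)) hm (hBN _ hm)
        have fs := f.self hid hN
        refine ⟨⟨hbd, _, Or.inr (Or.inr ⟨m, b, (hlt m hm).2, ?_, ?_, ?_, ?_⟩), r⟩,
          fun j hj => (hset _ _ j hj).trans (f.not_desc hj)⟩
        · rw [Set.insert_comm, Set.insert_sdiff_singleton, Set.insert_eq_of_mem hm, hAB,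
            Set.insert_sdiff_self_of_notMem]
          simp [haB, hab.ne]
        · rintro y ⟨hy, hym⟩
          exact ⟨lt_of_le_of_ne (hmin y hy) (Ne.symm hym), (hlt y hy).2⟩
        · rw [fs.1, Heap.set_mn]
        · rw [fs.2, Heap.set_mx, hq]
      · have hxb : x = b := by omega
        subst hxb
        rw [(hT k (Nat.lt_succ_self k)).1]
        obtain ⟨hm, hmax⟩ := hB.max hBN (fun h => hs0 (hB.1.mx_eq_zero.1 h))
        rw [(hT' _ (hBN _ hm)).1, (hT' _ (hBN _ hm)).2]
        generalize innerMax N (w k) id V = m at *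
        obtain ⟨r, f⟩ := hI _ B m (hB.set hid hN (V.mn id) (m + 1)) hm (hBN _ hm)
        have fs := f.self hid hN
        refine ⟨⟨hbd, _, Or.inr (Or.inr ⟨a, m, (hlt m hm).1, ?_, ?_, ?_, ?_⟩), r⟩,
          fun j hj => (hset _ _ j hj).trans (f.not_desc hj)⟩
        · rw [Set.insert_sdiff_singleton, Set.insert_eq_of_mem hm, hAB, Set.insert_comm,
            Set.insert_sdiff_self_of_notMem]
          simp [hbB, hab.ne']
        · rintro y ⟨hy, hym⟩
          exact ⟨(hlt y hy).1, lt_of_le_of_ne (hmax y hy) hym⟩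
        · rw [fs.1, Heap.set_mn, hp]
        · rw [fs.2, Heap.set_mx]
      · have hxa : x ≠ a := by omega
        have hxb : x ≠ b := by omega
        have hxB : x ∈ B := by
          rw [hAB] at hx
          simpa [hxa, hxb] using hx
        rw [(hT' _ (hBN _ hxB)).1, (hT' _ (hBN _ hxB)).2]
        obtain ⟨r, f⟩ := hI _ B x hB hxB (hBN _ hxB)
        have fs := f.self hid hN
        refine ⟨⟨hbd, _, Or.inr (Or.inr ⟨a, b, hab, ?_, fun y hy => hlt y hy.1, ?_, ?_⟩), r⟩,
          fun j hj => f.not_desc hj⟩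
        · rw [hAB, Set.insert_sdiff_of_notMem _ (by simpa using hxa.symm),
            Set.insert_sdiff_of_notMem _ (by simpa using hxb.symm)]
        · rw [fs.1, hp]
        · rw [fs.2, hq]

/-- Does the set that is represented by the node `id` have an element between `a` and `b`? -/
def qry (N : ℕ) (T : Tables) (V : Heap) : ℕ → ℕ → ℕ → ℕ → Bool
  | 0, _, _, _ => false
  | k + 1, id, a, b =>
    if a < V.mn id ∧ V.mn id ≤ b + 1 then true
    else if a < V.mx id ∧ V.mx id ≤ b + 1 then true
    else if V.mn (id * (N + 1)) = 0 then false
    else if T.div (k + 1) a = T.div (k + 1) b then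
      qry N T V k (id * (N + 1) + (T.div (k + 1) a + 1)) (T.mod (k + 1) a) (T.mod (k + 1) b)
    else if T.mod (k + 1) a < V.mx (id * (N + 1) + (T.div (k + 1) a + 1)) then true
    else if 0 < V.mn (id * (N + 1) + (T.div (k + 1) b + 1)) ∧
        V.mn (id * (N + 1) + (T.div (k + 1) b + 1)) ≤ T.mod (k + 1) b + 1 then true
    else if T.div (k + 1) a + 1 < T.div (k + 1) b then
      qry N T V k (id * (N + 1)) (T.div (k + 1) a + 1) (T.div (k + 1) b - 1)
    else false

/-- If `a` and `b` lie in different clusters, the two boundary clusters are settled by one look at a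
maximum and a minimum, and only the quotients strictly between remain for a recursive search in the
summary. -/
theorem qry_spec (k : ℕ) (T : Tables) (hT : T.Good N w k) (V : Heap) (id : ℕ) (A : Set ℕ)
    (a b : ℕ) (h : Rep N w k V id A) (hab : a ≤ b) (hb : b < N) :
    qry N T V k id a b = true ↔ ∃ y ∈ A, a ≤ y ∧ y ≤ b := by
  induction k generalizing id A a b with
  | zero => simp [h.1, qry]
  | succ k ih =>
    have hmin := h.min
    have hmax := h.max
    have hmx := h.mx_eq_zero
    obtain ⟨hA, B, hs, hB⟩ := h
    change Inner N w k V id B at hB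
    have hBN : ∀ y ∈ B, y < N := by
      rcases hs with h | h | ⟨c, d, -, h, -⟩
      · simp [h.2.1]
      · obtain ⟨c, -, h, -⟩ := h
        simp [h]
      · exact fun y hy => (hA y (by rw [h]; simp [hy])).2
    rw [qry]
    have hT' := fun y hy => (hT k (Nat.lt_succ_self k)).2 y hy
    rw [(hT' a (by omega)).1, (hT' a (by omega)).2, (hT' b hb).1, (hT' b hb).2]
    by_cases h1 : a < V.mn id ∧ V.mn id ≤ b + 1
    · rw [if_pos h1]
      exact iff_of_true rfl ⟨_, (hmin (by omega)).1, by omega, by omega⟩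
    by_cases h2 : a < V.mx id ∧ V.mx id ≤ b + 1
    · rw [if_neg h1, if_pos h2]
      exact iff_of_true rfl ⟨_, (hmax (by omega)).1, by omega, by omega⟩
    rw [if_neg h1, if_neg h2]
    -- Neither extreme element lies in the interval, so only the elements below the node matter.
    have key : (∃ y ∈ A, a ≤ y ∧ y ≤ b) ↔ ∃ y ∈ B, a ≤ y ∧ y ≤ b := by
      rcases hs with ⟨rfl, rfl, -⟩ | ⟨c, rfl, rfl, hp, hq⟩ | ⟨c, d, hcd, hAB, hlt, hp, hq⟩
      · rfl
      · simp
        omega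
      · rw [hAB]
        simp only [Set.mem_insert_iff, exists_eq_or_imp]
        constructor
        · rintro (h | h | h)
          · omega
          · omega
          · exact h
        · exact fun h => Or.inr (Or.inr h)
    rw [key]
    by_cases h3 : V.mn (id * (N + 1)) = 0
    · rw [if_pos h3, hB.mn_eq_zero.1 h3]
      simp
    rw [if_neg h3]
    have hqa : a / w k ≤ b / w k := Nat.div_le_div_right hab
    have hqb : b / w k < N := (Nat.div_le_self _ _).trans_lt hb
    have hca := hB.2 _ (hqa.trans_lt hqb)
    have hcb := hB.2 _ hqb
    have da := Nat.div_add_mod a (w k)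
    have db := Nat.div_add_mod b (w k)
    by_cases h4 : a / w k = b / w k
    · rw [if_pos h4]
      rw [h4] at da
      rw [ih (hT.mono (Nat.le_succ _)) _ _ _ _ hca (by omega) ((Nat.mod_le _ _).trans_lt hb)]
      constructor
      · rintro ⟨_, ⟨y, hy, hyq, rfl⟩, hl1, hl2⟩
        have dy := Nat.div_add_mod y (w k)
        rw [hyq, h4] at dy
        exact ⟨y, hy, by omega, by omega⟩
      · rintro ⟨y, hy, hay, hyb⟩
        have dy := Nat.div_add_mod y (w k)
        have q1 : a / w k ≤ y / w k := Nat.div_le_div_right hay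
        have q2 : y / w k ≤ b / w k := Nat.div_le_div_right hyb
        have q3 : y / w k = b / w k := by omega
        refine ⟨_, ⟨y, hy, by omega, rfl⟩, ?_, ?_⟩
        · rw [q3] at dy
          omega
        · rw [q3] at dy
          omega
    rw [if_neg h4]
    have hlt : a / w k < b / w k := lt_of_le_of_ne hqa h4
    by_cases h5 : a % w k < V.mx (id * (N + 1) + (a / w k + 1))
    · rw [if_pos h5]
      obtain ⟨y, hy, hyq, hyr⟩ := (hca.max (by omega)).1
      have dy := Nat.div_add_mod y (w k)
      rw [hyq] at dy
      refine iff_of_true rfl ⟨y, hy, by omega, ?_⟩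
      rw [← hyq] at hlt
      exact (Nat.lt_of_div_lt_div hlt).le
    rw [if_neg h5]
    by_cases h6 : 0 < V.mn (id * (N + 1) + (b / w k + 1)) ∧
        V.mn (id * (N + 1) + (b / w k + 1)) ≤ b % w k + 1
    · rw [if_pos h6]
      obtain ⟨y, hy, hyq, hyr⟩ := (hcb.min (by omega)).1
      have dy := Nat.div_add_mod y (w k)
      rw [hyq] at dy
      refine iff_of_true rfl ⟨y, hy, ?_, by omega⟩
      rw [← hyq] at hlt
      exact (Nat.lt_of_div_lt_div hlt).le
    rw [if_neg h6]
    -- `h5` and `h6` exclude hits in the boundary clusters, and every element with a quotient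
    -- strictly between lies in the interval.
    have key2 : (∃ y ∈ B, a ≤ y ∧ y ≤ b) ↔ ∃ q ∈ quots (w k) B, a / w k < q ∧ q < b / w k := by
      constructor
      · rintro ⟨y, hy, hay, hyb⟩
        have dy := Nat.div_add_mod y (w k)
        have q1 : a / w k ≤ y / w k := Nat.div_le_div_right hay
        have q2 : y / w k ≤ b / w k := Nat.div_le_div_right hyb
        refine ⟨y / w k, ⟨y, hy, rfl⟩, lt_of_le_of_ne q1 fun hq => ?_,
          lt_of_le_of_ne q2 fun hq => ?_⟩
        · have hm : y % w k ∈ rems (w k) B (a / w k) := ⟨y, hy, hq.symm, rfl⟩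
          have hne : V.mx (id * (N + 1) + (a / w k + 1)) ≠ 0 := fun h0 => by
            rw [hca.mn_eq_zero.1 (hca.mx_eq_zero.1 h0)] at hm
            exact hm
          have := (hca.max hne).2 _ hm
          rw [← hq] at dy
          omega
        · have hm : y % w k ∈ rems (w k) B (b / w k) := ⟨y, hy, hq, rfl⟩
          have hne : V.mn (id * (N + 1) + (b / w k + 1)) ≠ 0 := fun h0 => by
            rw [hcb.mn_eq_zero.1 h0] at hm
            exact hm
          have := (hcb.min hne).2 _ hm
          rw [hq] at dy
          omega
      · rintro ⟨_, ⟨y, hy, rfl⟩, q1, q2⟩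
        exact ⟨y, hy, (Nat.lt_of_div_lt_div q1).le, (Nat.lt_of_div_lt_div q2).le⟩
    rw [key2]
    split_ifs with h7
    · rw [ih (hT.mono (Nat.le_succ _)) _ _ _ _ hB.1 (by omega) (by omega)]
      exact exists_congr fun q => and_congr_right fun _ =>
        and_congr Iff.rfl (Nat.le_sub_one_iff_lt (Nat.zero_lt_of_lt hlt))
    · simp only [false_iff]
      rintro ⟨q, -, q1, q2⟩
      omega

/-- Stored extremes are shifted by one, so zeroed memory is an empty tree at every level. -/
theorem rep_zero (k id : ℕ) : Rep N w k ⟨fun _ => 0, fun _ => 0⟩ id ∅ := by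
  induction k generalizing id with
  | zero => exact ⟨rfl, rfl, rfl⟩
  | succ k ih =>
    exact ⟨by simp, ∅, Or.inl ⟨rfl, rfl, rfl, rfl⟩, by rw [quots_empty]; exact ih _,
      fun h _ => by rw [rems_empty]; exact ih _⟩

end LazyTree

/-! ## Program logic with a time budget -/

namespace RealRAM

/-- From `s`, the command reaches within `T` elementary commands a store that satisfies `R`. -/
def Cmd.Within (E : Env) (c : Cmd) (s : Store) (T : ℕ) (R : Store → Prop) : Prop :=
  ∃ t s', t ≤ T ∧ Ev E c s t s' ∧ R s'

namespace Expr

instance (n : ℕ) : OfNat Expr n := ⟨const n⟩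
instance : Add Expr := ⟨add⟩
instance : Sub Expr := ⟨sub⟩
instance : Mul Expr := ⟨mul⟩
instance : Coe Var Expr := ⟨var⟩

variable (E : Env) (s : Store)

@[simp] theorem eval_two : (2 : Expr).eval E s = 2 := rfl
@[simp] theorem eval_zero : (0 : Expr).eval E s = 0 := rfl
@[simp] theorem eval_one : (1 : Expr).eval E s = 1 := rfl
@[simp] theorem eval_add (e f : Expr) : (e + f).eval E s = e.eval E s + f.eval E s := rfl
@[simp] theorem eval_sub (e f : Expr) : (e - f).eval E s = e.eval E s - f.eval E s := rfl
@[simp] theorem eval_mul (e f : Expr) : (e * f).eval E s = e.eval E s * f.eval E s := rfl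
@[simp] theorem eval_size : size.eval E s = E.n := rfl
@[simp] theorem eval_var (v : Var) : (var v).eval E s = s.reg v := rfl
@[simp] theorem eval_load (A : Arr) (e : Expr) : (load A e).eval E s = s.mem A (e.eval E s) := rfl
@[simp] theorem eval_inp (e : Expr) : (inp e).eval E s = E.inp (E.clip (e.eval E s)) := rfl
@[simp] theorem eval_lt_eq_zero (e f : Expr) :
    (lt e f).eval E s = 0 ↔ f.eval E s ≤ e.eval E s := by simp [eval]
@[simp] theorem eval_eq_eq_zero (e f : Expr) :
    (eq e f).eval E s = 0 ↔ e.eval E s ≠ f.eval E s := by simp [eval]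

end Expr

namespace Cmd

variable {E : Env}

theorem Within.mono {c : Cmd} {s : Store} {T T' : ℕ} {R R' : Store → Prop}
    (h : c.Within E s T R) (hT : T ≤ T') (hR : ∀ s', R s' → R' s') : c.Within E s T' R' := by
  obtain ⟨t, s', h1, h2, h3⟩ := h
  exact ⟨t, s', h1.trans hT, h2, hR _ h3⟩

theorem Within.seq {c d : Cmd} {s : Store} {T T' : ℕ} {R : Store → Prop}
    (h : c.Within E s T fun s' => d.Within E s' T' R) : (seq c d).Within E s (T + T') R := by
  obtain ⟨t, s', h1, h2, t', s'', h3, h4, h5⟩ := h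
  exact ⟨_, s'', Nat.add_le_add h1 h3, Ev.seq h2 h4, h5⟩

theorem Within.ite {e : Expr} {c d : Cmd} {s : Store} {T : ℕ} {R : Store → Prop}
    (hc : e.eval E s ≠ 0 → c.Within E s T R) (hd : e.eval E s = 0 → d.Within E s T R) :
    (ite e c d).Within E s (T + 1) R := by
  by_cases h : e.eval E s = 0
  · obtain ⟨t, s', h1, h2, h3⟩ := hd h
    exact ⟨_, s', Nat.succ_le_succ h1, Ev.ite_false h h2, h3⟩
  · obtain ⟨t, s', h1, h2, h3⟩ := hc h
    exact ⟨_, s', Nat.succ_le_succ h1, Ev.ite_true h h2, h3⟩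

/-- A loop that is executed at most `j` times when the invariant `I j` holds at the beginning. -/
theorem Within.loop {e : Expr} {c : Cmd} {B : ℕ} (I : ℕ → Store → Prop)
    (hI : ∀ j s, I j s → e.eval E s ≠ 0 → ∃ j', j = j' + 1 ∧ c.Within E s B (I j'))
    (j : ℕ) (s : Store) (h : I j s) :
    (Cmd.loop e c).Within E s (j * (B + 1) + 1) fun s' => (∃ j', I j' s') ∧ e.eval E s' = 0 := by
  induction j generalizing s with
  | zero =>
    by_cases he : e.eval E s = 0
    · exact ⟨1, s, by simp, Ev.loop_false he, ⟨0, h⟩, he⟩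
    · obtain ⟨j', hj, -⟩ := hI 0 s h he
      omega
  | succ j ih =>
    by_cases he : e.eval E s = 0
    · exact ⟨1, s, by simp, Ev.loop_false he, ⟨_, h⟩, he⟩
    · obtain ⟨j', hj, t, s', h1, h2, h3⟩ := hI _ s h he
      obtain rfl : j = j' := by omega
      obtain ⟨t', s'', h4, h5, h6⟩ := ih s' h3
      refine ⟨_, s'', ?_, Ev.loop_true he h2 h5, h6⟩
      rw [Nat.succ_mul]
      omega

/-- Commands without loops. -/
def LoopFree : Cmd → Prop
  | skip => True
  | assign _ _ => True
  | store _ _ _ => True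
  | seq c d => c.LoopFree ∧ d.LoopFree
  | ite _ c d => c.LoopFree ∧ d.LoopFree
  | loop _ _ => False

/-- The effect of a command without loops. -/
noncomputable def run (E : Env) : Cmd → Store → Store
  | skip, s => s
  | assign v e, s => s.setV v (e.eval E s)
  | store A e f, s => s.setA A (e.eval E s) (f.eval E s)
  | seq c d, s => d.run E (c.run E s)
  | ite e c d, s => if e.eval E s = 0 then d.run E s else c.run E s
  | loop _ _, s => s

/-- A bound for the number of elementary commands of a command without loops. -/
def steps : Cmd → ℕ
  | skip => 0
  | assign _ _ => 1
  | store _ _ _ => 1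
  | seq c d => c.steps + d.steps
  | ite _ c d => max c.steps d.steps + 1
  | loop _ _ => 0

/-- A command without loops is a function on stores, so its correctness reduces to evaluating `run`,
which the simplifier can do. -/
theorem within_run {c : Cmd} (hc : c.LoopFree) {s : Store} {R : Store → Prop}
    (h : R (c.run E s)) : c.Within E s c.steps R := by
  induction c generalizing s R with
  | skip => exact ⟨0, s, le_rfl, Ev.skip s, h⟩
  | assign v e => exact ⟨1, _, le_rfl, Ev.assign v e s, h⟩
  | store A e f => exact ⟨1, _, le_rfl, Ev.store A e f s, h⟩
  | seq c d ih1 ih2 => exact Within.seq (ih1 hc.1 (ih2 hc.2 h))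
  | ite e c d ih1 ih2 =>
    simp only [run] at h
    refine Within.ite (fun he => ?_) fun he => ?_
    · rw [if_neg he] at h
      exact (ih1 hc.1 h).mono (le_max_left _ _) fun _ h => h
    · rw [if_pos he] at h
      exact (ih2 hc.2 h).mono (le_max_right _ _) fun _ h => h
  | loop e c => exact hc.elim

/-- `for v < n do c` -/
def forLoop (v : Var) (c : Cmd) : Cmd :=
  seq (assign v (.const 0))
    (.loop (.lt (.var v) .size) (seq c (assign v (.add (.var v) (.const 1)))))

theorem within_forLoop {v : Var} {c : Cmd} {B : ℕ} (I : ℕ → Store → Prop) {s : Store}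
    (h0 : I 0 (s.setV v 0))
    (hI : ∀ k < E.n, ∀ s, s.reg v = k → I k s → c.Within E s B fun s' =>
      s'.reg v = k ∧ I (k + 1) (s'.setV v (k + 1))) :
    (forLoop v c).Within E s (E.n * (B + 2) + 2) (I E.n) := by
  have hw := Within.loop (E := E) (e := .lt (.var v) .size)
    (c := seq c (assign v (.add (.var v) (.const 1)))) (B := B + 1)
    -- The fuel `j` is the number of remaining iterations.
    (fun j s => s.reg v + j = E.n ∧ I (s.reg v) s) (fun j s hs he => ?_) E.n (s.setV v 0)
    (by simpa using h0)
  · refine (Within.seq (T := 1) (T' := E.n * (B + 1 + 1) + 1)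
      ⟨1, _, le_rfl, Ev.assign _ _ _, hw⟩).mono (by rw [add_assoc]; omega) fun s' h => ?_
    obtain ⟨⟨j, hj, h1⟩, h2⟩ := h
    rw [Expr.eval_lt_eq_zero, Expr.eval_var, Expr.eval_size] at h2
    rwa [show E.n = s'.reg v by omega]
  · have he' : s.reg v < E.n := by simpa using he
    refine ⟨j - 1, by omega, Within.seq ((hI _ he' s rfl hs.2).mono le_rfl fun s' h => ?_)⟩
    refine ⟨1, _, le_rfl, Ev.assign _ _ _, ?_⟩
    simp only [Expr.eval, h.1, Store.setV_reg, if_true]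
    exact ⟨by omega, h.2⟩

end Cmd

/-! ## The tree operations -/

open RealRAM.Expr RealRAM.Cmd LazyTree

/-- Sequential composition. -/
infixr:60 " ;; " => Cmd.seq

/-- Compute the quotient and the remainder of `x` at level `k`, and the cluster `y` of `x`. -/
def locate : Cmd :=
  assign .h (load .div (Var.k * size + Var.x)) ;;
  assign .l (load .mod (Var.k * size + Var.x)) ;;
  assign .y (Var.id * (size + 1) + (Var.h + 1))

/-- Store the minimum `e` and the maximum `f` of the node `v`. -/
def setNode (v : Var) (e f : Expr) : Cmd := store .mn v e ;; store .mx v f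

/-- Proceed with the insertion of `x` to the summary or to a cluster of the node `id`. -/
def insPush : Cmd :=
  locate ;;
  ite (load .mn Var.y)
    (assign .id Var.y ;; assign .x Var.l)
    (setNode .y (Var.l + 1) (Var.l + 1) ;; assign .id (Var.id * (size + 1)) ;; assign .x Var.h) ;;
  assign .k (Var.k - 1)

/-- Exchange `x` with the minimum `lo` or the maximum `hi` of the node `id` if `x` is a new extreme
element. -/
def insSwap : Cmd :=
  ite (lt (Var.x + 1) Var.lo)
    (setNode .id (Var.x + 1) Var.hi ;; assign .x (Var.lo - 1))
    (ite (lt Var.hi (Var.x + 1)) (setNode .id Var.lo (Var.x + 1) ;; assign .x (Var.hi - 1)) skip)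

/-- One step of the insertion of `x` into the node `id` at level `k`. -/
def insBody : Cmd :=
  assign .lo (load .mn Var.id) ;;
  assign .hi (load .mx Var.id) ;;
  ite Var.lo
    (ite (eq Var.lo Var.hi)
      (ite (lt (Var.x + 1) Var.lo)
        (setNode .id (Var.x + 1) Var.hi) (setNode .id Var.lo (Var.x + 1)) ;;
      assign .k 0)
      (insSwap ;; insPush))
    (setNode .id (Var.x + 1) (Var.x + 1) ;; assign .k 0)

/-- Proceed with the deletion of `x` to the summary or to a cluster of the node `id`. -/
def delPush : Cmd :=
  locate ;;
  ite (eq (load .mn Var.y) (load .mx Var.y))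
    (setNode .y 0 0 ;; assign .id (Var.id * (size + 1)) ;; assign .x Var.h)
    (assign .id Var.y ;; assign .x Var.l) ;;
  assign .k (Var.k - 1)

/-- If `x` is the minimum `lo` or the maximum `hi` of the node `id`, replace this extreme element
and `x` by the extreme element below the node `id`, whose summary is `y`. -/
def delSwap : Cmd :=
  ite (eq (Var.x + 1) Var.lo)
    (assign .x ((load .mn Var.y - 1) * load .size Var.k +
        (load .mn (Var.y + load .mn Var.y) - 1)) ;;
      setNode .id (Var.x + 1) Var.hi)
    (ite (eq (Var.x + 1) Var.hi)
      (assign .x ((load .mx Var.y - 1) * load .size Var.k +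
          (load .mx (Var.y + load .mx Var.y) - 1)) ;;
        setNode .id Var.lo (Var.x + 1))
      skip)

/-- One step of the deletion of `x` from the node `id` at level `k`. -/
def delBody : Cmd :=
  assign .lo (load .mn Var.id) ;;
  assign .hi (load .mx Var.id) ;;
  assign .y (Var.id * (size + 1)) ;;
  ite (eq Var.lo Var.hi)
    (setNode .id 0 0 ;; assign .k 0)
    (ite (load .mn Var.y)
      (delSwap ;; delPush)
      (ite (eq (Var.x + 1) Var.lo) (setNode .id Var.hi Var.hi) (setNode .id Var.lo Var.lo) ;;
        assign .k 0))

/-- Compute the quotients, the remainders and the clusters `lo` and `hi` of `x` and `y`. -/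
def qryLocate : Cmd :=
  assign .h (load .div (Var.k * size + Var.x)) ;;
  assign .l (load .mod (Var.k * size + Var.x)) ;;
  assign .h' (load .div (Var.k * size + Var.y)) ;;
  assign .l' (load .mod (Var.k * size + Var.y)) ;;
  assign .lo (Var.id * (size + 1) + (Var.h + 1)) ;;
  assign .hi (Var.id * (size + 1) + (Var.h' + 1))

/-- The search below the node `id`. -/
def qrySplit : Cmd :=
  ite (eq Var.h Var.h')
    (assign .id Var.lo ;; assign .x Var.l ;; assign .y Var.l' ;; assign .k (Var.k - 1))
    (ite (lt Var.l (load .mx Var.lo))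
      (assign .ans 1 ;; assign .k 0)
      (ite (lt 0 (load .mn Var.hi) * lt (load .mn Var.hi) (Var.l' + 2))
        (assign .ans 1 ;; assign .k 0)
        (ite (lt (Var.h + 1) Var.h')
          (assign .id (Var.id * (size + 1)) ;; assign .x (Var.h + 1) ;;
            assign .y (Var.h' - 1) ;; assign .k (Var.k - 1))
          (assign .k 0))))

/-- One step of the search for an element between `x` and `y` in the node `id` at level `k`. -/
def qryBody : Cmd :=
  ite (lt Var.x (load .mn Var.id) * lt (load .mn Var.id) (Var.y + 2))
    (assign .ans 1 ;; assign .k 0)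
    (ite (lt Var.x (load .mx Var.id) * lt (load .mx Var.id) (Var.y + 2))
      (assign .ans 1 ;; assign .k 0)
      (ite (load .mn (Var.id * (size + 1)))
        (qryLocate ;; qrySplit)
        (assign .k 0)))

/-- The tree that is stored in the arrays. -/
def Store.heap (s : Store) : Heap := ⟨s.mem .mn, s.mem .mx⟩

/-- The division tables that are stored in the arrays. -/
def Store.tables (s : Store) (n : ℕ) : Tables :=
  ⟨fun k y => s.mem .div (k * n + y), fun k y => s.mem .mod (k * n + y), s.mem .size⟩

/-- Only the tree and the working variables of the tree operations have been changed. -/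
def TreeFrame (s s' : Store) : Prop :=
  (∀ A, A ≠ .mn → A ≠ .mx → s'.mem A = s.mem A) ∧
    s'.reg .a = s.reg .a ∧ s'.reg .b = s.reg .b ∧ s'.reg .c = s.reg .c ∧
    s'.reg .top = s.reg .top

theorem TreeFrame.trans {s s' s'' : Store} (h : TreeFrame s s') (h' : TreeFrame s' s'') :
    TreeFrame s s'' :=
  ⟨fun A h1 h2 => (h'.1 A h1 h2).trans (h.1 A h1 h2), h'.2.1.trans h.2.1, h'.2.2.1.trans h.2.2.1,
    h'.2.2.2.1.trans h.2.2.2.1, h'.2.2.2.2.trans h.2.2.2.2⟩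

theorem TreeFrame.tables {s s' : Store} (h : TreeFrame s s') (n : ℕ) :
    s'.tables n = s.tables n := by
  simp [Store.tables, h.1]

/-- The recursive call of `ins` is a tail call: it is carried out by overwriting `id`, `x` and `k`.
-/
theorem run_insPush (E : Env) (s : Store) (k : ℕ) (hk : s.reg .k = k + 1) :
    (insPush.run E s).reg .k = k ∧ TreeFrame s (insPush.run E s) ∧
      insInner E.n (ins E.n (s.tables E.n) k) (s.reg .id)
        ((s.tables E.n).div (k + 1) (s.reg .x)) ((s.tables E.n).mod (k + 1) (s.reg .x)) s.heap =
        ins E.n (s.tables E.n) k ((insPush.run E s).reg .id) ((insPush.run E s).reg .x)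
          (insPush.run E s).heap := by
  by_cases h : s.mem .mn (s.reg .id * (E.n + 1) + (s.mem .div ((k + 1) * E.n + s.reg .x) + 1)) = 0
  · simp +contextual [insPush, locate, setNode, run, insInner, TreeFrame, Store.heap, Heap.set, h,
      hk, Store.tables]
  · simp +contextual [insPush, locate, run, insInner, TreeFrame, Store.heap, h, hk, Store.tables]

theorem run_delPush (E : Env) (s : Store) (k : ℕ) (hk : s.reg .k = k + 1) :
    (delPush.run E s).reg .k = k ∧ TreeFrame s (delPush.run E s) ∧
      delInner E.n (del E.n (s.tables E.n) k) (s.reg .id)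
        ((s.tables E.n).div (k + 1) (s.reg .x)) ((s.tables E.n).mod (k + 1) (s.reg .x)) s.heap =
        del E.n (s.tables E.n) k ((delPush.run E s).reg .id) ((delPush.run E s).reg .x)
          (delPush.run E s).heap := by
  by_cases h : s.mem .mn (s.reg .id * (E.n + 1) + (s.mem .div ((k + 1) * E.n + s.reg .x) + 1)) =
    s.mem .mx (s.reg .id * (E.n + 1) + (s.mem .div ((k + 1) * E.n + s.reg .x) + 1))
  · simp +contextual [delPush, locate, setNode, run, delInner, TreeFrame, Store.heap, Heap.set, h,
      hk, Store.tables]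
  · simp +contextual [delPush, locate, run, delInner, TreeFrame, Store.heap, h, hk, Store.tables]

/-- The step preserves the value of the pending call. A case without recursion sets `k` to `0`,
where `ins` does nothing. -/
theorem run_insBody (E : Env) (s : Store) (k : ℕ) (hk : s.reg .k = k + 1) :
    ∃ k' ≤ k, (insBody.run E s).reg .k = k' ∧ TreeFrame s (insBody.run E s) ∧
      ins E.n (s.tables E.n) (k + 1) (s.reg .id) (s.reg .x) s.heap =
        ins E.n (s.tables E.n) k' ((insBody.run E s).reg .id) ((insBody.run E s).reg .x)
          (insBody.run E s).heap := by
  rw [ins]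
  by_cases h1 : s.mem .mn (s.reg .id) = 0
  · refine ⟨0, by omega, ?_, ?_, ?_⟩ <;>
      simp +contextual [insBody, setNode, run, h1, TreeFrame, Store.heap, ins, Heap.set]
  by_cases h2 : s.mem .mn (s.reg .id) = s.mem .mx (s.reg .id)
  · have h1' : ¬ s.mem .mx (s.reg .id) = 0 := h2 ▸ h1
    by_cases h3 : s.reg .x + 1 < s.mem .mx (s.reg .id)
    · have h3' := not_le.2 h3
      refine ⟨0, by omega, ?_, ?_, ?_⟩ <;>
        simp +contextual [insBody, setNode, run, h1', h2, h3, h3', TreeFrame, Store.heap, ins,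
          Heap.set]
    · have h3' := not_lt.1 h3
      refine ⟨0, by omega, ?_, ?_, ?_⟩ <;>
        simp +contextual [insBody, setNode, run, h1', h2, h3, h3', TreeFrame, Store.heap, ins,
          Heap.set]
  refine ⟨k, le_rfl, ?_⟩
  -- When the node holds two elements, the step is a possible exchange with an extreme element
  -- followed by the push; `s'` is the store in between.
  have key : ∃ s', insBody.run E s = insPush.run E s' ∧ s'.reg .k = k + 1 ∧ TreeFrame s s' ∧
      s'.reg .id = s.reg .id ∧
      (s'.reg .x, s'.heap) = if s.reg .x + 1 < s.heap.mn (s.reg .id) then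
        (s.heap.mn (s.reg .id) - 1, s.heap.set (s.reg .id) (s.reg .x + 1) (s.heap.mx (s.reg .id)))
      else if s.heap.mx (s.reg .id) < s.reg .x + 1 then
        (s.heap.mx (s.reg .id) - 1, s.heap.set (s.reg .id) (s.heap.mn (s.reg .id)) (s.reg .x + 1))
      else (s.reg .x, s.heap) := by
    refine ⟨insSwap.run E ((s.setV .lo (s.mem .mn (s.reg .id))).setV .hi (s.mem .mx (s.reg .id))),
      by simp [insBody, run, h1, h2], ?_⟩
    by_cases h3 : s.reg .x + 1 < s.mem .mn (s.reg .id)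
    · simp +contextual [insSwap, setNode, run, h3, not_le.2 h3, hk, TreeFrame, Store.heap, Heap.set]
    · by_cases h4 : s.mem .mx (s.reg .id) < s.reg .x + 1
      · simp +contextual [insSwap, setNode, run, h3, h4, not_lt.1 h3, not_le.2 h4, hk, TreeFrame,
          Store.heap, Heap.set]
      · simp +contextual [insSwap, run, h3, h4, not_lt.1 h3, not_lt.1 h4, hk, TreeFrame, Store.heap]
  obtain ⟨s', he, hk', hf, hid, hx⟩ := key
  have hp := run_insPush E s' k hk'
  rw [he]
  refine ⟨hp.1, hf.trans hp.2.1, ?_⟩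
  rw [hf.tables] at hp
  rw [← hp.2.2, if_neg (show ¬ s.heap.mn (s.reg .id) = 0 from h1),
    if_neg (show ¬ s.heap.mn (s.reg .id) = s.heap.mx (s.reg .id) from h2), hid]
  split_ifs at hx ⊢ <;> rw [Prod.mk.injEq] at hx <;> rw [hx.1, hx.2]

theorem run_delBody (E : Env) (s : Store) (k : ℕ) (hk : s.reg .k = k + 1) :
    ∃ k' ≤ k, (delBody.run E s).reg .k = k' ∧ TreeFrame s (delBody.run E s) ∧
      del E.n (s.tables E.n) (k + 1) (s.reg .id) (s.reg .x) s.heap =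
        del E.n (s.tables E.n) k' ((delBody.run E s).reg .id) ((delBody.run E s).reg .x)
          (delBody.run E s).heap := by
  rw [del]
  by_cases h1 : s.mem .mn (s.reg .id) = s.mem .mx (s.reg .id)
  · refine ⟨0, by omega, ?_, ?_, ?_⟩ <;>
      simp +contextual [delBody, setNode, run, h1, TreeFrame, Store.heap, del, Heap.set]
  by_cases h2 : s.mem .mn (s.reg .id * (E.n + 1)) = 0
  · by_cases h3 : s.reg .x + 1 = s.mem .mn (s.reg .id)
    · refine ⟨0, by omega, ?_, ?_, ?_⟩ <;>
      simp +contextual [delBody, setNode, run, h1, h2, h3, TreeFrame, Store.heap, del, Heap.set]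
    · refine ⟨0, by omega, ?_, ?_, ?_⟩ <;>
      simp +contextual [delBody, setNode, run, h1, h2, h3, TreeFrame, Store.heap, del, Heap.set]
  refine ⟨k, le_rfl, ?_⟩
  have key : ∃ s', delBody.run E s = delPush.run E s' ∧ s'.reg .k = k + 1 ∧ TreeFrame s s' ∧
      s'.reg .id = s.reg .id ∧
      (s'.reg .x, s'.heap) = if s.reg .x + 1 = s.heap.mn (s.reg .id) then
        (innerMin E.n ((s.tables E.n).size (k + 1)) (s.reg .id) s.heap, s.heap.set (s.reg .id)
          (innerMin E.n ((s.tables E.n).size (k + 1)) (s.reg .id) s.heap + 1)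
          (s.heap.mx (s.reg .id)))
      else if s.reg .x + 1 = s.heap.mx (s.reg .id) then
        (innerMax E.n ((s.tables E.n).size (k + 1)) (s.reg .id) s.heap, s.heap.set (s.reg .id)
          (s.heap.mn (s.reg .id))
          (innerMax E.n ((s.tables E.n).size (k + 1)) (s.reg .id) s.heap + 1))
      else (s.reg .x, s.heap) := by
    refine ⟨delSwap.run E (((s.setV .lo (s.mem .mn (s.reg .id))).setV .hi
      (s.mem .mx (s.reg .id))).setV .y (s.reg .id * (E.n + 1))),
      by simp [delBody, run, h1, h2], ?_⟩
    by_cases h3 : s.reg .x + 1 = s.mem .mn (s.reg .id)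
    · simp +contextual [delSwap, setNode, run, h3, hk, TreeFrame, Store.heap, Heap.set, innerMin,
        Store.tables]
    · by_cases h4 : s.reg .x + 1 = s.mem .mx (s.reg .id)
      · simp +contextual [delSwap, setNode, run, h4, Ne.symm h1, hk, TreeFrame, Store.heap,
          Heap.set, innerMax, Store.tables]
      · simp +contextual [delSwap, run, h3, h4, hk, TreeFrame, Store.heap]
  obtain ⟨s', he, hk', hf, hid, hx⟩ := key
  have hp := run_delPush E s' k hk'
  rw [he]
  refine ⟨hp.1, hf.trans hp.2.1, ?_⟩
  rw [hf.tables] at hp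
  rw [← hp.2.2, if_neg (show ¬ s.heap.mn (s.reg .id) = s.heap.mx (s.reg .id) from h1),
    if_neg (show ¬ s.heap.mn (s.reg .id * (E.n + 1)) = 0 from h2), hid]
  split_ifs at hx ⊢ <;> rw [Prod.mk.injEq] at hx <;> rw [hx.1, hx.2]

/-- The search does not change the arrays. -/
theorem run_qryBody (E : Env) (s : Store) (k : ℕ) (hk : s.reg .k = k + 1) :
    ∃ k' ≤ k, (qryBody.run E s).reg .k = k' ∧ TreeFrame s (qryBody.run E s) ∧
      (qryBody.run E s).heap = s.heap ∧
      (((qryBody.run E s).reg .ans = s.reg .ans ∧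
        qry E.n (s.tables E.n) s.heap (k + 1) (s.reg .id) (s.reg .x) (s.reg .y) =
          qry E.n (s.tables E.n) s.heap k' ((qryBody.run E s).reg .id) ((qryBody.run E s).reg .x)
            ((qryBody.run E s).reg .y)) ∨
      ((qryBody.run E s).reg .ans = 1 ∧ k' = 0 ∧
        qry E.n (s.tables E.n) s.heap (k + 1) (s.reg .id) (s.reg .x) (s.reg .y) = true)) := by
  rw [qry]
  -- The program multiplies two strict comparisons, and this is the form in which the simplifier
  -- states that the product vanishes.
  have e1 : ∀ a p b : ℕ, (a < p ∧ p ≤ b + 1) ↔ ¬ (p ≤ a ∨ b + 2 ≤ p) := by omega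
  simp only [e1]
  by_cases h1 : s.mem .mn (s.reg .id) ≤ s.reg .x ∨ s.reg .y + 2 ≤ s.mem .mn (s.reg .id)
  swap
  · exact ⟨0, by omega, by simp +contextual [qryBody, run, h1, TreeFrame, Store.heap]⟩
  by_cases h2 : s.mem .mx (s.reg .id) ≤ s.reg .x ∨ s.reg .y + 2 ≤ s.mem .mx (s.reg .id)
  swap
  · exact ⟨0, by omega, by simp +contextual [qryBody, run, h1, h2, TreeFrame, Store.heap]⟩
  by_cases h3 : s.mem .mn (s.reg .id * (E.n + 1)) = 0
  · exact ⟨0, by omega, by simp +contextual [qryBody, run, h1, h2, h3, TreeFrame, Store.heap, qry]⟩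
  have hr : qryBody.run E s = qrySplit.run E (qryLocate.run E s) := by
    simp [qryBody, run, qryLocate, h1, h2, h3]
  rw [hr]
  by_cases h4 : s.mem .div ((k + 1) * E.n + s.reg .x) = s.mem .div ((k + 1) * E.n + s.reg .y)
  · exact ⟨k, le_rfl, by simp +contextual [qryLocate, qrySplit, run, h1, h2, h3, h4, hk, TreeFrame,
      Store.heap, Store.tables]⟩
  by_cases h5 : s.mem .mx (s.reg .id * (E.n + 1) +
      (s.mem .div ((k + 1) * E.n + s.reg .x) + 1)) ≤ s.mem .mod ((k + 1) * E.n + s.reg .x)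
  swap
  · exact ⟨0, by omega, by simp +contextual [qryLocate, qrySplit, run, h1, h2, h3, h4, h5,
      not_le.1 h5, hk, TreeFrame, Store.heap, Store.tables]⟩
  by_cases h6 : s.mem .mn (s.reg .id * (E.n + 1) +
      (s.mem .div ((k + 1) * E.n + s.reg .y) + 1)) ≤ 0 ∨
      s.mem .mod ((k + 1) * E.n + s.reg .y) + 2 ≤ s.mem .mn (s.reg .id * (E.n + 1) +
      (s.mem .div ((k + 1) * E.n + s.reg .y) + 1))
  swap
  · rw [Nat.le_zero] at h6
    exact ⟨0, by omega, by simp +contextual [qryLocate, qrySplit, run, h1, h2, h3, h4, h5,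
      not_lt.2 h5, h6, hk, TreeFrame, Store.heap, Store.tables]⟩
  rw [Nat.le_zero] at h6
  by_cases h7 : s.mem .div ((k + 1) * E.n + s.reg .y) ≤ s.mem .div ((k + 1) * E.n + s.reg .x) + 1
  · exact ⟨0, by omega, by simp +contextual [qryLocate, qrySplit, run, h1, h2, h3, h4, h5,
      not_lt.2 h5, h6, h7, not_lt.2 h7, hk, TreeFrame, Store.heap, Store.tables, qry]⟩
  · exact ⟨k, le_rfl, by simp +contextual [qryLocate, qrySplit, run, h1, h2, h3, h4, h5,
      not_lt.2 h5, h6, h7, not_le.1 h7, hk, TreeFrame, Store.heap, Store.tables]⟩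

/-- Insert `x` into the node `id` at level `k`. -/
def insLoop : Cmd := .loop Var.k insBody

/-- Delete `x` from the node `id` at level `k`. -/
def delLoop : Cmd := .loop Var.k delBody

/-- Set `ans` to `1` if the node `id` at level `k` has an element between `x` and `y`. -/
def qryLoop : Cmd := .loop Var.k qryBody

/-- The level drops in every iteration, so the time is proportional to the number of levels; the
invariant is that the pending call has the value of the original one. -/
theorem within_insLoop (E : Env) (s : Store) :
    insLoop.Within E s (s.reg .k * (insBody.steps + 1) + 1) fun s' => TreeFrame s s' ∧
      s'.heap = ins E.n (s.tables E.n) (s.reg .k) (s.reg .id) (s.reg .x) s.heap := by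
  have h := Within.loop (E := E) (e := Var.k) (c := insBody) (B := insBody.steps)
    (fun j s' => s'.reg .k ≤ j ∧ TreeFrame s s' ∧
      ins E.n (s.tables E.n) (s'.reg .k) (s'.reg .id) (s'.reg .x) s'.heap =
        ins E.n (s.tables E.n) (s.reg .k) (s.reg .id) (s.reg .x) s.heap)
    (fun j s' hs he => by
      rw [eval_var] at he
      obtain ⟨k, hk⟩ := Nat.exists_eq_succ_of_ne_zero he
      refine ⟨j - 1, by omega, within_run (by simp [insBody, insSwap, insPush, locate, setNode,
        LoopFree]) ?_⟩
      obtain ⟨k', h1, h2, h3, h4⟩ := run_insBody E s' k hk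
      refine ⟨by omega, hs.2.1.trans h3, ?_⟩
      rw [← hs.2.2, hk, h2, ← hs.2.1.tables, h4]) _ s
    ⟨le_rfl, ⟨fun _ _ _ => rfl, rfl, rfl, rfl, rfl⟩, rfl⟩
  refine h.mono le_rfl ?_
  rintro s' ⟨⟨j, -, h1, h2⟩, h3⟩
  rw [eval_var] at h3
  rw [h3] at h2
  exact ⟨h1, h2⟩

theorem within_delLoop (E : Env) (s : Store) :
    delLoop.Within E s (s.reg .k * (delBody.steps + 1) + 1) fun s' => TreeFrame s s' ∧
      s'.heap = del E.n (s.tables E.n) (s.reg .k) (s.reg .id) (s.reg .x) s.heap := by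
  have h := Within.loop (E := E) (e := Var.k) (c := delBody) (B := delBody.steps)
    (fun j s' => s'.reg .k ≤ j ∧ TreeFrame s s' ∧
      del E.n (s.tables E.n) (s'.reg .k) (s'.reg .id) (s'.reg .x) s'.heap =
        del E.n (s.tables E.n) (s.reg .k) (s.reg .id) (s.reg .x) s.heap)
    (fun j s' hs he => by
      rw [eval_var] at he
      obtain ⟨k, hk⟩ := Nat.exists_eq_succ_of_ne_zero he
      refine ⟨j - 1, by omega, within_run (by simp [delBody, delSwap, delPush, locate, setNode,
        LoopFree]) ?_⟩
      obtain ⟨k', h1, h2, h3, h4⟩ := run_delBody E s' k hk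
      refine ⟨by omega, hs.2.1.trans h3, ?_⟩
      rw [← hs.2.2, hk, h2, ← hs.2.1.tables, h4]) _ s
    ⟨le_rfl, ⟨fun _ _ _ => rfl, rfl, rfl, rfl, rfl⟩, rfl⟩
  refine h.mono le_rfl ?_
  rintro s' ⟨⟨j, -, h1, h2⟩, h3⟩
  rw [eval_var] at h3
  rw [h3] at h2
  exact ⟨h1, h2⟩

theorem within_qryLoop (E : Env) (s : Store) :
    qryLoop.Within E s (s.reg .k * (qryBody.steps + 1) + 1) fun s' => TreeFrame s s' ∧
      s'.heap = s.heap ∧ s'.reg .ans =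
        if qry E.n (s.tables E.n) s.heap (s.reg .k) (s.reg .id) (s.reg .x) (s.reg .y) = true then 1
        else s.reg .ans := by
  have h := Within.loop (E := E) (e := Var.k) (c := qryBody) (B := qryBody.steps)
    (fun j s' => s'.reg .k ≤ j ∧ TreeFrame s s' ∧ s'.heap = s.heap ∧
      ((s'.reg .ans = s.reg .ans ∧
        qry E.n (s.tables E.n) s.heap (s.reg .k) (s.reg .id) (s.reg .x) (s.reg .y) =
          qry E.n (s.tables E.n) s.heap (s'.reg .k) (s'.reg .id) (s'.reg .x) (s'.reg .y)) ∨
      (s'.reg .ans = 1 ∧ s'.reg .k = 0 ∧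
        qry E.n (s.tables E.n) s.heap (s.reg .k) (s.reg .id) (s.reg .x) (s.reg .y) = true)))
    (fun j s' hs he => by
      rw [eval_var] at he
      obtain ⟨k, hk⟩ := Nat.exists_eq_succ_of_ne_zero he
      refine ⟨j - 1, by omega, within_run (by simp [qryBody, qryLocate, qrySplit, LoopFree]) ?_⟩
      obtain ⟨k', h1, h2, h3, h4, h5⟩ := run_qryBody E s' k hk
      obtain ⟨i1, i2, i3, i4⟩ := hs
      refine ⟨by omega, i2.trans h3, h4.trans i3, ?_⟩
      rcases i4 with ⟨i4, i5⟩ | i4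
      · rw [i5, hk]
        rw [i2.tables, i3] at h5
        rcases h5 with ⟨h5, h6⟩ | ⟨h5, h6, h7⟩
        · exact Or.inl ⟨h5.trans i4, by rw [h2]; exact h6⟩
        · exact Or.inr ⟨h5, h2.trans h6, h7⟩
      · exact absurd i4.2.1 he) _ s
    ⟨le_rfl, ⟨fun _ _ _ => rfl, rfl, rfl, rfl, rfl⟩, rfl, Or.inl ⟨rfl, rfl⟩⟩
  refine h.mono le_rfl ?_
  rintro s' ⟨⟨j, -, h1, h2, h4⟩, h3⟩
  rw [eval_var] at h3
  refine ⟨h1, h2, ?_⟩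
  rcases h4 with ⟨h5, h6⟩ | ⟨h5, -, h6⟩
  · rw [h6, h3, qry, h5]
    simp
  · rw [h6, h5, if_pos rfl]

end RealRAM

/-! ## Combinatorics of the sweep

The endpoints are numbered in sweep order, `U k` is the rank of the `k`-th endpoint in the sweep
direction, `V k` its rank in the other direction, and `Q k` the number of the other endpoint of the
same segment. -/

namespace Sweep

/-- `k` is the first endpoint of a segment that is parallel to the sweep direction. -/
def LeftEnd (V Q : ℕ → ℕ) (k : ℕ) : Prop := k < Q k ∧ V k = V (Q k)

/-- Two segments that start before position `K` and lie on a common line parallel to the sweep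
direction have a common point. -/
def Conflict (U V Q : ℕ → ℕ) (K : ℕ) : Prop :=
  ∃ j k, j < k ∧ k < K ∧ LeftEnd V Q j ∧ LeftEnd V Q k ∧ V j = V k ∧ U k ≤ U (Q j)

/-- `D v` is by one larger than the end of the last segment on the line `v`, for all segments
that start before position `K`. -/
def LastEnd (U V Q : ℕ → ℕ) (K : ℕ) (D : ℕ → ℕ) : Prop :=
  ∀ v, (∀ j < K, LeftEnd V Q j → V j = v → U (Q j) < D v) ∧
    (D v = 0 ∨ ∃ j < K, LeftEnd V Q j ∧ V j = v ∧ D v = U (Q j) + 1)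

variable {n : ℕ} {U V Q : ℕ → ℕ}

theorem conflict_succ_of_not_leftEnd {K : ℕ} (h : ¬ LeftEnd V Q K) :
    Conflict U V Q (K + 1) ↔ Conflict U V Q K := by
  constructor
  · rintro ⟨j, k, h1, h2, h3, h4, h5⟩
    have : k ≠ K := fun hk => h (hk ▸ h4)
    exact ⟨j, k, h1, by omega, h3, h4, h5⟩
  · rintro ⟨j, k, h1, h2, h3⟩
    exact ⟨j, k, h1, by omega, h3⟩

/-- A segment overlaps an earlier one on its line exactly if it starts no later than the last
recorded end. After a first conflict the table may be wrong, so `hD` claims nothing then. -/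
theorem conflict_succ {K : ℕ} {D : ℕ → ℕ} (h : LeftEnd V Q K)
    (hD : ¬ Conflict U V Q K → LastEnd U V Q K D) :
    Conflict U V Q (K + 1) ∨ Conflict U V Q K ↔ Conflict U V Q K ∨ U K < D (V K) := by
  by_cases hc : Conflict U V Q K
  · simp [hc]
  simp only [hc, or_false, false_or]
  constructor
  · rintro ⟨j, k, h1, h2, h3, h4, h5, h6⟩
    by_cases hk : k = K
    · subst hk
      exact h6.trans_lt ((hD hc (V k)).1 j h1 h3 h5)
    · exact absurd ⟨j, k, h1, by omega, h3, h4, h5, h6⟩ hc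
  · intro hlt
    rcases (hD hc (V K)).2 with h0 | ⟨j, hj, h3, h5, h6⟩
    · omega
    · exact ⟨j, K, hj, by omega, h3, h, h5, by omega⟩

theorem Conflict.succ {K : ℕ} (h : Conflict U V Q K) : Conflict U V Q (K + 1) := by
  obtain ⟨j, k, h1, h2, h3⟩ := h
  exact ⟨j, k, h1, by omega, h3⟩

theorem LastEnd.succ_of_not_leftEnd {K : ℕ} {D : ℕ → ℕ} (h : ¬ LeftEnd V Q K)
    (hD : LastEnd U V Q K D) : LastEnd U V Q (K + 1) D := by
  refine fun v => ⟨fun j hj hl hv => (hD v).1 j ?_ hl hv, (hD v).2.imp_right ?_⟩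
  · have : j ≠ K := fun hk => h (hk ▸ hl)
    omega
  · rintro ⟨j, hj, h1⟩
    exact ⟨j, by omega, h1⟩

/-- By `hlt` all earlier segments on the line end before the new one starts, so overwriting the
entry yields the maximum. -/
theorem LastEnd.succ {K : ℕ} {D : ℕ → ℕ} (hU : U K ≤ U (Q K)) (h : LeftEnd V Q K)
    (hD : LastEnd U V Q K D) (hlt : D (V K) ≤ U K) :
    LastEnd U V Q (K + 1) (Function.update D (V K) (U (Q K) + 1)) := by
  intro v
  by_cases hv : v = V K
  · subst hv
    rw [Function.update_self]
    refine ⟨fun j hj hl hv => ?_, Or.inr ⟨K, by omega, h, rfl, rfl⟩⟩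
    by_cases hjK : j = K
    · rw [hjK]; omega
    · have := (hD (V K)).1 j (by omega) hl hv
      omega
  · rw [Function.update_of_ne hv]
    refine ⟨fun j hj hl hv' => (hD v).1 j ?_ hl hv', (hD v).2.imp_right ?_⟩
    · have : j ≠ K := fun hk => hv (by rw [← hv', hk])
      omega
    · rintro ⟨j, hj, h1⟩
      exact ⟨j, by omega, h1⟩

/-- The lines of the segments that have been inserted (those that start before position `a`) and
not yet deleted (those that end at position `c` or later). -/
def active (V Q : ℕ → ℕ) (a c : ℕ) : Set ℕ :=
  {v | ∃ p, p < a ∧ LeftEnd V Q p ∧ c ≤ Q p ∧ V p = v}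

/-- One of the segments with an endpoint before position `K` that are orthogonal to the sweep
direction meets a segment parallel to it. -/
def Crossing (n : ℕ) (U V Q : ℕ → ℕ) (K : ℕ) : Prop :=
  ∃ b < K, ∃ k < n, LeftEnd V Q k ∧ V b < V (Q b) ∧ U k ≤ U b ∧ U b ≤ U (Q k) ∧
    V b ≤ V k ∧ V k ≤ V (Q b)

/-- The properties of the numbers of the endpoints. -/
structure Family (n : ℕ) (U V Q : ℕ → ℕ) : Prop where
  mono : ∀ j k, j ≤ k → k < n → U j ≤ U k
  V_lt : ∀ k < n, V k < n
  Q_lt : ∀ k < n, Q k < n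
  Q_Q : ∀ k < n, Q (Q k) = k

theorem active_zero (c : ℕ) : active V Q 0 c = ∅ := by
  simp [active]

/-- The positions of insertions, queries and deletions. -/
structure Pointers (n : ℕ) (U : ℕ → ℕ) (a b c : ℕ) : Prop where
  cb : c ≤ b
  ba : b ≤ a
  an : a ≤ n
  inserted : b < n → ∀ p < a, U p ≤ U b
  deleted : b < n → ∀ q < c, U q < U b
  disjoint : c < n → ∀ p < a, U p ≤ U c

/-- The sweep deletes at `c` if `U c < U b`, otherwise inserts at `a` if `U a ≤ U b`, and otherwise
queries at `b`. Segments are closed, so at equal rank insertions come first and deletions last. The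
three lemmas show that the moves keep the invariants. -/
theorem Pointers.delete (hF : Family n U V Q) {a b c : ℕ} (h : Pointers n U a b c) (hb : b < n)
    (hlt : U c < U b) : Pointers n U a b (c + 1) := by
  have hcb := h.cb
  have hne : c ≠ b := fun he => by rw [he] at hlt; exact hlt.false
  refine ⟨by omega, h.ba, h.an, h.inserted, fun _ q hq => ?_, fun hc p hp => ?_⟩
  · rcases Nat.lt_succ_iff_lt_or_eq.1 hq with hq | rfl
    · exact h.deleted hb q hq
    · exact hlt
  · exact (h.disjoint (by omega) p hp).trans (hF.mono _ _ (Nat.le_succ c) hc)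

theorem Pointers.insert {a b c : ℕ} (h : Pointers n U a b c) (hb : b < n) (ha : a < n)
    (hc : U b ≤ U c) (hab : U a ≤ U b) : Pointers n U (a + 1) b c := by
  refine ⟨h.cb, h.ba.trans (Nat.le_succ a), ha, fun _ p hp => ?_, h.deleted, fun hcn p hp => ?_⟩
  · rcases Nat.lt_succ_iff_lt_or_eq.1 hp with hp | rfl
    · exact h.inserted hb p hp
    · exact hab
  · rcases Nat.lt_succ_iff_lt_or_eq.1 hp with hp | rfl
    · exact h.disjoint hcn p hp
    · exact hab.trans hc

theorem Pointers.query (hF : Family n U V Q) {a b c : ℕ} (h : Pointers n U a b c) (hb : b < n)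
    (ha : ¬ (a < n ∧ U a ≤ U b)) : Pointers n U a (b + 1) c := by
  refine ⟨h.cb.trans (Nat.le_succ b), ?_, h.an, fun hb1 p hp => ?_, fun hb1 q hq => ?_, h.disjoint⟩
  -- If `a` were equal to `b`, an insertion would still be due.
  · rcases h.ba.eq_or_lt with rfl | h1
    · exact absurd ⟨hb, le_rfl⟩ ha
    · exact h1
  · exact (h.inserted hb p hp).trans (hF.mono _ _ (Nat.le_succ b) hb1)
  · exact (h.deleted hb q hq).trans_le (hF.mono _ _ (Nat.le_succ b) hb1)

/-- The set stores lines rather than segments, so deleting a line is correct only if no other active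
segment lies on it. By `disjoint`, a second one would start no later than this one ends, or the
reverse, which is a conflict. -/
theorem active_delete (hF : Family n U V Q) (hn : ¬ Conflict U V Q n) {a b c : ℕ}
    (h : Pointers n U a b c) (hb : b < n) (hc : Q c < c ∧ V (Q c) = V c) :
    V c ∈ active V Q a c ∧ active V Q a (c + 1) = active V Q a c \ {V c} := by
  have hcb := h.cb
  have hba := h.ba
  have han := h.an
  have hcn : c < n := by omega
  have hx : LeftEnd V Q (Q c) := by
    rw [LeftEnd, hF.Q_Q c hcn]
    exact hc
  have hQx := hF.Q_Q c hcn
  refine ⟨⟨Q c, by omega, hx, hQx.ge, hc.2⟩, ?_⟩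
  ext v
  constructor
  · rintro ⟨p, hp, hl, hcp, rfl⟩
    refine ⟨⟨p, hp, hl, by omega, rfl⟩, fun he => hn ?_⟩
    rw [Set.mem_singleton_iff] at he
    have hne : p ≠ Q c := fun h => by rw [h, hQx] at hcp; omega
    rcases lt_or_gt_of_ne hne with h1 | h1
    · refine ⟨p, Q c, h1, by omega, hl, hx, he.trans hc.2.symm, ?_⟩
      exact hF.mono _ _ (by omega) (hF.Q_lt p (by omega))
    · refine ⟨Q c, p, h1, by omega, hx, hl, hc.2.trans he.symm, ?_⟩
      rw [hQx]
      exact h.disjoint hcn p hp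
  · rintro ⟨⟨p, hp, hl, hcp, rfl⟩, hne⟩
    refine ⟨p, hp, hl, lt_of_le_of_ne hcp fun he => hne ?_, rfl⟩
    rw [Set.mem_singleton_iff, hl.2, ← he]

theorem active_delete_of_not (hF : Family n U V Q) {a c : ℕ} (ha : a ≤ n)
    (hc : ¬ (Q c < c ∧ V (Q c) = V c)) : active V Q a (c + 1) = active V Q a c := by
  ext v
  constructor
  · rintro ⟨p, hp, hl, hcp, rfl⟩
    exact ⟨p, hp, hl, by omega, rfl⟩
  · rintro ⟨p, hp, hl, hcp, rfl⟩
    refine ⟨p, hp, hl, lt_of_le_of_ne hcp fun he => hc ?_, rfl⟩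
    rw [he, hF.Q_Q p (by omega)]
    exact hl

/-- An active segment on the line of `a` would end at rank `U c` or later, and `U a ≤ U b ≤ U c`, so
the two would be in conflict. -/
theorem active_insert (hF : Family n U V Q) (hn : ¬ Conflict U V Q n) {a b c : ℕ}
    (h : Pointers n U a b c) (ha : a < n) (hc : U b ≤ U c) (hab : U a ≤ U b)
    (hl : LeftEnd V Q a) :
    V a ∉ active V Q a c ∧ active V Q (a + 1) c = insert (V a) (active V Q a c) := by
  have hcb := h.cb
  have hba := h.ba
  constructor
  · rintro ⟨p, hp, hlp, hcp, he⟩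
    refine hn ⟨p, a, hp, ha, hlp, hl, he, (hab.trans hc).trans ?_⟩
    exact hF.mono _ _ hcp (hF.Q_lt p (by omega))
  · ext v
    constructor
    · rintro ⟨p, hp, hlp, hcp, rfl⟩
      rcases Nat.lt_succ_iff_lt_or_eq.1 hp with hp | rfl
      · exact Or.inr ⟨p, hp, hlp, hcp, rfl⟩
      · exact Or.inl rfl
    · rintro (rfl | ⟨p, hp, hlp, hcp, rfl⟩)
      · have := hl.1
        exact ⟨a, by omega, hl, by omega, rfl⟩
      · exact ⟨p, by omega, hlp, hcp, rfl⟩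

theorem active_insert_of_not {a c : ℕ} (hl : ¬ LeftEnd V Q a) :
    active V Q (a + 1) c = active V Q a c := by
  ext v
  constructor
  · rintro ⟨p, hp, hlp, hcp, rfl⟩
    rcases Nat.lt_succ_iff_lt_or_eq.1 hp with hp | rfl
    · exact ⟨p, hp, hlp, hcp, rfl⟩
    · exact absurd hlp hl
  · rintro ⟨p, hp, hlp, hcp, rfl⟩
    exact ⟨p, by omega, hlp, hcp, rfl⟩

/-- When neither a deletion nor an insertion is due, a segment is active exactly if its closed range
of ranks contains `U b`. -/
theorem crossing_succ (hF : Family n U V Q) {a b c : ℕ} (h : Pointers n U a b c) (hb : b < n)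
    (hc : U b ≤ U c) (hab : ¬ (a < n ∧ U a ≤ U b)) :
    Crossing n U V Q (b + 1) ↔ Crossing n U V Q b ∨
      (V b < V (Q b) ∧ ∃ y ∈ active V Q a c, V b ≤ y ∧ y ≤ V (Q b)) := by
  have han := h.an
  constructor
  · rintro ⟨b', hb', k, hk, hl, h1, h2, h3, h4, h5⟩
    rcases Nat.lt_succ_iff_lt_or_eq.1 hb' with hb' | rfl
    · exact Or.inl ⟨b', hb', k, hk, hl, h1, h2, h3, h4, h5⟩
    · refine Or.inr ⟨h1, _, ⟨k, ?_, hl, ?_, rfl⟩, h4, h5⟩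
      · by_contra hka
        exact hab ⟨by omega, (hF.mono _ _ (by omega) hk).trans h2⟩
      · by_contra hka
        exact ((h.deleted hb _ (by omega)).trans_le h3).false
  · rintro (⟨b', hb', h1⟩ | ⟨h1, _, ⟨k, hk, hl, hck, rfl⟩, h4, h5⟩)
    · exact ⟨b', by omega, h1⟩
    · exact ⟨b, by omega, k, by omega, hl, h1, h.inserted hb k hk,
        hc.trans (hF.mono _ _ hck (hF.Q_lt k (by omega))), h4, h5⟩

/-- The number of increases of a sequence of reals before position `k`. -/
noncomputable def rank (f : ℕ → ℝ) : ℕ → ℕ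
  | 0 => 0
  | k + 1 => rank f k + if f k < f (k + 1) then 1 else 0

theorem rank_le (f : ℕ → ℝ) (k : ℕ) : rank f k ≤ k := by
  induction k with
  | zero => exact le_rfl
  | succ k ih =>
    rw [rank]
    split_ifs <;> omega

theorem rank_mono (f : ℕ → ℝ) : Monotone (rank f) :=
  monotone_nat_of_le_succ fun k => by rw [rank]; omega

/-- On a nondecreasing stretch the number of strict steps vanishes exactly if the end values agree.
Comparisons of neighbours thus produce integers in the same order as the reals, with ties preserved.
-/
theorem rank_eq {f : ℕ → ℝ} {j k : ℕ} (hjk : j ≤ k) (hf : ∀ i, j ≤ i → i < k → f i ≤ f (i + 1)) :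
    (f j < f k → rank f j < rank f k) ∧ (f j = f k → rank f j = rank f k) ∧ f j ≤ f k := by
  induction k, hjk using Nat.le_induction with
  | base => simp
  | succ k hjk ih =>
    obtain ⟨h1, h2, h3⟩ := ih fun i hi hik => hf i hi (by omega)
    have h4 := hf k hjk (by omega)
    rw [rank]
    refine ⟨fun h => ?_, fun h => ?_, h3.trans h4⟩
    · rcases h3.eq_or_lt with h5 | h5
      · rw [if_pos (h5 ▸ h), h2 h5]
        omega
      · have := h1 h5
        omega
    · have h5 : f j = f k := le_antisymm h3 (h ▸ h4)
      rw [if_neg (by rw [← h5, h]; exact lt_irrefl _), h2 h5, add_zero]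

theorem rank_lt_iff {f : ℕ → ℝ} {n : ℕ} (hf : ∀ i, i + 1 < n → f i ≤ f (i + 1)) {j k : ℕ}
    (hj : j < n) (hk : k < n) : rank f j < rank f k ↔ f j < f k := by
  rcases le_total j k with h | h
  · have := rank_eq h fun i _ hi => hf i (by omega)
    refine ⟨fun hr => this.2.2.lt_of_ne fun he => ?_, this.1⟩
    rw [this.2.1 he] at hr
    exact hr.false
  · have := rank_eq h fun i _ hi => hf i (by omega)
    exact iff_of_false (rank_mono f h).not_gt this.2.2.not_gt

theorem rank_le_iff {f : ℕ → ℝ} {n : ℕ} (hf : ∀ i, i + 1 < n → f i ≤ f (i + 1)) {j k : ℕ}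
    (hj : j < n) (hk : k < n) : rank f j ≤ rank f k ↔ f j ≤ f k := by
  rw [← not_lt, rank_lt_iff hf hk hj, not_lt]

end Sweep

/-! ## The program -/

namespace RealRAM

open RealRAM.Expr RealRAM.Cmd LazyTree Sweep

/-- The command does not assign the variable `v`. -/
def Cmd.Keeps (v : Var) : Cmd → Prop
  | .skip => True
  | .assign w _ => v ≠ w
  | .store _ _ _ => True
  | .seq c d => c.Keeps v ∧ d.Keeps v
  | .ite _ c d => c.Keeps v ∧ d.Keeps v
  | .loop _ c => c.Keeps v

/-- The command does not write the array `A`. -/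
def Cmd.KeepsArr (A : Arr) : Cmd → Prop
  | .skip => True
  | .assign _ _ => True
  | .store A' _ _ => A ≠ A'
  | .seq c d => c.KeepsArr A ∧ d.KeepsArr A
  | .ite _ c d => c.KeepsArr A ∧ d.KeepsArr A
  | .loop _ c => c.KeepsArr A

theorem Ev.keeps {E : Env} {c : Cmd} {s s' : Store} {t : ℕ} {v : Var} (h : Ev E c s t s')
    (hc : c.Keeps v) : s'.reg v = s.reg v := by
  induction h with
  | skip => rfl
  | assign w e s => rw [Store.setV_reg, if_neg hc]
  | store => rfl
  | seq _ _ ih1 ih2 => exact (ih2 hc.2).trans (ih1 hc.1)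
  | ite_true _ _ ih => exact ih hc.1
  | ite_false _ _ ih => exact ih hc.2
  | loop_true _ _ _ ih1 ih2 => exact (ih2 hc).trans (ih1 hc)
  | loop_false => rfl

theorem Ev.keepsArr {E : Env} {c : Cmd} {s s' : Store} {t : ℕ} {A : Arr} (h : Ev E c s t s')
    (hc : c.KeepsArr A) : s'.mem A = s.mem A := by
  induction h with
  | skip => rfl
  | assign => rfl
  | store A' e f s => rw [Store.setA_mem, if_neg hc]
  | seq _ _ ih1 ih2 => exact (ih2 hc.2).trans (ih1 hc.1)
  | ite_true _ _ ih => exact ih hc.1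
  | ite_false _ _ ih => exact ih hc.2
  | loop_true _ _ _ ih1 ih2 => exact (ih2 hc).trans (ih1 hc)
  | loop_false => rfl

theorem Cmd.Within.frame {E : Env} {c : Cmd} {s : Store} {T : ℕ} {R : Store → Prop}
    (h : c.Within E s T R) : c.Within E s T fun s' => R s' ∧
      (∀ v, c.Keeps v → s'.reg v = s.reg v) ∧ ∀ A, c.KeepsArr A → s'.mem A = s.mem A := by
  obtain ⟨t, s', h1, h2, h3⟩ := h
  exact ⟨t, s', h1, h2, h3, fun v => h2.keeps, fun A => h2.keepsArr⟩

theorem Cmd.Within.assign {E : Env} {v : Var} {e : Expr} {s : Store} {R : Store → Prop}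
    (h : R (s.setV v (e.eval E s))) : (Cmd.assign v e).Within E s 1 R :=
  ⟨1, _, le_rfl, Ev.assign _ _ _, h⟩

theorem Cmd.Within.assign_seq {E : Env} {v : Var} {e : Expr} {d : Cmd} {s : Store} {T : ℕ}
    {R : Store → Prop} (h : d.Within E (s.setV v (e.eval E s)) T R) :
    (Cmd.assign v e ;; d).Within E s (T + 1) R := by
  rw [add_comm]
  exact Within.seq (Within.assign h)

theorem Cmd.Within.store_seq {E : Env} {A : Arr} {e f : Expr} {d : Cmd} {s : Store} {T : ℕ}
    {R : Store → Prop} (h : d.Within E (s.setA A (e.eval E s) (f.eval E s)) T R) :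
    (Cmd.store A e f ;; d).Within E s (T + 1) R := by
  rw [add_comm]
  exact Within.seq ⟨1, _, le_rfl, Ev.store _ _ _ _, h⟩

/-- The integer input is a permutation followed by the numbers of the segments, and `Q` maps every
endpoint to the other endpoint of its segment. -/
structure Env.Paired (E : Env) (Q : ℕ → ℕ) : Prop where
  inp_lt : ∀ k < E.n, E.inp k < E.n
  inp_inj : ∀ j < E.n, ∀ k < E.n, E.inp j = E.inp k → j = k
  Q_lt : ∀ k < E.n, Q k < E.n
  Q_Q : ∀ k < E.n, Q (Q k) = k
  Q_ne : ∀ k < E.n, Q k ≠ k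
  seg : ∀ j < E.n, ∀ k < E.n, E.inp (E.n + j) = E.inp (E.n + k) → k = j ∨ k = Q j
  seg_Q : ∀ j < E.n, E.inp (E.n + Q j) = E.inp (E.n + j)

/-- The rank of the `x`-coordinate of the `k`-th point in `x`-order. -/
noncomputable def Env.rankX (E : Env) (k : ℕ) : ℕ := rank (fun i => E.real (2 * i)) k

/-- The rank of the `y`-coordinate of the `k`-th point in `y`-order. -/
noncomputable def Env.rankY (E : Env) (k : ℕ) : ℕ :=
  rank (fun i => E.real (2 * E.n + (2 * i + 1))) k

theorem Env.clip_of_lt {E : Env} {a : ℕ} (h : a < 2 * E.n) : E.clip a = a := if_pos h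

/-- Compute the ranks of the coordinates, the inverse of the permutation, and the partners. -/
def prepBody : Cmd :=
  store .rankX (Var.i + 1) (load .rankX Var.i + rlt (2 * Var.i) (2 * (Var.i + 1))) ;;
  store .rankY (Var.i + 1) (load .rankY Var.i +
    rlt (2 * size + (2 * Var.i + 1)) (2 * size + (2 * (Var.i + 1) + 1))) ;;
  store .inv (inp Var.i) Var.i ;;
  assign .y (inp (size + Var.i)) ;;
  ite (load .first Var.y)
    (assign .x (load .first Var.y - 1) ;; store .partner Var.i Var.x ;; store .partner Var.x Var.i)
    (store .first Var.y (Var.i + 1))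

/-- The state of the preprocessing before position `k`. -/
structure PrepInv (E : Env) (Q : ℕ → ℕ) (k : ℕ) (s : Store) : Prop where
  rankX : ∀ j ≤ k, s.mem .rankX j = E.rankX j
  rankY : ∀ j ≤ k, s.mem .rankY j = E.rankY j
  inv : ∀ j < k, s.mem .inv (E.inp j) = j
  first : ∀ j < E.n, s.mem .first (E.inp (E.n + j)) = if min j (Q j) < k then min j (Q j) + 1 else 0
  partner : ∀ j < E.n, max j (Q j) < k → s.mem .partner j = Q j
  rest : ∀ A, A ≠ .rankX → A ≠ .rankY → A ≠ .inv → A ≠ .first → A ≠ .partner →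
    s.mem A = fun _ => 0
  ans : s.reg .ans = 0

theorem run_prepBody (E : Env) (s : Store) :
    (prepBody.run E s).mem .rankX = Function.update (s.mem .rankX) (s.reg .i + 1)
      (s.mem .rankX (s.reg .i) +
        if E.real (2 * s.reg .i) < E.real (2 * (s.reg .i + 1)) then 1 else 0) ∧
    (prepBody.run E s).mem .rankY = Function.update (s.mem .rankY) (s.reg .i + 1)
      (s.mem .rankY (s.reg .i) + if E.real (2 * E.n + (2 * s.reg .i + 1)) <
        E.real (2 * E.n + (2 * (s.reg .i + 1) + 1)) then 1 else 0) ∧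
    (prepBody.run E s).mem .inv = Function.update (s.mem .inv) (E.inp (E.clip (s.reg .i)))
      (s.reg .i) ∧
    (prepBody.run E s).mem .first =
      (if s.mem .first (E.inp (E.clip (E.n + s.reg .i))) = 0 then
        Function.update (s.mem .first) (E.inp (E.clip (E.n + s.reg .i))) (s.reg .i + 1)
      else s.mem .first) ∧
    (prepBody.run E s).mem .partner =
      (if s.mem .first (E.inp (E.clip (E.n + s.reg .i))) = 0 then s.mem .partner
      else Function.update (Function.update (s.mem .partner) (s.reg .i)
        (s.mem .first (E.inp (E.clip (E.n + s.reg .i))) - 1))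
        (s.mem .first (E.inp (E.clip (E.n + s.reg .i))) - 1) (s.reg .i)) ∧
    (∀ A, A ≠ .rankX → A ≠ .rankY → A ≠ .inv → A ≠ .first → A ≠ .partner →
      (prepBody.run E s).mem A = s.mem A) ∧
    (prepBody.run E s).reg .ans = s.reg .ans ∧ (prepBody.run E s).reg .i = s.reg .i := by
  by_cases h : s.mem .first (E.inp (E.clip (E.n + s.reg .i))) = 0
  · simp +contextual [prepBody, run, h, Expr.eval]
    exact ⟨rfl, rfl⟩
  · simp +contextual [prepBody, run, h, Expr.eval]
    exact ⟨rfl, rfl⟩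

/-- Every segment number is met twice. The first visit records its position plus one in `first`; the
second finds this record and links both positions. In the last iteration the rank comparisons read a
cell that is not in the array concerned, but the rank at position `n` is never used. -/
theorem PrepInv.step {E : Env} {Q : ℕ → ℕ} (hE : E.Paired Q) {k : ℕ} (hk : k < E.n) {s : Store}
    (hs : s.reg .i = k) (h : PrepInv E Q k s) :
    PrepInv E Q (k + 1) ((prepBody.run E s).setV .i (k + 1)) := by
  obtain ⟨r1, r2, r3, r4, r5, r6, r7, -⟩ := run_prepBody E s
  rw [hs] at r1 r2 r3 r4 r5
  rw [Env.clip_of_lt (by omega)] at r3 r4 r5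
  have hQk := hE.Q_lt k hk
  have hQQ := hE.Q_Q k hk
  have hne := hE.Q_ne k hk
  have hf := h.first k hk
  -- Positions other than `k` and its partner belong to other segments, so their entries are not
  -- touched.
  have hcase : ∀ j < E.n, j ≠ k → j ≠ Q k → Q j ≠ k ∧ E.inp (E.n + j) ≠ E.inp (E.n + k) := by
    intro j hj h1 h2
    refine ⟨fun hc => h2 (by rw [← hc, hE.Q_Q j hj]), fun hc => ?_⟩
    rcases hE.seg j hj k hk hc with h3 | h3
    · exact h1 h3.symm
    · exact h2 (by rw [h3, hE.Q_Q j hj])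
  constructor
  · intro j hj
    rw [Store.setV_mem, r1, Function.update_apply]
    by_cases hjk : j = k + 1
    · rw [if_pos hjk, h.rankX k le_rfl, hjk]
      rfl
    · rw [if_neg hjk]
      exact h.rankX j (by omega)
  · intro j hj
    rw [Store.setV_mem, r2, Function.update_apply]
    by_cases hjk : j = k + 1
    · rw [if_pos hjk, h.rankY k le_rfl, hjk]
      rfl
    · rw [if_neg hjk]
      exact h.rankY j (by omega)
  · intro j hj
    rw [Store.setV_mem, r3, Function.update_apply]
    split_ifs with hjk
    · exact (hE.inp_inj j (by omega) k hk hjk).symm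
    · refine h.inv j (lt_of_le_of_ne (by omega) fun hc => hjk (by rw [hc]))
  -- After either visit, the entry of the segment is its smaller position plus one.
  · have key : (if min k (Q k) < k then s.mem .first else
        Function.update (s.mem .first) (E.inp (E.n + k)) (k + 1)) (E.inp (E.n + k)) =
        min k (Q k) + 1 := by
      by_cases hlt : min k (Q k) < k
      · rw [if_pos hlt, hf, if_pos hlt]
      · rw [if_neg hlt, Function.update_self, min_eq_left (by omega : k ≤ Q k)]
    have hr : (if s.mem .first (E.inp (E.n + k)) = 0 then
        Function.update (s.mem .first) (E.inp (E.n + k)) (k + 1) else s.mem .first) =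
        if min k (Q k) < k then s.mem .first else
          Function.update (s.mem .first) (E.inp (E.n + k)) (k + 1) := by
      by_cases hlt : min k (Q k) < k
      · rw [if_pos hlt, if_neg (by rw [hf, if_pos hlt]; omega)]
      · rw [if_neg hlt, if_pos (by rw [hf, if_neg hlt])]
    rw [hr] at r4
    intro j hj
    rw [Store.setV_mem, r4]
    by_cases h1 : j = k
    · rw [h1, key, if_pos (by omega)]
    by_cases h2 : j = Q k
    · rw [h2, hE.seg_Q k hk, key, hQQ, min_comm (Q k), if_pos (by omega)]
    obtain ⟨h3, h4⟩ := hcase j hj h1 h2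
    have h5 := h.first j hj
    have h6 : (if min j (Q j) < k then min j (Q j) + 1 else 0) =
        if min j (Q j) < k + 1 then min j (Q j) + 1 else 0 := by
      split_ifs <;> omega
    rw [← h6, ← h5]
    split_ifs
    · rfl
    · rw [Function.update_of_ne h4]
  · intro j hj hjk
    have hQj := hE.Q_Q j hj
    have hQjn := hE.Q_ne j hj
    rw [Store.setV_mem, r5]
    by_cases hlt : Q k < k
    · have h7 : s.mem .first (E.inp (E.n + k)) = Q k + 1 := by
        rw [hf, if_pos (by omega), min_eq_right (by omega)]
      rw [h7, if_neg (by omega), Nat.add_sub_cancel]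
      by_cases h2 : j = Q k
      · rw [h2, Function.update_self, hQQ]
      rw [Function.update_of_ne h2]
      by_cases h1 : j = k
      · rw [h1, Function.update_self]
      rw [Function.update_of_ne h1]
      obtain ⟨h3, h4⟩ := hcase j hj h1 h2
      exact h.partner j hj (by omega)
    · have h7 : s.mem .first (E.inp (E.n + k)) = 0 := by
        rw [hf, if_neg (by omega)]
      rw [if_pos h7]
      have h1 : j ≠ k := fun hc => by rw [hc] at hjk; omega
      have h2 : j ≠ Q k := fun hc => by rw [hc] at hjk; omega
      obtain ⟨h3, h4⟩ := hcase j hj h1 h2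
      exact h.partner j hj (by omega)
  · intro A h1 h2 h3 h4 h5
    rw [Store.setV_mem, r6 A h1 h2 h3 h4 h5, h.rest A h1 h2 h3 h4 h5]
  · simp [r7, h.ans]

end RealRAM

namespace RealRAM

open RealRAM.Expr RealRAM.Cmd LazyTree Sweep

/-! ## Collinear segments -/

/-- Compare the segment with the endpoints `i` and `x` with the preceding ones on its line. -/
def collide (U D : Arr) : Cmd :=
  ite (lt Var.i Var.x)
    (ite (eq Var.lo Var.hi)
      (ite (lt (load U Var.i) (load D Var.lo)) (assign .ans 1) skip ;;
        store D Var.lo (load U Var.x + 1))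
      skip)
    skip

/-- The state of the search for conflicts before position `k`, where `P` is the result of the
previous searches. -/
def ConflictInv (U V Q : ℕ → ℕ) (P : Prop) (D : Arr) (k : ℕ) (s : Store) : Prop :=
  (¬ Conflict U V Q k → LastEnd U V Q k (s.mem D)) ∧
    ((P ∨ Conflict U V Q k) ∧ s.reg .ans = 1 ∨ ¬ (P ∨ Conflict U V Q k) ∧ s.reg .ans = 0)

theorem ConflictInv.zero {U V Q : ℕ → ℕ} {P : Prop} {D : Arr} {s : Store}
    (hD : s.mem D = fun _ => 0) (h : P ∧ s.reg .ans = 1 ∨ ¬ P ∧ s.reg .ans = 0) :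
    ConflictInv U V Q P D 0 s := by
  have h0 : ¬ Conflict U V Q 0 := by
    rintro ⟨j, k, -, h, -⟩
    omega
  refine ⟨fun _ v => ⟨fun j hj => absurd hj (Nat.not_lt_zero j), Or.inl (by rw [hD])⟩, ?_⟩
  simpa [h0] using h

/-- A conflict, once found, persists along with `ans = 1`; the table `D` has to be correct only as
long as there is none. -/
theorem ConflictInv.step {E : Env} {U V Q : ℕ → ℕ} {P : Prop} {A D : Arr} {k : ℕ} {s : Store}
    (h : ConflictInv U V Q P D k s) (hi : s.reg .i = k) (hx : s.reg .x = Q k)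
    (hlo : s.reg .lo = V k) (hhi : s.reg .hi = V (Q k)) (hk : s.mem A k = U k)
    (hQk : s.mem A (Q k) = U (Q k)) (hU : k < Q k → U k ≤ U (Q k)) :
    ConflictInv U V Q P D (k + 1) ((collide A D).run E s) := by
  by_cases hl : LeftEnd V Q k
  · have hs := conflict_succ hl h.1
    have h1 : ¬ Q k ≤ k := not_le.2 hl.1
    by_cases hc : U k < s.mem D (V k)
    · have hrun : (collide A D).run E s = (s.setV .ans 1).setA D (V k) (U (Q k) + 1) := by
        have hc' := not_le.2 hc
        simp [collide, run, hi, hx, hlo, hhi, h1, hQk, hk, ← hl.2, hc']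
      rw [hrun]
      have hC : Conflict U V Q (k + 1) := by
        rcases hs.2 (Or.inr hc) with h2 | h2
        · exact h2
        · exact h2.succ
      exact ⟨fun h2 => absurd hC h2, Or.inl ⟨Or.inr hC, by simp⟩⟩
    · have hrun : (collide A D).run E s = s.setA D (V k) (U (Q k) + 1) := by
        have hc' := not_lt.1 hc
        simp [collide, run, hi, hx, hlo, hhi, h1, hQk, hk, ← hl.2, hc']
      rw [hrun]
      have hC : Conflict U V Q (k + 1) ↔ Conflict U V Q k := by
        refine ⟨fun h2 => (hs.1 (Or.inl h2)).resolve_right hc, Conflict.succ⟩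
      refine ⟨fun h2 => ?_, ?_⟩
      · have := (h.1 (mt hC.2 h2)).succ (hU hl.1) hl (not_lt.1 hc)
        simpa using this
      · rw [hC]
        exact h.2
  · have hrun : (collide A D).run E s = s := by
      rw [LeftEnd, not_and_or] at hl
      rcases hl with hl | hl
      · simp [collide, run, hi, hx, not_lt.1 hl]
      · by_cases h1 : Q k ≤ k
        · simp [collide, run, hi, hx, h1]
        · simp [collide, run, hi, hx, hlo, hhi, h1, hl]
    rw [hrun]
    refine ⟨fun h1 => ?_, ?_⟩
    · exact (h.1 (mt (conflict_succ_of_not_leftEnd hl).2 h1)).succ_of_not_leftEnd hl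
    · rw [conflict_succ_of_not_leftEnd hl]
      exact h.2

/-- The numbers of the endpoints and of the partners have been computed. -/
structure Prepared (E : Env) (Q : ℕ → ℕ) (s : Store) : Prop where
  rankX : ∀ j < E.n, s.mem .rankX j = E.rankX j
  rankY : ∀ j < E.n, s.mem .rankY j = E.rankY j
  inv : ∀ j < E.n, s.mem .inv (E.inp j) = j
  partner : ∀ j < E.n, s.mem .partner j = Q j

theorem Prepared.congr {E : Env} {Q : ℕ → ℕ} {s s' : Store} (h : Prepared E Q s)
    (h1 : s'.mem .rankX = s.mem .rankX) (h2 : s'.mem .rankY = s.mem .rankY)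
    (h3 : s'.mem .inv = s.mem .inv) (h4 : s'.mem .partner = s.mem .partner) : Prepared E Q s' :=
  ⟨by rw [h1]; exact h.rankX, by rw [h2]; exact h.rankY, by rw [h3]; exact h.inv,
    by rw [h4]; exact h.partner⟩

theorem within_prep {E : Env} {Q : ℕ → ℕ} (hE : E.Paired Q) :
    (forLoop .i prepBody).Within E ⟨fun _ => 0, fun _ _ => 0⟩ (E.n * (prepBody.steps + 2) + 2)
      fun s => Prepared E Q s ∧ s.reg .ans = 0 ∧ ∀ A, A ≠ .rankX → A ≠ .rankY → A ≠ .inv →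
        A ≠ .first → A ≠ .partner → s.mem A = fun _ => 0 := by
  refine (within_forLoop (PrepInv E Q) ?_ ?_).mono le_rfl fun s h => ?_
  · refine ⟨?_, ?_, ?_, ?_, ?_, ?_, ?_⟩ <;> simp [Env.rankX, Env.rankY, rank]
  · intro k hk s hs h
    refine within_run (by simp [prepBody, LoopFree]) ⟨?_, h.step hE hk hs⟩
    rw [(run_prepBody E s).2.2.2.2.2.2.2, hs]
  · refine ⟨⟨fun j hj => h.rankX j hj.le, fun j hj => h.rankY j hj.le, h.inv, fun j hj => ?_⟩,
      h.ans, h.rest⟩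
    exact h.partner j hj (max_lt hj (hE.Q_lt j hj))

/-- Search for conflicts between horizontal segments. -/
def collideX : Cmd :=
  assign .x (load .partner Var.i) ;;
  assign .lo (load .rankY (inp Var.i)) ;;
  assign .hi (load .rankY (inp Var.x)) ;;
  collide .rankX .endX

/-- Search for conflicts between vertical segments. -/
def collideY : Cmd :=
  assign .a (load .inv Var.i) ;;
  assign .b (load .partner Var.a) ;;
  assign .x (inp Var.b) ;;
  assign .lo (load .rankX Var.a) ;;
  assign .hi (load .rankX Var.b) ;;
  collide .rankY .endY

theorem run_collide_i (E : Env) (s : Store) (A D : Arr) :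
    ((collide A D).run E s).reg .i = s.reg .i ∧
      ∀ A', A' ≠ D → ((collide A D).run E s).mem A' = s.mem A' := by
  simp only [collide, run]
  split_ifs <;> simp +contextual

theorem ConflictInv.setV {U V Q : ℕ → ℕ} {P : Prop} {D : Arr} {k : ℕ} {s : Store}
    (h : ConflictInv U V Q P D k s) {v : Var} (hv : v ≠ .ans) (a : ℕ) :
    ConflictInv U V Q P D k (s.setV v a) := by
  simpa [ConflictInv, hv.symm] using h

theorem within_collideX {E : Env} {Q V : ℕ → ℕ} (hE : E.Paired Q)
    (hV : ∀ k < E.n, V k = E.rankY (E.inp k)) {P : Prop} {s : Store} (hs : Prepared E Q s)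
    (hD : s.mem .endX = fun _ => 0) (h : P ∧ s.reg .ans = 1 ∨ ¬ P ∧ s.reg .ans = 0) :
    (forLoop .i collideX).Within E s (E.n * (collideX.steps + 2) + 2) fun s' =>
      Prepared E Q s' ∧ (∀ A, A ≠ .endX → s'.mem A = s.mem A) ∧
      ((P ∨ Conflict E.rankX V Q E.n) ∧ s'.reg .ans = 1 ∨
        ¬ (P ∨ Conflict E.rankX V Q E.n) ∧ s'.reg .ans = 0) := by
  refine (within_forLoop (fun k s' => ConflictInv E.rankX V Q P .endX k s' ∧
    ∀ A, A ≠ .endX → s'.mem A = s.mem A) ?_ ?_).mono le_rfl fun s' h => ?_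
  · exact ⟨(ConflictInv.zero hD h).setV (by simp) _, fun A _ => rfl⟩
  · rintro k hk s' hi ⟨h1, h2⟩
    have hQk := hE.Q_lt k hk
    have e1 : s'.mem .partner k = Q k := by rw [h2 _ (by simp), hs.partner k hk]
    have e2 : s'.mem .rankY (E.inp k) = V k := by
      rw [h2 _ (by simp), hs.rankY _ (hE.inp_lt k hk), hV k hk]
    have e3 : s'.mem .rankY (E.inp (Q k)) = V (Q k) := by
      rw [h2 _ (by simp), hs.rankY _ (hE.inp_lt _ hQk), hV _ hQk]
    have hrun : collideX.run E s' = (collide .rankX .endX).run E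
        (((s'.setV .x (Q k)).setV .lo (V k)).setV .hi (V (Q k))) := by
      simp [collideX, run, hi, e1, e2, e3, Env.clip_of_lt (show k < 2 * E.n by omega),
        Env.clip_of_lt (show Q k < 2 * E.n by omega)]
    have hc := run_collide_i E (((s'.setV .x (Q k)).setV .lo (V k)).setV .hi (V (Q k)))
      .rankX .endX
    refine within_run (by simp [collideX, collide, LoopFree]) ⟨?_, ?_, ?_⟩
    · rw [hrun, hc.1]
      simp [hi]
    · rw [hrun]
      refine ConflictInv.setV (ConflictInv.step (((h1.setV (by simp) _).setV (by simp) _).setV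
        (by simp) _) ?_ ?_ ?_ ?_ ?_ ?_ fun hlt => ?_) (by simp) _
      · simp [hi]
      · simp
      · simp
      · simp
      · simp [h2, hs.rankX k hk]
      · simp [h2, hs.rankX _ hQk]
      · exact rank_mono _ hlt.le
    · intro A hA
      rw [Store.setV_mem, hrun, hc.2 A hA]
      simpa using h2 A hA
  · exact ⟨hs.congr (h.2 _ (by simp)) (h.2 _ (by simp)) (h.2 _ (by simp)) (h.2 _ (by simp)), h.2,
      h.1.2⟩

/-- The same search with the axes exchanged: `k` numbers the points in `y`-order, `I` translates to
`x`-order, where the partners are known, and the input permutation translates back. -/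
theorem within_collideY {E : Env} {Q I : ℕ → ℕ} (hE : E.Paired Q)
    (hI : ∀ k < E.n, I k < E.n ∧ E.inp (I k) = k) {P : Prop} {s : Store} (hs : Prepared E Q s)
    (hD : s.mem .endY = fun _ => 0) (h : P ∧ s.reg .ans = 1 ∨ ¬ P ∧ s.reg .ans = 0) :
    (forLoop .i collideY).Within E s (E.n * (collideY.steps + 2) + 2) fun s' =>
      Prepared E Q s' ∧ (∀ A, A ≠ .endY → s'.mem A = s.mem A) ∧
      ((P ∨ Conflict E.rankY (fun k => E.rankX (I k)) (fun k => E.inp (Q (I k))) E.n) ∧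
          s'.reg .ans = 1 ∨
        ¬ (P ∨ Conflict E.rankY (fun k => E.rankX (I k)) (fun k => E.inp (Q (I k))) E.n) ∧
          s'.reg .ans = 0) := by
  refine (within_forLoop (fun k s' => ConflictInv E.rankY (fun k => E.rankX (I k))
    (fun k => E.inp (Q (I k))) P .endY k s' ∧
    ∀ A, A ≠ .endY → s'.mem A = s.mem A) ?_ ?_).mono le_rfl fun s' h => ?_
  · exact ⟨(ConflictInv.zero hD h).setV (by simp) _, fun A _ => rfl⟩
  · rintro k hk s' hi ⟨h1, h2⟩
    obtain ⟨hI1, hI2⟩ := hI k hk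
    have hQk := hE.Q_lt _ hI1
    have hx := hE.inp_lt _ hQk
    have e0 : s'.mem .inv k = I k := by
      rw [h2 _ (by simp)]
      nth_rw 1 [← hI2]
      rw [hs.inv _ hI1]
    have e1 : s'.mem .partner (I k) = Q (I k) := by rw [h2 _ (by simp), hs.partner _ hI1]
    have e2 : s'.mem .rankX (I k) = E.rankX (I k) := by rw [h2 _ (by simp), hs.rankX _ hI1]
    have e3 : s'.mem .rankX (Q (I k)) = E.rankX (Q (I k)) := by
      rw [h2 _ (by simp), hs.rankX _ hQk]
    have e4 : I (E.inp (Q (I k))) = Q (I k) :=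
      hE.inp_inj _ (hI _ hx).1 _ hQk (hI _ hx).2
    have hrun : collideY.run E s' = (collide .rankY .endY).run E
        (((((s'.setV .a (I k)).setV .b (Q (I k))).setV .x (E.inp (Q (I k)))).setV .lo
          (E.rankX (I k))).setV .hi (E.rankX (Q (I k)))) := by
      simp [collideY, run, hi, e0, e1, e2, e3, Env.clip_of_lt (show Q (I k) < 2 * E.n by omega)]
    have hc := run_collide_i E (((((s'.setV .a (I k)).setV .b (Q (I k))).setV .x
      (E.inp (Q (I k)))).setV .lo (E.rankX (I k))).setV .hi (E.rankX (Q (I k)))) .rankY .endY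
    refine within_run (by simp [collideY, collide, LoopFree]) ⟨?_, ?_, ?_⟩
    · rw [hrun, hc.1]
      simp [hi]
    · rw [hrun]
      refine ConflictInv.setV (ConflictInv.step (((((h1.setV (by simp) _).setV (by simp) _).setV
        (by simp) _).setV (by simp) _).setV (by simp) _) ?_ ?_ ?_ ?_ ?_ ?_
        fun hlt => ?_) (by simp) _
      · simp [hi]
      · simp
      · simp
      · simp [e4]
      · simp [h2, hs.rankY k hk]
      · simp [h2, hs.rankY _ hx]
      · exact rank_mono _ hlt.le
    · intro A hA
      rw [Store.setV_mem, hrun, hc.2 A hA]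
      simpa using h2 A hA
  · exact ⟨hs.congr (h.2 _ (by simp)) (h.2 _ (by simp)) (h.2 _ (by simp)) (h.2 _ (by simp)), h.2,
      h.1.2⟩

end RealRAM

namespace RealRAM

open RealRAM.Expr RealRAM.Cmd LazyTree Sweep

/-! ## Division tables -/

/-- The sizes of the universes. -/
def treeSize : ℕ → ℕ
  | 0 => 2
  | 1 => 2
  | k + 2 => treeSize (k + 1) * treeSize (k + 1)

theorem treeSize_succ (k : ℕ) : treeSize (k + 1) = 2 ^ 2 ^ k := by
  induction k with
  | zero => rfl
  | succ k ih => rw [treeSize, ih, ← pow_add, pow_succ, mul_two]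

theorem treeSize_pos (k : ℕ) : 0 < treeSize k := by
  cases k with
  | zero => exact two_pos
  | succ k => rw [treeSize_succ]; positivity

/-- A sufficient number of levels. -/
def levels (n : ℕ) : ℕ := Nat.log 2 (Nat.log 2 n) + 2

theorem le_treeSize_levels (n : ℕ) : n ≤ treeSize (levels n) := by
  rw [levels, treeSize_succ]
  refine (Nat.lt_pow_succ_log_self one_lt_two n).le.trans (Nat.pow_le_pow_right two_pos ?_)
  exact Nat.lt_pow_succ_log_self one_lt_two _

/-- Write one entry of the division table of level `k`, for the divisor `u`. -/
def divStep : Cmd :=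
  store .div (Var.k * size + Var.i) Var.q ;;
  store .mod (Var.k * size + Var.i) Var.r ;;
  assign .r (Var.r + 1) ;;
  ite (eq Var.r Var.u) (assign .r 0 ;; assign .q (Var.q + 1)) skip

/-- Write the division table of level `k`, for the divisor `u`. -/
def divTable : Cmd :=
  store .size Var.k Var.u ;; assign .q 0 ;; assign .r 0 ;; forLoop .i divStep

/-- The state of the computation of a division table. -/
structure DivInv (n K W : ℕ) (s₀ : Store) (i : ℕ) (s : Store) : Prop where
  k : s.reg .k = K
  u : s.reg .u = W
  q : s.reg .q = i / W
  r : s.reg .r = i % W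
  div : ∀ y < i, s.mem .div (K * n + y) = y / W
  mod : ∀ y < i, s.mem .mod (K * n + y) = y % W
  div_old : ∀ j < K * n, s.mem .div j = s₀.mem .div j
  mod_old : ∀ j < K * n, s.mem .mod j = s₀.mem .mod j

/-- Quotient and remainder are maintained by counting: the remainder grows by one and is reset, with
a carry, when it reaches the divisor. -/
theorem DivInv.step {E : Env} {K W : ℕ} {s₀ : Store} {i : ℕ} {s : Store} (hW : 0 < W)
    (h : DivInv E.n K W s₀ i s) (hi : s.reg .i = i) :
    DivInv E.n K W s₀ (i + 1) ((divStep.run E s).setV .i (i + 1)) := by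
  have hr : (divStep.run E s).mem .div = Function.update (s.mem .div) (K * E.n + i) (i / W) ∧
      (divStep.run E s).mem .mod = Function.update (s.mem .mod) (K * E.n + i) (i % W) ∧
      (divStep.run E s).reg .k = K ∧ (divStep.run E s).reg .u = W ∧
      (divStep.run E s).reg .r = (if i % W + 1 = W then 0 else i % W + 1) ∧
      (divStep.run E s).reg .q = (if i % W + 1 = W then i / W + 1 else i / W) := by
    by_cases hc : i % W + 1 = W <;>
      simp [divStep, run, h.k, h.u, h.q, h.r, hi, hc]
  obtain ⟨h1, h2, h3, h4, h5, h6⟩ := hr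
  have hdm : (i + 1) / W = (if i % W + 1 = W then i / W + 1 else i / W) ∧
      (i + 1) % W = (if i % W + 1 = W then 0 else i % W + 1) := by
    have e := Nat.div_add_mod i W
    have hlt := Nat.mod_lt i hW
    rw [Nat.div_mod_unique hW]
    split_ifs with hc
    · refine ⟨?_, hW⟩
      rw [mul_add]
      omega
    · exact ⟨by omega, by omega⟩
  refine ⟨?_, ?_, ?_, ?_, ?_, ?_, ?_, ?_⟩
  · simpa using h3
  · simpa using h4
  · simpa [hdm.1] using h6
  · simpa [hdm.2] using h5
  · intro y hy
    rw [Store.setV_mem, h1, Function.update_apply]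
    split_ifs with hc
    · rw [show y = i by omega]
    · exact h.div y (by omega)
  · intro y hy
    rw [Store.setV_mem, h2, Function.update_apply]
    split_ifs with hc
    · rw [show y = i by omega]
    · exact h.mod y (by omega)
  · intro j hj
    rw [Store.setV_mem, h1, Function.update_of_ne (by omega), h.div_old j hj]
  · intro j hj
    rw [Store.setV_mem, h2, Function.update_of_ne (by omega), h.mod_old j hj]

theorem within_divTable (E : Env) {s : Store} {w : ℕ → ℕ} {K : ℕ} (hK : s.reg .k = K + 1)
    (hu : s.reg .u = w K) (hw : 0 < w K) (h : (s.tables E.n).Good E.n w K) :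
    divTable.Within E s (E.n * (divStep.steps + 2) + 5) fun s' =>
      s'.reg .k = K + 1 ∧ s'.reg .u = w K ∧ (s'.tables E.n).Good E.n w (K + 1) := by
  have hl := within_forLoop (E := E) (v := .i) (c := divStep) (B := divStep.steps)
    (DivInv E.n (K + 1) (w K) s) (s := ((s.setA .size (K + 1) (w K)).setV .q 0).setV .r 0)
    (by refine ⟨?_, ?_, ?_, ?_, ?_, ?_, ?_, ?_⟩ <;> simp [hK, hu])
    (fun k hk s' hs' hI => within_run (by simp [divStep, LoopFree])
      ⟨by by_cases h : s'.reg .r + 1 = s'.reg .u <;> simp [divStep, run, h, hs'], hI.step hw hs'⟩)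
  have hl := hl.frame
  refine Within.store_seq (T := _ + 4) (Within.assign_seq (Within.assign_seq ?_))
  simp only [eval_var, eval_zero, hK, hu]
  refine hl.mono le_rfl ?_
  rintro s' ⟨h1, -, h2⟩
  have hsz := h2 .size (by simp [forLoop, divStep, KeepsArr])
  simp only [Store.setV_mem, Store.setA_mem, if_true] at hsz
  refine ⟨h1.k, h1.u, fun k hk => ?_⟩
  rcases Nat.lt_succ_iff_lt_or_eq.1 hk with hk | rfl
  · obtain ⟨g1, g2⟩ := h k hk
    refine ⟨?_, fun y hy => ?_⟩
    · simp only [Store.tables] at g1 ⊢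
      rw [hsz, Function.update_of_ne (by omega), g1]
    -- The entries of a lower level lie in front of the block of level `K + 1` and are not
    -- overwritten.
    · have hlt : (k + 1) * E.n + y < (K + 1) * E.n := by
        have := Nat.mul_le_mul_right E.n (show k + 2 ≤ K + 1 by omega)
        rw [Nat.succ_mul] at this
        omega
      obtain ⟨g3, g4⟩ := g2 y hy
      simp only [Store.tables] at g3 g4 ⊢
      rw [h1.div_old _ hlt, h1.mod_old _ hlt]
      exact ⟨g3, g4⟩
  · refine ⟨?_, fun y hy => ⟨h1.div y hy, h1.mod y hy⟩⟩
    simp [Store.tables, hsz]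

/-- Compute the division tables. -/
def divTables : Cmd :=
  assign .u 2 ;;
  assign .k 1 ;;
  divTable ;;
  .loop (lt Var.u size) (assign .k (Var.k + 1) ;; divTable ;; assign .u (Var.u * Var.u)) ;;
  assign .top Var.k

/-- Repeated squaring passes `n` after at most `levels n` tables, each of which takes linear time.
The last level reached becomes the height of the tree. -/
theorem within_divTables (E : Env) (s : Store) :
    divTables.Within E s (levels E.n * (E.n * (divStep.steps + 2) + 8) + 4) fun s' =>
      (∃ K, s'.reg .top = K + 1 ∧ K + 1 ≤ levels E.n ∧ E.n ≤ treeSize (K + 1) ∧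
        (s'.tables E.n).Good E.n treeSize (K + 1)) := by
  have hL : levels E.n = Nat.log 2 (Nat.log 2 E.n) + 1 + 1 := rfl
  set B := E.n * (divStep.steps + 2) + 5
  have hw : ∀ s₁ : Store, s₁.reg .k = 1 ∧ s₁.reg .u = treeSize 1 ∧
      (s₁.tables E.n).Good E.n treeSize 1 →
      (Cmd.loop (lt Var.u size)
        (assign .k (Var.k + 1) ;; divTable ;; assign .u (Var.u * Var.u))).Within E s₁
        ((levels E.n - 1) * (B + 2 + 1) + 1) fun s' =>
        ∃ K, s'.reg .k = K + 1 ∧ K + 1 ≤ levels E.n ∧ E.n ≤ treeSize (K + 1) ∧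
          (s'.tables E.n).Good E.n treeSize (K + 1) := by
    intro s₁ h1
    refine (Within.loop (B := B + 2) (fun j s' => ∃ K, K + 1 + j = levels E.n ∧ s'.reg .k = K + 1 ∧
      s'.reg .u = treeSize (K + 1) ∧ (s'.tables E.n).Good E.n treeSize (K + 1))
      ?_ _ s₁ ⟨0, by omega, h1.1, h1.2⟩).mono le_rfl ?_
    · rintro j s' ⟨K, hj, hk, hu, hT⟩ he
      have hlt : treeSize (K + 1) < E.n := by
        by_contra hc
        exact he (by simp [hu, not_lt.1 hc])
      -- Without fuel the level would be `levels n`, whose universe already has size at least `n`.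
      have hj0 : j ≠ 0 := by
        rintro rfl
        have := le_treeSize_levels E.n
        rw [← hj, add_zero] at this
        omega
      refine ⟨j - 1, by omega, Within.assign_seq (T := B + 1) (Within.seq ((within_divTable E
        (s := s'.setV .k _) (w := treeSize) (K := K + 1) (by simp [hk]) (by simp [hu])
        (treeSize_pos _) hT).mono le_rfl
        fun s'' h => Within.assign ?_))⟩
      exact ⟨K + 1, by omega, by simp [h.1], by simp [h.2.1, treeSize], h.2.2⟩
    · rintro s' ⟨⟨j, K, hj, hk, hu, hT⟩, he⟩
      rw [eval_lt_eq_zero, eval_var, eval_size, hu] at he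
      exact ⟨K, hk, by omega, he, hT⟩
  -- The first table divides by `treeSize 0`. This equals `treeSize 1`, so the invariant of the loop
  -- holds at its entry with `K = 0`.
  refine (Within.assign_seq (Within.assign_seq (Within.seq ((within_divTable E (w := treeSize)
    (K := 0) (by simp) (by simp [treeSize]) two_pos
    fun k hk => absurd hk (Nat.not_lt_zero k)).mono le_rfl fun s₁ h => Within.seq
      ((hw s₁ h).mono le_rfl fun s₂ h2 => Within.assign ?_))))).mono ?_ fun s' h => h
  · simpa [Store.tables] using h2
  · have : levels E.n * (B + 3) = (levels E.n - 1) * (B + 3) + (B + 3) := by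
      rw [hL, Nat.succ_mul (_ + 1), Nat.add_sub_cancel]
    change B + ((levels E.n - 1) * (B + 3) + 1 + 1) + 1 + 1 ≤ levels E.n * (B + 3) + 4
    omega

end RealRAM

namespace RealRAM

open RealRAM.Expr RealRAM.Cmd LazyTree Sweep

/-! ## The sweep -/

/-- Execute `c` if both conditions are satisfied. -/
def guarded (e f : Expr) (c : Cmd) : Cmd := ite e (ite f c skip) skip

theorem within_guarded {E : Env} {e f : Expr} {c : Cmd} {s : Store} {T : ℕ} {R : Store → Prop}
    (h : e.eval E s ≠ 0 → f.eval E s ≠ 0 → c.Within E s T R)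
    (h' : ¬ (e.eval E s ≠ 0 ∧ f.eval E s ≠ 0) → R s) : (guarded e f c).Within E s (T + 2) R :=
  Within.ite (fun he => Within.ite (fun hf => h he hf)
    fun hf => ⟨0, s, Nat.zero_le _, Ev.skip s, h' fun hc => hc.2 hf⟩)
    fun he => ⟨0, s, Nat.zero_le _, Ev.skip s, h' fun hc => hc.1 he⟩

/-- The rank of the `y`-coordinate of the point whose number is stored in `v`. -/
def lineOf (v : Var) : Expr := load .rankY (inp v)

/-- Apply a tree operation to the root. -/
def atRoot (c : Cmd) : Cmd := assign .id 1 ;; assign .k Var.top ;; c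

/-- Delete the segment that ends at the point `c`. -/
def sweepDelete : Cmd :=
  assign .x (load .partner Var.c) ;;
  guarded (lt Var.x Var.c) (eq (lineOf .c) (lineOf .x)) (assign .x (lineOf .c) ;; atRoot delLoop) ;;
  assign .c (Var.c + 1)

/-- Insert the segment that starts at the point `a`. -/
def sweepInsert : Cmd :=
  assign .x (load .partner Var.a) ;;
  guarded (lt Var.a Var.x) (eq (lineOf .a) (lineOf .x)) (assign .x (lineOf .a) ;; atRoot insLoop) ;;
  assign .a (Var.a + 1)

/-- Search for a segment that meets the segment with the lower endpoint `b`. -/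
def sweepQuery : Cmd :=
  assign .x (load .partner Var.b) ;;
  assign .y (lineOf .x) ;;
  assign .x (lineOf .b) ;;
  ite (lt Var.x Var.y) (atRoot qryLoop) skip ;;
  assign .b (Var.b + 1)

/-- One step of the sweep. -/
def sweepBody : Cmd :=
  ite (lt (load .rankX Var.c) (load .rankX Var.b)) sweepDelete
    (ite (lt Var.a size * lt (load .rankX Var.a) (load .rankX Var.b + 1)) sweepInsert sweepQuery)

/-- Sweep over the points. -/
def sweep : Cmd :=
  assign .a 0 ;; assign .b 0 ;; assign .c 0 ;; .loop (lt Var.b size) sweepBody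

/-- The state of the sweep. -/
structure SweepInv (E : Env) (Q V : ℕ → ℕ) (K a b c : ℕ) (s : Store) : Prop where
  prepared : Prepared E Q s
  good : (s.tables E.n).Good E.n treeSize (K + 1)
  top : s.reg .top = K + 1
  reg_a : s.reg .a = a
  reg_b : s.reg .b = b
  reg_c : s.reg .c = c
  pointers : Pointers E.n E.rankX a b c
  rep : LazyTree.Rep E.n treeSize (K + 1) s.heap 1 (active V Q a c)
  ans : Crossing E.n E.rankX V Q b ∧ s.reg .ans = 1 ∨
    ¬ Crossing E.n E.rankX V Q b ∧ s.reg .ans = 0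

@[simp] theorem Store.setV_heap (s : Store) (v : Var) (a : ℕ) : (s.setV v a).heap = s.heap := rfl

@[simp] theorem Store.setV_tables (s : Store) (v : Var) (a n : ℕ) :
    (s.setV v a).tables n = s.tables n := rfl

theorem TreeFrame.prepared {E : Env} {Q : ℕ → ℕ} {s s' : Store} (h : TreeFrame s s')
    (hs : Prepared E Q s) : Prepared E Q s' :=
  hs.congr (h.1 _ (by simp) (by simp)) (h.1 _ (by simp) (by simp)) (h.1 _ (by simp) (by simp))
    (h.1 _ (by simp) (by simp))

variable {E : Env} {Q V : ℕ → ℕ} {K a b c : ℕ} {s : Store}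

theorem Prepared.lineOf (hE : E.Paired Q) (hV : ∀ k < E.n, V k = E.rankY (E.inp k))
    (h : Prepared E Q s) {v : Var} {k : ℕ} (hv : s.reg v = k) (hk : k < E.n) :
    (lineOf v).eval E s = V k := by
  rw [RealRAM.lineOf, eval_load, eval_inp, eval_var, hv, Env.clip_of_lt (by omega),
    h.rankY _ (hE.inp_lt k hk), hV k hk]

theorem SweepInv.delete (hE : E.Paired Q) (hV : ∀ k < E.n, V k = E.rankY (E.inp k))
    (hF : Family E.n E.rankX V Q) (hn : ¬ Conflict E.rankX V Q E.n)
    (h : SweepInv E Q V K a b c s) (hb : b < E.n) (hlt : E.rankX c < E.rankX b) :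
    sweepDelete.Within E s ((K + 1) * (delBody.steps + 1) + 8) (SweepInv E Q V K a b (c + 1)) := by
  have hcn : c < E.n := h.pointers.cb.trans_lt hb
  have hQc := hE.Q_lt c hcn
  have hp := h.prepared
  have hx : (load .partner Var.c).eval E s = Q c := by simp [h.reg_c, hp.partner c hcn]
  refine Within.assign_seq (T := (K + 1) * (delBody.steps + 1) + 6 + 1)
    (Within.seq (T := (K + 1) * (delBody.steps + 1) + 4 + 2) ?_)
  rw [hx]
  have e1 : (lineOf .c).eval E (s.setV .x (Q c)) = V c :=
    Prepared.lineOf hE hV (s := s.setV .x (Q c)) (v := .c) ⟨hp.1, hp.2, hp.3, hp.4⟩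
      (by simp [h.reg_c]) hcn
  have e2 : (lineOf .x).eval E (s.setV .x (Q c)) = V (Q c) :=
    Prepared.lineOf hE hV (s := s.setV .x (Q c)) (v := .x) ⟨hp.1, hp.2, hp.3, hp.4⟩
      (by simp) hQc
  -- The common end of both branches: once the tree represents the new active set, only the pointer
  -- has to be advanced.
  have fin : ∀ s', TreeFrame s s' → s'.reg .ans = s.reg .ans →
      LazyTree.Rep E.n treeSize (K + 1) s'.heap 1 (active V Q a (c + 1)) →
      (assign .c (Var.c + 1)).Within E s' 1 (SweepInv E Q V K a b (c + 1)) := by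
    intro s' hf ha hr
    have hs' := hf.prepared hp
    refine Within.assign ⟨⟨hs'.1, hs'.2, hs'.3, hs'.4⟩, ?_, ?_, ?_, ?_, ?_, ?_, hr, ?_⟩
    · have := h.good
      rwa [← hf.tables] at this
    · simp [hf.2.2.2.2, h.top]
    · simp [hf.2.1, h.reg_a]
    · simp [hf.2.2.1, h.reg_b]
    · simp [hf.2.2.2.1, h.reg_c]
    · exact h.pointers.delete hF hb hlt
    · simpa [ha] using h.ans
  refine within_guarded (fun h1 h2 => ?_) fun h1 => ?_
  · rw [Ne, eval_lt_eq_zero] at h1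
    rw [Ne, eval_eq_eq_zero, e1, e2, not_not] at h2
    simp only [eval_var, Store.setV_reg, if_true, reduceCtorEq, if_false, h.reg_c, not_le] at h1
    obtain ⟨hm, he⟩ := active_delete hF hn h.pointers hb ⟨h1, h2.symm⟩
    refine Within.assign_seq (Within.assign_seq (Within.assign_seq ?_))
    rw [e1]
    refine ((within_delLoop E _).frame.mono ?_ fun s' hs' => ?_)
    · simp [h.top]
    · obtain ⟨⟨hf, hh⟩, hr, -⟩ := hs'
      have hans := hr .ans (by simp [delLoop, delBody, delSwap, delPush, locate, setNode, Keeps])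
      refine fin s' (TreeFrame.trans ?_ hf) (hans.trans (by simp)) ?_
      · simp [TreeFrame]
      · have hd := (del_spec (K + 1) (s.tables E.n) h.good s.heap 1 _ (V c) one_pos h.rep hm).1
        rw [he]
        rw [hh]
        simpa [h.top] using hd
  · refine fin _ (by simp [TreeFrame]) (by simp) ?_
    rw [active_delete_of_not hF h.pointers.an]
    · exact h.rep
    · rintro ⟨h2, h3⟩
      refine h1 ⟨?_, ?_⟩
      · rw [Ne, eval_lt_eq_zero]
        simp [h.reg_c, h2]
      · rw [Ne, eval_eq_eq_zero, e1, e2, not_not, h3]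

theorem SweepInv.insert (hE : E.Paired Q) (hV : ∀ k < E.n, V k = E.rankY (E.inp k))
    (hF : Family E.n E.rankX V Q) (hn : ¬ Conflict E.rankX V Q E.n)
    (hK : E.n ≤ treeSize (K + 1))
    (h : SweepInv E Q V K a b c s) (hb : b < E.n) (ha : a < E.n) (hc : E.rankX b ≤ E.rankX c)
    (hab : E.rankX a ≤ E.rankX b) :
    sweepInsert.Within E s ((K + 1) * (insBody.steps + 1) + 8) (SweepInv E Q V K (a + 1) b c) := by
  have hQa := hE.Q_lt a ha
  have hp := h.prepared
  have hx : (load .partner Var.a).eval E s = Q a := by simp [h.reg_a, hp.partner a ha]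
  refine Within.assign_seq (T := (K + 1) * (insBody.steps + 1) + 6 + 1)
    (Within.seq (T := (K + 1) * (insBody.steps + 1) + 4 + 2) ?_)
  rw [hx]
  have e1 : (lineOf .a).eval E (s.setV .x (Q a)) = V a :=
    Prepared.lineOf hE hV (s := s.setV .x (Q a)) (v := .a) ⟨hp.1, hp.2, hp.3, hp.4⟩
      (by simp [h.reg_a]) ha
  have e2 : (lineOf .x).eval E (s.setV .x (Q a)) = V (Q a) :=
    Prepared.lineOf hE hV (s := s.setV .x (Q a)) (v := .x) ⟨hp.1, hp.2, hp.3, hp.4⟩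
      (by simp) hQa
  have fin : ∀ s', TreeFrame s s' → s'.reg .ans = s.reg .ans →
      LazyTree.Rep E.n treeSize (K + 1) s'.heap 1 (active V Q (a + 1) c) →
      (assign .a (Var.a + 1)).Within E s' 1 (SweepInv E Q V K (a + 1) b c) := by
    intro s' hf hans hr
    have hs' := hf.prepared hp
    refine Within.assign ⟨⟨hs'.1, hs'.2, hs'.3, hs'.4⟩, ?_, ?_, ?_, ?_, ?_, ?_, hr, ?_⟩
    · have := h.good
      rwa [← hf.tables] at this
    · simp [hf.2.2.2.2, h.top]
    · simp [hf.2.1, h.reg_a]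
    · simp [hf.2.2.1, h.reg_b]
    · simp [hf.2.2.2.1, h.reg_c]
    · exact h.pointers.insert hb ha hc hab
    · simpa [hans] using h.ans
  refine within_guarded (fun h1 h2 => ?_) fun h1 => ?_
  · rw [Ne, eval_lt_eq_zero] at h1
    rw [Ne, eval_eq_eq_zero, e1, e2, not_not] at h2
    simp only [eval_var, Store.setV_reg, if_true, reduceCtorEq, if_false, h.reg_a, not_le] at h1
    obtain ⟨hm, he⟩ := active_insert hF hn h.pointers ha hc hab ⟨h1, h2⟩
    refine Within.assign_seq (Within.assign_seq (Within.assign_seq ?_))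
    rw [e1]
    refine ((within_insLoop E _).frame.mono ?_ fun s' hs' => ?_)
    · simp [h.top]
    · obtain ⟨⟨hf, hh⟩, hr, -⟩ := hs'
      have hans := hr .ans (by simp [insLoop, insBody, insSwap, insPush, locate, setNode, Keeps])
      refine fin s' (TreeFrame.trans ?_ hf) (hans.trans (by simp)) ?_
      · simp [TreeFrame]
      · have hd := (ins_spec rfl (fun _ => rfl) K (s.tables E.n) h.good s.heap 1 _ (V a) one_pos
          h.rep hm ((hF.V_lt a ha).trans_le hK) (hF.V_lt a ha)).1
        rw [he]
        rw [hh]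
        simpa [h.top] using hd
  · refine fin _ (by simp [TreeFrame]) (by simp) ?_
    rw [active_insert_of_not]
    · exact h.rep
    · rintro ⟨h2, h3⟩
      refine h1 ⟨?_, ?_⟩
      · rw [Ne, eval_lt_eq_zero]
        simp [h.reg_a, h2]
      · rw [Ne, eval_eq_eq_zero, e1, e2, not_not, h3]

/-- Only an endpoint with rank below that of its partner triggers a search. For every other endpoint
the set of crossings found so far is unchanged by advancing `b`. -/
theorem SweepInv.query (hE : E.Paired Q) (hV : ∀ k < E.n, V k = E.rankY (E.inp k))
    (hF : Family E.n E.rankX V Q)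
    (h : SweepInv E Q V K a b c s) (hb : b < E.n) (hc : E.rankX b ≤ E.rankX c)
    (hab : ¬ (a < E.n ∧ E.rankX a ≤ E.rankX b)) :
    sweepQuery.Within E s ((K + 1) * (qryBody.steps + 1) + 8) (SweepInv E Q V K a (b + 1) c) := by
  have hQb := hE.Q_lt b hb
  have hp := h.prepared
  have hx : (load .partner Var.b).eval E s = Q b := by simp [h.reg_b, hp.partner b hb]
  refine Within.assign_seq (T := (K + 1) * (qryBody.steps + 1) + 7) (Within.assign_seq
    (Within.assign_seq (T := (K + 1) * (qryBody.steps + 1) + 4 + 1)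
    (Within.seq (T := (K + 1) * (qryBody.steps + 1) + 3 + 1) ?_)))
  rw [hx]
  have e1 : (lineOf .x).eval E (s.setV .x (Q b)) = V (Q b) :=
    Prepared.lineOf hE hV (s := s.setV .x (Q b)) (v := .x) ⟨hp.1, hp.2, hp.3, hp.4⟩
      (by simp) hQb
  rw [e1]
  have e2 : (lineOf .b).eval E ((s.setV .x (Q b)).setV .y (V (Q b))) = V b :=
    Prepared.lineOf hE hV (s := (s.setV .x (Q b)).setV .y (V (Q b))) (v := .b)
      ⟨hp.1, hp.2, hp.3, hp.4⟩ (by simp [h.reg_b]) hb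
  rw [e2]
  have hcr := crossing_succ hF h.pointers hb hc hab
  have fin : ∀ s', TreeFrame s s' → s'.heap = s.heap →
      (Crossing E.n E.rankX V Q (b + 1) ∧ s'.reg .ans = 1 ∨
        ¬ Crossing E.n E.rankX V Q (b + 1) ∧ s'.reg .ans = 0) →
      (assign .b (Var.b + 1)).Within E s' 1 (SweepInv E Q V K a (b + 1) c) := by
    intro s' hf hh hans
    have hs' := hf.prepared hp
    refine Within.assign ⟨⟨hs'.1, hs'.2, hs'.3, hs'.4⟩, ?_, ?_, ?_, ?_, ?_, ?_, ?_, ?_⟩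
    · have := h.good
      rwa [← hf.tables] at this
    · simp [hf.2.2.2.2, h.top]
    · simp [hf.2.1, h.reg_a]
    · simp [hf.2.2.1, h.reg_b]
    · simp [hf.2.2.2.1, h.reg_c]
    · exact h.pointers.query hF hb hab
    · have := h.rep
      rwa [← hh] at this
    · simpa using hans
  refine Within.ite (fun h1 => ?_) fun h1 => ⟨0, _, Nat.zero_le _, Ev.skip _, ?_⟩
  · rw [Ne, eval_lt_eq_zero] at h1
    simp only [eval_var, Store.setV_reg, if_true, reduceCtorEq, if_false, not_le] at h1
    refine Within.assign_seq (Within.assign_seq ?_)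
    refine ((within_qryLoop E _).mono ?_ fun s' hs' => ?_)
    · simp [h.top]
    · obtain ⟨hf, hh, hans⟩ := hs'
      have hq := qry_spec (K + 1) (s.tables E.n) h.good s.heap 1 _ (V b) (V (Q b)) h.rep h1.le
        (hF.V_lt _ hQb)
      have hans' : s'.reg .ans = if qry E.n (s.tables E.n) s.heap (K + 1) 1 (V b) (V (Q b)) = true
          then 1 else s.reg .ans := by
        rw [hans]
        simp [h.top]
      refine fin s' (TreeFrame.trans ?_ hf) (hh.trans rfl) ?_
      · simp [TreeFrame]
      · rw [hcr, hans']
        by_cases hy : ∃ y ∈ active V Q a c, V b ≤ y ∧ y ≤ V (Q b)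
        · rw [if_pos (hq.2 hy)]
          exact Or.inl ⟨Or.inr ⟨h1, hy⟩, rfl⟩
        · rw [if_neg (mt hq.1 hy)]
          simpa [hy] using h.ans
  · rw [eval_lt_eq_zero] at h1
    simp only [eval_var, Store.setV_reg, if_true, reduceCtorEq, if_false] at h1
    refine fin _ (by simp [TreeFrame]) rfl ?_
    rw [hcr]
    simpa [not_lt.2 h1] using h.ans

/-- The time for one step of the sweep, with trees of `k` levels. -/
def sweepTime (k : ℕ) : ℕ := k * (insBody.steps + delBody.steps + qryBody.steps + 1) + 10

theorem SweepInv.step (hE : E.Paired Q) (hV : ∀ k < E.n, V k = E.rankY (E.inp k))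
    (hF : Family E.n E.rankX V Q) (hn : ¬ Conflict E.rankX V Q E.n)
    (hK : E.n ≤ treeSize (K + 1)) (h : SweepInv E Q V K a b c s) (hb : b < E.n) :
    sweepBody.Within E s (sweepTime (K + 1)) fun s' => ∃ a' b' c', a' + b' + c' = a + b + c + 1 ∧
      SweepInv E Q V K a' b' c' s' := by
  have hcb := h.pointers.cb
  have hp := h.prepared
  have ht : ∀ t ≤ insBody.steps + delBody.steps + qryBody.steps, (K + 1) * (t + 1) + 8 ≤
      (K + 1) * (insBody.steps + delBody.steps + qryBody.steps + 1) + 8 := fun t ht => by gcongr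
  refine Within.ite (T := (K + 1) * (insBody.steps + delBody.steps + qryBody.steps + 1) + 8 + 1)
    (fun h1 => ?_) fun h1 => ?_
  · rw [Ne, eval_lt_eq_zero, eval_load, eval_load, eval_var, eval_var, h.reg_b, h.reg_c,
      hp.rankX _ hb, hp.rankX _ (by omega), not_le] at h1
    exact (h.delete hE hV hF hn hb h1).mono ((ht _ (by omega)).trans (Nat.le_succ _))
      fun s' h' => ⟨a, b, c + 1, by omega, h'⟩
  · rw [eval_lt_eq_zero, eval_load, eval_load, eval_var, eval_var, h.reg_b, h.reg_c,
      hp.rankX _ hb, hp.rankX _ (by omega)] at h1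
    have hcond : (lt Var.a size * lt (load .rankX Var.a) (load .rankX Var.b + 1)).eval E s = 0 ↔
        ¬ (a < E.n ∧ E.rankX a ≤ E.rankX b) := by
      rw [eval_mul, mul_eq_zero, eval_lt_eq_zero, eval_lt_eq_zero]
      simp only [eval_var, eval_size, eval_add, eval_load, eval_one, h.reg_a, h.reg_b,
        hp.rankX _ hb]
      by_cases ha : a < E.n
      · simp [ha, not_le.2 ha, hp.rankX _ ha]
      · simp [ha, not_lt.1 ha]
    refine Within.ite (fun h2 => ?_) fun h2 => ?_
    · rw [Ne, hcond, not_not] at h2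
      exact (h.insert hE hV hF hn hK hb h2.1 h1 h2.2).mono (ht _ (by omega))
        fun s' h' => ⟨a + 1, b, c, by omega, h'⟩
    · rw [hcond] at h2
      exact (h.query hE hV hF hb h1 h2).mono (ht _ (by omega))
        fun s' h' => ⟨a, b + 1, c, by omega, h'⟩

/-- Every step advances exactly one of three pointers that never exceed `n`, so `3 * n` steps
suffice. When `b` reaches `n`, all vertical segments have been queried. -/
theorem within_sweep (hE : E.Paired Q) (hV : ∀ k < E.n, V k = E.rankY (E.inp k))
    (hF : Family E.n E.rankX V Q) (hn : ¬ Conflict E.rankX V Q E.n)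
    (hK : E.n ≤ treeSize (K + 1)) (hp : Prepared E Q s)
    (hT : (s.tables E.n).Good E.n treeSize (K + 1)) (htop : s.reg .top = K + 1)
    (hmn : s.mem .mn = fun _ => 0) (hmx : s.mem .mx = fun _ => 0) (hans : s.reg .ans = 0) :
    sweep.Within E s (3 * E.n * (sweepTime (K + 1) + 1) + 4) fun s' =>
      Crossing E.n E.rankX V Q E.n ∧ s'.reg .ans = 1 ∨
        ¬ Crossing E.n E.rankX V Q E.n ∧ s'.reg .ans = 0 := by
  refine Within.assign_seq (Within.assign_seq (Within.assign_seq ?_))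
  refine (Within.loop (fun j s' => ∃ a b c, j + (a + b + c) = 3 * E.n ∧
    SweepInv E Q V K a b c s') ?_ _ _ ⟨0, 0, 0, by omega, ?_⟩).mono le_rfl ?_
  · rintro j s' ⟨a, b, c, hj, h⟩ he
    rw [Ne, eval_lt_eq_zero, eval_var, eval_size, h.reg_b, not_le] at he
    have := h.pointers.an
    have := h.pointers.cb
    refine ⟨j - 1, by omega, (h.step hE hV hF hn hK he).mono le_rfl ?_⟩
    rintro s'' ⟨a', b', c', h1, h2⟩
    exact ⟨a', b', c', by omega, h2⟩
  · refine ⟨⟨hp.1, hp.2, hp.3, hp.4⟩, hT, by simp [htop], by simp, by simp, by simp, ?_, ?_, ?_⟩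
    · exact ⟨le_rfl, le_rfl, Nat.zero_le _, fun _ p hp => absurd hp (Nat.not_lt_zero p),
        fun _ p hp => absurd hp (Nat.not_lt_zero p), fun _ p hp => absurd hp (Nat.not_lt_zero p)⟩
    · rw [active_zero]
      simp only [Store.heap, Store.setV_mem, hmn, hmx]
      exact rep_zero _ _
    · refine Or.inr ⟨?_, by simp [hans]⟩
      rintro ⟨b, hb, -⟩
      exact absurd hb (Nat.not_lt_zero b)
  · rintro s' ⟨⟨j, a, b, c, hj, h⟩, he⟩
    rw [eval_lt_eq_zero, eval_var, eval_size, h.reg_b] at he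
    have h1 := h.pointers.an
    have h2 := h.pointers.ba
    have h3 := h.ans
    rwa [show b = E.n by omega] at h3

end RealRAM

/-! ### The complete program and its time budget -/

namespace RealRAM

open RealRAM.Expr RealRAM.Cmd LazyTree Sweep

/-- Decide whether two segments intersect: first search for conflicts between parallel segments,
and then sweep over the points. -/
def intersect : Cmd :=
  forLoop .i prepBody ;; forLoop .i collideX ;; forLoop .i collideY ;; divTables ;;
    ite Var.ans skip sweep

/-- The constant in the running time. -/
def intersectConst : ℕ := prepBody.steps + collideX.steps + collideY.steps + divStep.steps +
  3 * (insBody.steps + delBody.steps + qryBody.steps) + 100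

/-- The sweep is skipped if a conflict has been found. This settles the answer in that case and
otherwise supplies the absence of conflicts between horizontal segments on which the sweep relies.
-/
theorem within_intersect {E : Env} {Q V I : ℕ → ℕ} (hE : E.Paired Q)
    (hV : ∀ k < E.n, V k = E.rankY (E.inp k)) (hI : ∀ k < E.n, I k < E.n ∧ E.inp (I k) = k)
    (hF : Family E.n E.rankX V Q) :
    intersect.Within E ⟨fun _ => 0, fun _ _ => 0⟩ (intersectConst * ((E.n + 1) * levels E.n))
      fun s => ((Conflict E.rankX V Q E.n ∨
          Conflict E.rankY (fun k => E.rankX (I k)) (fun k => E.inp (Q (I k))) E.n) ∨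
          Crossing E.n E.rankX V Q E.n) ∧ s.reg .ans = 1 ∨
        ¬ ((Conflict E.rankX V Q E.n ∨
          Conflict E.rankY (fun k => E.rankX (I k)) (fun k => E.inp (Q (I k))) E.n) ∨
          Crossing E.n E.rankX V Q E.n) ∧ s.reg .ans = 0 := by
  refine (Within.seq ((within_prep hE).mono le_rfl fun s₁ h1 => ?_)).mono
    (T := E.n * (prepBody.steps + 2) + 2 + (E.n * (collideX.steps + 2) + 2 +
      (E.n * (collideY.steps + 2) + 2 + (levels E.n * (E.n * (divStep.steps + 2) + 8) + 4 +
      (3 * E.n * (sweepTime (levels E.n) + 1) + 4 + 1))))) ?_ fun s' h => h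
  · obtain ⟨p1, a1, z1⟩ := h1
    refine Within.seq ((within_collideX hE hV p1 (P := False) (z1 _ (by simp) (by simp) (by simp)
      (by simp) (by simp)) (by simp [a1])).mono le_rfl fun s₂ h2 => ?_)
    obtain ⟨p2, f2, a2⟩ := h2
    rw [false_or] at a2
    refine Within.seq ((within_collideY hE hI p2 (P := Conflict E.rankX V Q E.n)
      (by rw [f2 _ (by simp), z1 _ (by simp) (by simp) (by simp) (by simp) (by simp)])
      a2).mono le_rfl fun s₃ h3 => ?_)
    obtain ⟨p3, f3, a3⟩ := h3
    refine Within.seq ((within_divTables E s₃).frame.mono le_rfl fun s₄ h4 => ?_)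
    obtain ⟨⟨K, top, hK, hn, hT⟩, r4, f4⟩ := h4
    have r5 := r4 .ans (by simp [divTables, divTable, divStep, forLoop, Keeps])
    have hm : ∀ A, A ≠ .div → A ≠ .mod → A ≠ .size → s₄.mem A = s₃.mem A := fun A h1 h2 h3 =>
      f4 A (by simp [divTables, divTable, divStep, forLoop, KeepsArr, h1, h2, h3])
    have p4 : Prepared E Q s₄ := p3.congr (hm _ (by simp) (by simp) (by simp))
      (hm _ (by simp) (by simp) (by simp)) (hm _ (by simp) (by simp) (by simp))
      (hm _ (by simp) (by simp) (by simp))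
    refine Within.ite (fun ha => ⟨0, _, Nat.zero_le _, Ev.skip _, ?_⟩) fun ha => ?_
    · rw [eval_var, r5] at ha
      beta_reduce
      rw [r5]
      rcases a3 with ⟨h, h'⟩ | ⟨-, h'⟩
      · exact Or.inl ⟨Or.inl h, h'⟩
      · exact absurd h' ha
    · rw [eval_var, r5] at ha
      have hno := (a3.resolve_left fun h => by omega).1
      refine (within_sweep hE hV hF (fun h => hno (Or.inl h)) hn p4 hT top ?_ ?_
        (r5.trans ha)).mono ?_ fun s' h' => ?_
      · rw [hm _ (by simp) (by simp) (by simp), f3 _ (by simp), f2 _ (by simp),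
          z1 _ (by simp) (by simp) (by simp) (by simp) (by simp)]
      · rw [hm _ (by simp) (by simp) (by simp), f3 _ (by simp), f2 _ (by simp),
          z1 _ (by simp) (by simp) (by simp) (by simp) (by simp)]
      · unfold sweepTime
        gcongr
      · simpa only [hno, false_or] using h'
  · have hL : 1 ≤ levels E.n := by rw [levels]; omega
    unfold sweepTime intersectConst
    generalize levels E.n = L at hL ⊢
    generalize E.n = n
    generalize prepBody.steps = x₁
    generalize collideX.steps = x₂
    generalize collideY.steps = x₃
    generalize divStep.steps = x₄
    generalize insBody.steps = x₅
    generalize delBody.steps = x₆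
    generalize qryBody.steps = x₇
    obtain ⟨L, rfl⟩ := Nat.exists_eq_add_of_le hL
    ring_nf
    nlinarith [Nat.zero_le (n * L), Nat.zero_le L, Nat.zero_le n, Nat.zero_le (L * x₁)]

end RealRAM

/-! ## Intersections of axis-parallel segments -/

namespace AxisSegments

open Sweep Set

variable {m n : ℕ}

/-- The other endpoint of the same segment. -/
def other (p : Fin m × Bool) : Fin m × Bool := (p.1, !p.2)

@[simp] theorem other_other (p : Fin m × Bool) : other (other p) = p := by simp [other]

theorem other_ne (p : Fin m × Bool) : other p ≠ p := by
  intro h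
  simpa [other] using congrArg Prod.snd h

theorem eq_or_eq_other {p q : Fin m × Bool} (h : p.1 = q.1) : q = p ∨ q = other p := by
  obtain ⟨i, b⟩ := p
  obtain ⟨j, c⟩ := q
  obtain rfl : i = j := h
  cases b <;> cases c <;> simp [other]

/-- The range of a coordinate on a segment. -/
def range (f : Fin m × Bool → ℝ) (i : Fin m) : Set ℝ := uIcc (f (i, false)) (f (i, true))

/-- A coordinate is constant on a segment. -/
def Const (f : Fin m × Bool → ℝ) (i : Fin m) : Prop := f (i, false) = f (i, true)

theorem range_eq (f : Fin m × Bool → ℝ) (p : Fin m × Bool) :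
    range f p.1 = uIcc (f p) (f (other p)) := by
  obtain ⟨i, b⟩ := p
  cases b
  · rfl
  · exact uIcc_comm _ _

theorem const_iff {f : Fin m × Bool → ℝ} (p : Fin m × Bool) :
    Const f p.1 ↔ f p = f (other p) := by
  obtain ⟨i, b⟩ := p
  cases b
  · rfl
  · exact eq_comm

theorem Const.eq {f : Fin m × Bool → ℝ} {p : Fin m × Bool} (h : Const f p.1) {y : ℝ}
    (hy : y ∈ range f p.1) : y = f p := by
  rw [range_eq, ← (const_iff p).1 h, uIcc_self] at hy
  exact hy

/-- One coordinate is constant, so the segment is a degenerate box, and intersection can be tested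
in each coordinate separately. -/
theorem seg_eq (S : AxisSegments m) (i : Fin m) :
    S.seg i = range (fun p => (S.endpt p).1) i ×ˢ range (fun p => (S.endpt p).2) i := by
  have h := S.axis_parallel i
  unfold seg range
  beta_reduce
  generalize S.endpt (i, false) = p at h ⊢
  generalize S.endpt (i, true) = q at h ⊢
  obtain ⟨a, b⟩ := p
  obtain ⟨c, d⟩ := q
  rcases h with h | h <;> obtain rfl := h
  · rw [uIcc_self, singleton_prod, ← segment_eq_uIcc, Prod.image_mk_segment_right]
  · rw [uIcc_self, prod_singleton, ← segment_eq_uIcc, Prod.image_mk_segment_left]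

/-- The endpoints are numbered by increasing values of `X`, and `U` and `V` rank the values of `X`
and `Y`. -/
structure Numbering (X Y : Fin m × Bool → ℝ) (e : Fin n ≃ Fin m × Bool) (U V Q : ℕ → ℕ) :
    Prop where
  U_le : ∀ p q, U (e.symm p) ≤ U (e.symm q) ↔ X p ≤ X q
  V_le : ∀ p q, V (e.symm p) ≤ V (e.symm q) ↔ Y p ≤ Y q
  Q_eq : ∀ p, Q (e.symm p) = e.symm (other p)
  mono : ∀ p q, e.symm p ≤ e.symm q → X p ≤ X q

variable {X Y : Fin m × Bool → ℝ} {e : Fin n ≃ Fin m × Bool} {U V Q : ℕ → ℕ}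

theorem Numbering.V_eq (h : Numbering X Y e U V Q) (p q : Fin m × Bool) :
    V (e.symm p) = V (e.symm q) ↔ Y p = Y q := by
  rw [le_antisymm_iff, le_antisymm_iff, h.V_le, h.V_le]

theorem Numbering.V_lt (h : Numbering X Y e U V Q) (p q : Fin m × Bool) :
    V (e.symm p) < V (e.symm q) ↔ Y p < Y q := by
  rw [← not_le, ← not_le, h.V_le]

theorem Numbering.leftEnd (h : Numbering X Y e U V Q) (p : Fin m × Bool) :
    LeftEnd V Q (e.symm p) ↔ e.symm p < e.symm (other p) ∧ Const Y p.1 := by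
  rw [LeftEnd, h.Q_eq, h.V_eq, const_iff, Fin.lt_def]

theorem Numbering.exists_first (h : Numbering X Y e U V Q) (i : Fin m) :
    ∃ p : Fin m × Bool, p.1 = i ∧ e.symm p < e.symm (other p) ∧
      range X i = Icc (X p) (X (other p)) := by
  have key : ∀ p : Fin m × Bool, e.symm p < e.symm (other p) →
      range X p.1 = Icc (X p) (X (other p)) := fun p hp => by
    rw [range_eq, uIcc_of_le (h.mono _ _ hp.le)]
  have hne : e.symm (i, false) ≠ e.symm (other (i, false)) := fun hc =>
    other_ne _ (e.symm.injective hc).symm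
  rcases lt_or_gt_of_ne hne with h1 | h1
  · exact ⟨_, rfl, h1, key _ h1⟩
  · have h2 : e.symm (other (i, false)) < e.symm (other (other (i, false))) := by
      rwa [other_other]
    exact ⟨other (i, false), rfl, h2, key _ h2⟩

theorem exists_symm (e : Fin n ≃ Fin m × Bool) {k : ℕ} (hk : k < n) :
    ∃ p, (e.symm p : ℕ) = k := ⟨e ⟨k, hk⟩, by simp⟩

/-- Two closed intervals on a line meet exactly if the one that starts later starts no later than
the other one ends. -/
theorem Numbering.conflict_iff (h : Numbering X Y e U V Q) : Conflict U V Q n ↔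
    ∃ i j, i ≠ j ∧ Const Y i ∧ Const Y j ∧ (range X i ∩ range X j).Nonempty ∧
      (range Y i ∩ range Y j).Nonempty := by
  constructor
  · rintro ⟨j, k, hjk, hk, h1, h2, h3, h4⟩
    obtain ⟨p, rfl⟩ := exists_symm e (hjk.trans hk)
    obtain ⟨q, rfl⟩ := exists_symm e hk
    rw [h.leftEnd] at h1 h2
    rw [h.Q_eq, h.U_le] at h4
    rw [h.V_eq] at h3
    refine ⟨p.1, q.1, fun hpq => ?_, h1.2, h2.2, ⟨X q, ?_, ?_⟩, ⟨Y p, ?_, ?_⟩⟩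
    · rcases eq_or_eq_other hpq with rfl | rfl
      · exact hjk.false
      · rw [other_other] at h2
        exact h1.1.asymm h2.1
    · rw [range_eq, uIcc_of_le (h.mono _ _ h1.1.le)]
      exact ⟨h.mono _ _ (Fin.le_def.2 hjk.le), h4⟩
    · rw [range_eq]
      exact left_mem_uIcc
    · rw [range_eq]
      exact left_mem_uIcc
    · rw [range_eq, h3]
      exact left_mem_uIcc
  · rintro ⟨i, j, hij, h1, h2, ⟨x, hx, hx'⟩, ⟨y, hy, hy'⟩⟩
    obtain ⟨p, rfl, hp, hp'⟩ := h.exists_first i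
    obtain ⟨q, rfl, hq, hq'⟩ := h.exists_first j
    rw [hp'] at hx
    rw [hq'] at hx'
    have hY : Y p = Y q := (h1.eq hy).symm.trans (h2.eq hy')
    have hne : e.symm p ≠ e.symm q := fun hc => hij (by rw [e.symm.injective hc])
    rcases lt_or_gt_of_ne hne with h3 | h3
    · refine ⟨e.symm p, e.symm q, h3, (e.symm q).2, (h.leftEnd p).2 ⟨hp, h1⟩,
        (h.leftEnd q).2 ⟨hq, h2⟩, (h.V_eq p q).2 hY, ?_⟩
      rw [h.Q_eq, h.U_le]
      exact hx'.1.trans hx.2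
    · refine ⟨e.symm q, e.symm p, h3, (e.symm p).2, (h.leftEnd q).2 ⟨hq, h2⟩,
        (h.leftEnd p).2 ⟨hp, h1⟩, (h.V_eq q p).2 hY.symm, ?_⟩
      rw [h.Q_eq, h.U_le]
      exact hx.1.trans hx'.2

/-- By `hXY` a segment with nonconstant `Y` has constant `X`, so its lower endpoint carries its
abscissa and its partner the upper end of its range. -/
theorem Numbering.crossing_iff (h : Numbering X Y e U V Q) (hXY : ∀ i, Const X i ∨ Const Y i) :
    Crossing n U V Q n ↔ ∃ i j, Const Y i ∧ ¬ Const Y j ∧ (range X i ∩ range X j).Nonempty ∧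
      (range Y i ∩ range Y j).Nonempty := by
  constructor
  · rintro ⟨b, hb, k, hk, h1, h2, h3, h4, h5, h6⟩
    obtain ⟨p, rfl⟩ := exists_symm e hk
    obtain ⟨q, rfl⟩ := exists_symm e hb
    rw [h.leftEnd] at h1
    rw [h.Q_eq, h.V_lt] at h2
    rw [h.U_le] at h3
    rw [h.Q_eq, h.U_le] at h4
    rw [h.V_le] at h5
    rw [h.Q_eq, h.V_le] at h6
    refine ⟨p.1, q.1, h1.2, fun hc => h2.ne ((const_iff q).1 hc), ⟨X q, ?_, ?_⟩, ⟨Y p, ?_, ?_⟩⟩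
    · rw [range_eq, uIcc_of_le (h.mono _ _ h1.1.le)]
      exact ⟨h3, h4⟩
    · rw [range_eq]
      exact left_mem_uIcc
    · rw [range_eq]
      exact left_mem_uIcc
    · rw [range_eq, uIcc_of_le h2.le]
      exact ⟨h5, h6⟩
  · rintro ⟨i, j, h1, h2, ⟨x, hx, hx'⟩, ⟨y, hy, hy'⟩⟩
    obtain ⟨p, rfl, hp, hp'⟩ := h.exists_first i
    obtain ⟨q, rfl, hq⟩ : ∃ q : Fin m × Bool, q.1 = j ∧ Y q < Y (other q) := by
      rcases lt_or_gt_of_ne h2 with h3 | h3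
      · exact ⟨(j, false), rfl, h3⟩
      · exact ⟨(j, true), rfl, h3⟩
    have hxq : x = X q := ((hXY q.1).resolve_right h2).eq hx'
    have hyp : y = Y p := h1.eq hy
    rw [hp'] at hx
    rw [range_eq, uIcc_of_le hq.le] at hy'
    subst hxq hyp
    refine ⟨e.symm q, (e.symm q).2, e.symm p, (e.symm p).2, (h.leftEnd p).2 ⟨hp, h1⟩, ?_⟩
    rw [h.Q_eq, h.Q_eq, h.V_lt, h.U_le, h.U_le, h.V_le, h.V_le]
    exact ⟨hq, hx.1, hx.2, hy'.1, hy'.2⟩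

/-- Two horizontal segments give a conflict, two non-horizontal ones a conflict with the axes
exchanged, and a mixed pair gives a crossing. -/
theorem intersecting_iff (S : AxisSegments m) {X Y : Fin m × Bool → ℝ}
    (hX : X = fun p => (S.endpt p).1) (hY : Y = fun p => (S.endpt p).2)
    {ex ey : Fin n ≃ Fin m × Bool} {U V Q U' V' Q' : ℕ → ℕ} (h : Numbering X Y ex U V Q)
    (h' : Numbering Y X ey U' V' Q') :
    (Conflict U V Q n ∨ Conflict U' V' Q' n) ∨ Crossing n U V Q n ↔ S.Intersecting := by
  have hXY : ∀ i, Const X i ∨ Const Y i := by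
    rw [hX, hY]
    exact S.axis_parallel
  have hI : S.Intersecting ↔ ∃ i j, i ≠ j ∧ (range X i ∩ range X j).Nonempty ∧
      (range Y i ∩ range Y j).Nonempty := by
    unfold Intersecting
    simp only [seg_eq, prod_inter_prod, prod_nonempty_iff, ← hX, ← hY]
  rw [hI, h.conflict_iff, h'.conflict_iff, h.crossing_iff hXY]
  constructor
  · rintro ((⟨i, j, h1, -, -, h2⟩ | ⟨i, j, h1, -, -, h2, h3⟩) | ⟨i, j, h1, h2, h3⟩)
    · exact ⟨i, j, h1, h2⟩
    · exact ⟨i, j, h1, h3, h2⟩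
    · exact ⟨i, j, fun hc => h2 (hc ▸ h1), h3⟩
  · rintro ⟨i, j, h1, h2, h3⟩
    by_cases hi : Const Y i
    · by_cases hj : Const Y j
      · exact Or.inl (Or.inl ⟨i, j, h1, hi, hj, h2, h3⟩)
      · exact Or.inr ⟨i, j, hi, hj, h2, h3⟩
    · by_cases hj : Const Y j
      · rw [inter_comm] at h2 h3
        exact Or.inr ⟨j, i, hj, hi, h2, h3⟩
      · exact Or.inl (Or.inr ⟨i, j, h1, (hXY i).resolve_right hi, (hXY j).resolve_right hj, h3, h2⟩)

end AxisSegments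

/-! ### The machine input as an environment -/

theorem List.getElem?_flatMap_pair {α β : Type*} (f g : α → β) (l : List α) (i : ℕ) :
    (l.flatMap fun a => [f a, g a])[2 * i]? = l[i]?.map f ∧
      (l.flatMap fun a => [f a, g a])[2 * i + 1]? = l[i]?.map g := by
  induction l generalizing i with
  | nil => simp
  | cons a l ih =>
    cases i with
    | zero => simp
    | succ i =>
      have := ih i
      simpa [mul_add, add_right_comm] using this

theorem List.length_flatMap_pair {α β : Type*} (f g : α → β) (l : List α) :
    (l.flatMap fun a => [f a, g a]).length = 2 * l.length := by
  induction l with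
  | nil => rfl
  | cons a l ih => simp [ih]; omega

namespace AxisSegments

open RealRAM Sweep

variable {m : ℕ}

/-- The integers of the input. -/
def inputInts (ex ey : Fin (2 * m) ≃ Fin m × Bool) : List ℕ :=
  (List.finRange (2 * m)).map (fun k => ((ex.trans ey.symm) k : ℕ)) ++
    (List.finRange (2 * m)).map (fun k => ((ex k).1 : ℕ))

/-- The input as an environment of the structured language. -/
def inputEnv (S : AxisSegments m) (ex ey : Fin (2 * m) ≃ Fin m × Bool) : Env :=
  ⟨2 * m, fun k => (inputInts ex ey).getD k 0,
    fun k => (S.pointArray ex ++ S.pointArray ey).getD k 0⟩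

variable (S : AxisSegments m) (ex ey : Fin (2 * m) ≃ Fin m × Bool)

theorem length_inputInts : (inputInts ex ey).length = 2 * (2 * m) := by
  simp [inputInts]; omega

theorem inputEnv_inp_perm (p : Fin m × Bool) :
    (S.inputEnv ex ey).inp (ex.symm p) = ey.symm p := by
  simp [inputEnv, inputInts, List.getElem?_append_left]

theorem inputEnv_inp_seg (p : Fin m × Bool) :
    (S.inputEnv ex ey).inp (2 * m + ex.symm p) = p.1 := by
  simp [inputEnv, inputInts]

theorem inputEnv_real_fst (p : Fin m × Bool) :
    (S.inputEnv ex ey).real (2 * (ex.symm p : ℕ)) = (S.endpt p).1 := by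
  have h := (List.getElem?_flatMap_pair (fun k => (S.endpt (ex k)).1) (fun k => (S.endpt (ex k)).2)
    (List.finRange (2 * m)) (ex.symm p)).1
  have hl := List.length_flatMap_pair (fun k => (S.endpt (ex k)).1) (fun k => (S.endpt (ex k)).2)
    (List.finRange (2 * m))
  have := (ex.symm p).2
  rw [List.length_finRange] at hl
  simp only [inputEnv, pointArray]
  rw [List.getD_append _ _ _ _ (by omega), List.getD_eq_getElem?_getD, h]
  simp

theorem inputEnv_real_snd (p : Fin m × Bool) :
    (S.inputEnv ex ey).real (2 * (2 * m) + (2 * (ey.symm p : ℕ) + 1)) = (S.endpt p).2 := by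
  have h := (List.getElem?_flatMap_pair (fun k => (S.endpt (ey k)).1) (fun k => (S.endpt (ey k)).2)
    (List.finRange (2 * m)) (ey.symm p)).2
  have hl := List.length_flatMap_pair (fun k => (S.endpt (ex k)).1) (fun k => (S.endpt (ex k)).2)
    (List.finRange (2 * m))
  rw [List.length_finRange] at hl
  simp only [inputEnv, pointArray]
  rw [List.getD_append_right _ _ _ _ (by omega), hl, Nat.add_sub_cancel_left,
    List.getD_eq_getElem?_getD, h]
  simp

variable {S ex ey}

theorem rankX_le_iff (hx : S.SortedByX ex) (p q : Fin m × Bool) :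
    (S.inputEnv ex ey).rankX (ex.symm p) ≤ (S.inputEnv ex ey).rankX (ex.symm q) ↔
      (S.endpt p).1 ≤ (S.endpt q).1 := by
  rw [Env.rankX, Env.rankX, rank_le_iff (n := 2 * m) (fun i hi => ?_) (ex.symm p).2 (ex.symm q).2,
    inputEnv_real_fst, inputEnv_real_fst]
  have h1 := S.inputEnv_real_fst ex ey (ex ⟨i, by omega⟩)
  have h2 := S.inputEnv_real_fst ex ey (ex ⟨i + 1, hi⟩)
  rw [Equiv.symm_apply_apply] at h1 h2
  rw [h1, h2]
  exact hx (Fin.le_def.2 (Nat.le_succ i))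

theorem rankY_le_iff (hy : S.SortedByY ey) (p q : Fin m × Bool) :
    (S.inputEnv ex ey).rankY (ey.symm p) ≤ (S.inputEnv ex ey).rankY (ey.symm q) ↔
      (S.endpt p).2 ≤ (S.endpt q).2 := by
  rw [Env.rankY, Env.rankY, rank_le_iff (n := 2 * m) (fun i hi => ?_) (ey.symm p).2 (ey.symm q).2]
  · exact (iff_of_eq (congrArg₂ _ (S.inputEnv_real_snd ex ey p) (S.inputEnv_real_snd ex ey q)))
  have h1 := S.inputEnv_real_snd ex ey (ey ⟨i, by omega⟩)
  have h2 := S.inputEnv_real_snd ex ey (ey ⟨i + 1, hi⟩)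
  rw [Equiv.symm_apply_apply] at h1 h2
  refine (h1.le.trans ?_).trans h2.ge
  exact hy (Fin.le_def.2 (Nat.le_succ i))

/-- The number of the other endpoint of the same segment. -/
def partner (ex : Fin (2 * m) ≃ Fin m × Bool) (k : ℕ) : ℕ :=
  if h : k < 2 * m then ex.symm (other (ex ⟨k, h⟩)) else 0

/-- The number in `x`-order of the `k`-th endpoint in `y`-order. -/
def invPerm (ex ey : Fin (2 * m) ≃ Fin m × Bool) (k : ℕ) : ℕ :=
  if h : k < 2 * m then ex.symm (ey ⟨k, h⟩) else 0

theorem partner_symm (p : Fin m × Bool) : partner ex (ex.symm p) = ex.symm (other p) := by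
  simp [partner]

theorem invPerm_symm (p : Fin m × Bool) : invPerm ex ey (ey.symm p) = ex.symm p := by
  simp [invPerm]

theorem inputEnv_paired : (S.inputEnv ex ey).Paired (partner ex) := by
  refine ⟨fun k hk => ?_, fun j hj k hk h => ?_, fun k hk => ?_, fun k hk => ?_, fun k hk => ?_,
    fun j hj k hk h => ?_, fun j hj => ?_⟩
  · obtain ⟨p, rfl⟩ := exists_symm ex hk
    rw [inputEnv_inp_perm]
    exact (ey.symm p).2
  · obtain ⟨p, rfl⟩ := exists_symm ex hj
    obtain ⟨q, rfl⟩ := exists_symm ex hk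
    rw [inputEnv_inp_perm, inputEnv_inp_perm, Fin.val_inj, ey.symm.injective.eq_iff] at h
    rw [h]
  · obtain ⟨p, rfl⟩ := exists_symm ex hk
    rw [partner_symm]
    exact (ex.symm _).2
  · obtain ⟨p, rfl⟩ := exists_symm ex hk
    rw [partner_symm, partner_symm, other_other]
  · obtain ⟨p, rfl⟩ := exists_symm ex hk
    rw [partner_symm, Ne, Fin.val_inj, ex.symm.injective.eq_iff]
    exact other_ne p
  · obtain ⟨p, rfl⟩ := exists_symm ex hj
    obtain ⟨q, rfl⟩ := exists_symm ex hk
    have h' : ((p.1 : Fin m) : ℕ) = q.1 := by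
      rw [← S.inputEnv_inp_seg ex ey, ← S.inputEnv_inp_seg ex ey]
      exact h
    rw [partner_symm]
    rcases eq_or_eq_other (Fin.ext h') with rfl | rfl
    · exact Or.inl rfl
    · exact Or.inr rfl
  · obtain ⟨p, rfl⟩ := exists_symm ex hj
    rw [partner_symm]
    exact (S.inputEnv_inp_seg ex ey _).trans (S.inputEnv_inp_seg ex ey p).symm

theorem invPerm_spec (k : ℕ) (hk : k < (S.inputEnv ex ey).n) :
    invPerm ex ey k < (S.inputEnv ex ey).n ∧ (S.inputEnv ex ey).inp (invPerm ex ey k) = k := by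
  obtain ⟨p, rfl⟩ := exists_symm ey hk
  rw [invPerm_symm, inputEnv_inp_perm]
  exact ⟨(ex.symm p).2, rfl⟩

theorem inputEnv_family : Family (S.inputEnv ex ey).n (S.inputEnv ex ey).rankX
    (fun k => (S.inputEnv ex ey).rankY ((S.inputEnv ex ey).inp k)) (partner ex) := by
  have hE := inputEnv_paired (S := S) (ex := ex) (ey := ey)
  exact ⟨fun j k hjk _ => rank_mono _ hjk, fun k hk => (rank_le _ _).trans_lt (hE.inp_lt k hk),
    hE.Q_lt, hE.Q_Q⟩

theorem numbering_x (hx : S.SortedByX ex) (hy : S.SortedByY ey) :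
    Numbering (fun p => (S.endpt p).1) (fun p => (S.endpt p).2) ex (S.inputEnv ex ey).rankX
      (fun k => (S.inputEnv ex ey).rankY ((S.inputEnv ex ey).inp k)) (partner ex) := by
  refine ⟨rankX_le_iff hx, fun p q => ?_, partner_symm, fun p q h => ?_⟩
  · rw [inputEnv_inp_perm, inputEnv_inp_perm, rankY_le_iff hy]
  · simpa using hx h

theorem numbering_y (hx : S.SortedByX ex) (hy : S.SortedByY ey) :
    Numbering (fun p => (S.endpt p).2) (fun p => (S.endpt p).1) ey (S.inputEnv ex ey).rankY
      (fun k => (S.inputEnv ex ey).rankX (invPerm ex ey k))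
      (fun k => (S.inputEnv ex ey).inp (partner ex (invPerm ex ey k))) := by
  refine ⟨rankY_le_iff hy, fun p q => ?_, fun p => ?_, fun p q h => ?_⟩
  · rw [invPerm_symm, invPerm_symm, rankX_le_iff hx]
  · rw [invPerm_symm, partner_symm, inputEnv_inp_perm]
  · simpa using hy h

/-- The running time for `n` endpoints. -/
def intersectTime (n : ℕ) : ℕ := intersect.weight * (intersectConst * ((n + 1) * levels n)) + 2

theorem decidesWithin_intersect (hx : S.SortedByX ex) (hy : S.SortedByY ey) :
    DecidesWithin intersect.program (S.ramInput ex ey) (intersectTime (2 * m)) S.Intersecting := by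
  obtain ⟨t, s, ht, hev, hs⟩ := within_intersect (inputEnv_paired (S := S) (ex := ex) (ey := ey))
    (fun _ _ => rfl) invPerm_spec inputEnv_family
  have hi := S.intersecting_iff rfl rfl (numbering_x hx hy) (numbering_y hx hy)
  refine Cmd.decidesWithin (length_inputInts ex ey) hev ?_
    (Nat.add_le_add_right (Nat.mul_le_mul_left _ ht) 2)
  rw [← hi]
  exact hs

end AxisSegments

/-! ### Asymptotics of the running time -/

namespace RealRAM

/-- Since `log 2 > 1 / 2`, the binary logarithm is at most twice the natural one. Two applications
give `levels n ≤ 2 log 2 + 2 log log n + 2`, and the constant part is absorbed by `log log n ≥ 1`.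
-/
theorem levels_le {n : ℕ} (h1 : 1 ≤ Real.log (Real.log n)) :
    (levels n : ℝ) ≤ 6 * Real.log (Real.log n) := by
  have h2 : (1 / 2 : ℝ) < Real.log 2 := by
    have := Real.log_two_gt_d9
    norm_num at this ⊢
    linarith
  have key : ∀ k : ℕ, (Nat.log 2 k : ℝ) ≤ 2 * Real.log k := by
    intro k
    rcases Nat.eq_zero_or_pos k with rfl | hk
    · simp
    have h3 : (2 : ℝ) ^ Nat.log 2 k ≤ k := by exact_mod_cast Nat.pow_log_le_self 2 hk.ne'
    have h4 := Real.log_le_log (by positivity) h3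
    rw [Real.log_pow] at h4
    have h5 : (0 : ℝ) ≤ Nat.log 2 k := Nat.cast_nonneg _
    nlinarith
  have hL : (Nat.log 2 (Nat.log 2 n) : ℝ) ≤ 2 * Real.log (2 * Real.log n) := by
    have hn : 0 < Real.log n := by
      by_contra hc
      have hn0 : Real.log (n : ℝ) = 0 := le_antisymm (not_lt.1 hc) (Real.log_natCast_nonneg n)
      rw [hn0, Real.log_zero] at h1
      linarith
    have h3 := key n
    rcases Nat.eq_zero_or_pos (Nat.log 2 n) with h0 | h0
    · have : 0 ≤ Real.log (2 * Real.log n) := by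
        rw [Real.log_mul two_ne_zero hn.ne']
        linarith
      rw [h0]
      simpa using this
    · refine (key _).trans ?_
      have := Real.log_le_log (by exact_mod_cast h0) h3
      linarith
  have hn : Real.log (n : ℝ) ≠ 0 := fun h => by rw [h, Real.log_zero] at h1; linarith
  rw [Real.log_mul two_ne_zero hn] at hL
  have h3 : Real.log 2 < 1 := by
    have := Real.log_two_lt_d9
    linarith
  rw [levels]
  push_cast
  linarith

end RealRAM

/-- The factor `12` comes from `n + 1 ≤ 2 * n` and `levels n ≤ 6 log log n`; the additive `2` is
absorbed because `n log log n ≥ 1`. -/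
theorem AxisSegments.isBigO_intersectTime :
    (fun n : ℕ => (intersectTime n : ℝ)) =O[atTop]
      fun n : ℕ => (n : ℝ) * Real.log (Real.log (n : ℝ)) := by
  have hlog : Tendsto (fun n : ℕ => Real.log (Real.log (n : ℝ))) atTop atTop :=
    Real.tendsto_log_atTop.comp (Real.tendsto_log_atTop.comp tendsto_natCast_atTop_atTop)
  refine IsBigO.of_bound ((RealRAM.intersect.weight * RealRAM.intersectConst : ℕ) * 12 + 2) ?_
  filter_upwards [hlog.eventually_ge_atTop 1, eventually_ge_atTop 1] with n hn h1
  have h1' : (1 : ℝ) ≤ n := by exact_mod_cast h1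
  have hL := RealRAM.levels_le hn
  have hnn : 0 ≤ (n : ℝ) * Real.log (Real.log (n : ℝ)) := by positivity
  rw [Real.norm_of_nonneg (Nat.cast_nonneg _), Real.norm_of_nonneg hnn, intersectTime]
  have h2 : ((n : ℝ) + 1) * RealRAM.levels n ≤ 12 * (n * Real.log (Real.log n)) := by
    calc ((n : ℝ) + 1) * RealRAM.levels n ≤ (2 * n) * (6 * Real.log (Real.log n)) := by
          gcongr
          linarith
      _ = _ := by ring
  have h3 : (1 : ℝ) ≤ n * Real.log (Real.log n) := by nlinarith
  have h4 := mul_le_mul_of_nonneg_left h2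
    (Nat.cast_nonneg (α := ℝ) (RealRAM.intersect.weight * RealRAM.intersectConst))
  push_cast at h4 ⊢
  linarith

theorem theorem5p3 :
    (∃ c : ℝ, 0 < c ∧ ∀ᶠ m : ℕ in atTop,
      ∃ e : Fin (2 * m) ≃ Fin m × Bool,
        ∀ T : ComparisonTree (Fin (2 * m) × Bool),
          (∀ S : AxisSegments m, S.SortedByX e →
            (T.eval (S.coords e) = true ↔ S.Intersecting)) →
          ∃ S : AxisSegments m, S.SortedByX e ∧
            c * ((2 * m : ℕ) : ℝ) * Real.log ((2 * m : ℕ) : ℝ) ≤ (T.cost (S.coords e) : ℝ)) ∧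
    (∃ (P : RealRAM.Program) (τ : ℕ → ℕ),
      ((fun n : ℕ => (τ n : ℝ)) =O[atTop] fun n : ℕ => (n : ℝ) * Real.log (Real.log (n : ℝ))) ∧
      ∀ (m : ℕ) (S : AxisSegments m) (ex ey : Fin (2 * m) ≃ Fin m × Bool),
        S.SortedByX ex → S.SortedByY ey →
          RealRAM.DecidesWithin P (S.ramInput ex ey) (τ (2 * m)) S.Intersecting) := by
  refine ⟨⟨1 / 20, by norm_num, ?_⟩, RealRAM.intersect.program, AxisSegments.intersectTime,
    AxisSegments.isBigO_intersectTime,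
    fun m S ex ey hx hy => AxisSegments.decidesWithin_intersect hx hy⟩
  filter_upwards [(Real.tendsto_log_atTop.comp
    tendsto_natCast_atTop_atTop).eventually_ge_atTop 4] with m hm
  exact ⟨AxisSegments.leftThenRight m, fun T hT => AxisSegments.exists_cost_lower_bound hm _
    AxisSegments.unitHorizontal_sortedByX T hT⟩
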